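/- **Setting.** Let $G$ be a connected matrix Lie group (a closed, path-connected subgroup of $GL_n(\mathbb R)$) with Lie algebra $\mathfrak g$, let $E_1,\dots,E_m$ be a basis of $\mathfrak g$ and $S(\zeta)=\sum_k\zeta_kE_k$ the corresponding isomorphism $\mathbb R^m\to\mathfrak g$. For $f:G\to\mathbb R$ let $L[f](g)$ be the vector with entries $\frac{d}{d\varepsilon}f(\exp(\varepsilon E_j)g)|_{\varepsilon=0}$; for a function of $(V,W)\in G\times G$ let $L_V,L_W$ denote this operator in one of the variables. Such a function is called differentiable in $V$ (in $W$) at a point if $L_V$ (respectively $L_W$) exists around the point and is continuous at it. An *EE-distance* is a continuous $\widehat D:G\times G\to[0,\infty)$ with $\widehat D(V,W)=0\iff V=W$ that is differentiable in both arguments almost everywhere and at all $(V,W)$ with $0<\widehat D(V,W)<D_{\min}$ for some $D_{\min}>0$, and such that at each point where it is not differentiable in $V$, the operator $L_V[\widehat D]$ has limits along all directions along which it exists and is locally bounded where it exists, and likewise for $W$. It is *left-invariant* if $\widehat D(AV,AW)=\widehat D(V,W)$; *chainable* if there is $\Phi:[0,1]\times G\times G\to G$, differentiable in $\sigma$, with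 $\Phi(0,V,W)=V$, $\Phi(1,V,W)=W$ and $\widehat D(V,W)=\widehat D(V,\Phi(\sigma,V,W))+\widehat D(\Phi(\sigma,V,W),W)$ for all $\sigma\in[0,1]$; and *locally linear* (for this $\Phi$) if $\lim_{\sigma\to0^+}\frac1\sigma\widehat D(A,\Phi(\sigma,A,B))$ exists and is positive for all $A\ne B$. Let $\mathcal C\subset G$ be a closed $C^1$ curve without self-intersections, with a parametrization $H_d$ of period $1$, injective on $[0,1)$, that is proper: $\xi_d(s)=S^{-1}(H_d'(s)H_d(s)^{-1})\neq0$ for all $s$. Let $\mathcal P_1$ be the set of $H$ for which $\min_{s\in[0,1)}\widehat D(H,H_d(s))$ does not have exactly one minimizer, and let $s^*(H)$ be the minimizer if $H\notin\mathcal P_1$. Let $\mathcal P_2$ be the set of $H\notin\mathcal P_1\cup\mathcal C$ such that $\widehat D$ is not differentiable in both arguments at $(H,H_d(s^*(H)))$, and let $\mathcal P=\mathcal P_1\cup\mathcal P_2$. Put $\xi_N(H)=-L_V[\widehat D](H,H_d(s^*(H)))^\top$, $\xi_T(H)=\xi_d(s^*(H))$ and $$\Psi(H)=k_N(H)\xi_N(H)+k_T(H)\xi_T(H)\qquad(H\notin\mathcal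 P),$$ with continuous $k_N,k_T:G\to\mathbb R$, where $k_T>0$ everywhere, $k_N=0$ on $\mathcal C$ and $k_N>0$ off $\mathcal C$; on $\mathcal C$ the first summand of $\Psi$ is $0$. **Theorem 1.** Let $\widehat D$ be a left-invariant, chainable and locally linear EE-distance, and $H_d$ a proper parametrization of the closed curve $\mathcal C$ as above. Then the closed-loop system $\dot H=S(\Psi(H))H$ has the following properties. (i) Let $H:[0,T)\to G\setminus\mathcal P$, $0<T\le\infty$, be a solution that cannot be extended to a longer interval. Then either $T=\infty$ and the distance of $H(t)$ to $\mathcal C$ tends to $0$ as $t\to\infty$, or the distance of $H(t)$ to $\mathcal P$ tends to $0$ as $t\to T$ (possibly $T<\infty$). (ii) $\mathcal P$ is escapable. For all $\varepsilon,\tau>0$ there is a policy $\pi:G\to\mathbb R^m$ with $\|\pi\|\le\varepsilon$ for which the following holds. Consider trajectories on $[0,\infty)$ that follow the closed loop outside $\mathcal P$, interrupted by manoeuvres of duration $\tau$: when the state has reached $\mathcal P$ (a manoeuvre may start only at a point $H(a)$ of the closure of $\mathcal P$ off $\mathcal C$, and one must be in progress whenever the state is in $\mathcal P$), the constant twist $\pi(H(a))$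 is applied during $[a,a+\tau]$. Such a trajectory exists from every initial state, and for every such trajectory there is a finite time $t'$ by which all manoeuvres have ended, and $H(t)\notin\mathcal P$ for all $t\ge t'$. (iii) Let $H$ be a solution as in (i). If $H(t)$ converges to $\mathcal C$, then $k_T\xi_T$ is never zero along $H$, and is even bounded away from zero. If $H(t_0)\in\mathcal C$ for some $t_0$, then $T=\infty$, and for all $t\ge t_0$ the state stays on $\mathcal C$ and moves with the nonzero twist $\Psi(H(t))=k_T(H(t))\xi_T(H(t))$. -/

import Mathlib

open Set Filter Topology MeasureTheory

noncomputable section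

namespace GuidanceField

/-- The invertible matrix `exp X`. -/
def expGL {n : ℕ} (X : Matrix (Fin n) (Fin n) ℝ) : GL (Fin n) ℝ where
  val := NormedSpace.exp X
  inv := NormedSpace.exp (-X)
  val_inv := by
    rw [← Matrix.exp_add_of_commute X (-X) (Commute.neg_right (Commute.refl X)), add_neg_cancel,
      NormedSpace.exp_zero]
  inv_val := by
    rw [← Matrix.exp_add_of_commute (-X) X (Commute.neg_left (Commute.refl X)), neg_add_cancel,
      NormedSpace.exp_zero]

/-- The Lie algebra of a (closed) matrix group `G`: all `X` whose one-parameter group lies in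
`G`. -/
def lieAlg {n : ℕ} (G : Subgroup (GL (Fin n) ℝ)) : Set (Matrix (Fin n) (Fin n) ℝ) :=
  {X | ∀ t : ℝ, expGL (t • X) ∈ G}

/-- A basis `E₁, …, Eₘ` of the Lie algebra of `G`; in particular `m = dim G`. -/
structure LieBasis {n : ℕ} (G : Subgroup (GL (Fin n) ℝ)) (m : ℕ) where
  E : Fin m → Matrix (Fin n) (Fin n) ℝ
  linearIndependent : LinearIndependent ℝ E
  span_eq : (Submodule.span ℝ (Set.range E) : Set (Matrix (Fin n) (Fin n) ℝ)) = lieAlg G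

/-- The matrix underlying an element of `G`. -/
def mat {n : ℕ} {G : Subgroup (GL (Fin n) ℝ)} (g : G) : Matrix (Fin n) (Fin n) ℝ :=
  ((g : GL (Fin n) ℝ) : Matrix (Fin n) (Fin n) ℝ)

section Basis

variable {n m : ℕ} {G : Subgroup (GL (Fin n) ℝ)} (B : LieBasis G m)

/-- The map `S : ℝᵐ → 𝔤`, `S(ζ) = ∑ ζₖ Eₖ`. -/
def LieBasis.S (ζ : EuclideanSpace ℝ (Fin m)) : Matrix (Fin n) (Fin n) ℝ :=
  ∑ k, ζ k • B.E k

/-- The inverse of `S` on the Lie algebra. -/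
def LieBasis.Sinv (X : Matrix (Fin n) (Fin n) ℝ) : EuclideanSpace ℝ (Fin m) :=
  Function.invFun B.S X

theorem LieBasis.expGL_S_mem (ζ : EuclideanSpace ℝ (Fin m)) : expGL (B.S ζ) ∈ G := by
  have h : B.S ζ ∈ (Submodule.span ℝ (Set.range B.E) : Set (Matrix (Fin n) (Fin n) ℝ)) :=
    Submodule.sum_mem _ fun k _ =>
      Submodule.smul_mem _ _ (Submodule.subset_span (Set.mem_range_self k))
  rw [B.span_eq] at h
  simpa using h 1

/-- `exp(S(ζ))` as an element of `G`. -/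
def LieBasis.expS (ζ : EuclideanSpace ℝ (Fin m)) : G := ⟨expGL (B.S ζ), B.expGL_S_mem ζ⟩

/-- The `m` directional derivatives at `0` of `ε ↦ f (exp(S(eⱼ) ε) g)` exist. -/
def LieBasis.LExists (f : G → ℝ) (g : G) : Prop :=
  ∀ j : Fin m, DifferentiableAt ℝ
    (fun ε : ℝ => f (B.expS (ε • EuclideanSpace.single j (1 : ℝ)) * g)) 0

/-- The row vector `L[f](g)` of these directional derivatives. -/
def LieBasis.L (f : G → ℝ) (g : G) : EuclideanSpace ℝ (Fin m) :=
  WithLp.toLp 2 fun j =>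
    deriv (fun ε : ℝ => f (B.expS (ε • EuclideanSpace.single j (1 : ℝ)) * g)) 0

/-- Existence of the partial operator `L_V[D](V, W)`. -/
def LieBasis.LVExists (D : G → G → ℝ) (V W : G) : Prop := B.LExists (fun V' => D V' W) V

/-- Existence of the partial operator `L_W[D](V, W)`. -/
def LieBasis.LWExists (D : G → G → ℝ) (V W : G) : Prop := B.LExists (fun W' => D V W') W

/-- The partial operator `L_V[D](V, W)`. -/
def LieBasis.LV (D : G → G → ℝ) (V W : G) : EuclideanSpace ℝ (Fin m) :=
  B.L (fun V' => D V' W) V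

/-- The partial operator `L_W[D](V, W)`. -/
def LieBasis.LW (D : G → G → ℝ) (V W : G) : EuclideanSpace ℝ (Fin m) :=
  B.L (fun W' => D V W') W

/-- `D` is differentiable in its first argument at `(V, W)`: `L_V[D]` exists around the point and
is continuous at it. -/
def LieBasis.DiffV (D : G → G → ℝ) (V W : G) : Prop :=
  (∀ᶠ p : G × G in 𝓝 (V, W), B.LVExists D p.1 p.2) ∧
    ContinuousAt (fun p : G × G => B.LV D p.1 p.2) (V, W)

/-- `D` is differentiable in its second argument at `(V, W)`. -/
def LieBasis.DiffW (D : G → G → ℝ) (V W : G) : Prop :=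
  (∀ᶠ p : G × G in 𝓝 (V, W), B.LWExists D p.1 p.2) ∧
    ContinuousAt (fun p : G × G => B.LW D p.1 p.2) (V, W)

/-- `D` is differentiable in both arguments at almost every pair, with respect to Haar measure on
the Borel sets. -/
def LieBasis.DiffAE (D : G → G → ℝ) : Prop :=
  letI : MeasurableSpace G := borel G
  ∀ μ : Measure G, μ.IsHaarMeasure → ∀ᵐ p : G × G ∂(μ.prod μ), B.DiffV D p.1 p.2 ∧ B.DiffW D p.1 p.2

/-- At `(V, W)`, the partially defined function `F` (with domain `dom`) has a limit along every
direction `(exp(S(ζ)ε)V, exp(S(η)ε)W)`, `ε → 0⁺`, along which it is defined, and it is bounded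
around `(V, W)`. -/
def LieBasis.BoundedDirectionalLimits (dom : G → G → Prop) (F : G → G → EuclideanSpace ℝ (Fin m))
    (V W : G) : Prop :=
  (∀ ζ η : EuclideanSpace ℝ (Fin m),
    (∀ᶠ ε : ℝ in 𝓝[>] 0, dom (B.expS (ε • ζ) * V) (B.expS (ε • η) * W)) →
    ∃ l, Tendsto (fun ε : ℝ => F (B.expS (ε • ζ) * V) (B.expS (ε • η) * W)) (𝓝[>] 0) (𝓝 l)) ∧
  ∃ K : ℝ, ∀ᶠ p : G × G in 𝓝 (V, W), dom p.1 p.2 → ‖F p.1 p.2‖ ≤ K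

/-- Element-to-element (EE-) distance functions. -/
structure IsEEDistance (D : G → G → ℝ) : Prop where
  nonneg : ∀ V W, 0 ≤ D V W
  eq_zero_iff : ∀ V W, D V W = 0 ↔ V = W
  continuous : Continuous fun p : G × G => D p.1 p.2
  diff_ae : B.DiffAE D
  diff_near : ∃ Dmin : ℝ, 0 < Dmin ∧
    ∀ V W, 0 < D V W → D V W < Dmin → B.DiffV D V W ∧ B.DiffW D V W
  limits_V : ∀ V W, ¬ B.DiffV D V W → B.BoundedDirectionalLimits (B.LVExists D) (B.LV D) V W
  limits_W : ∀ V W, ¬ B.DiffW D V W → B.BoundedDirectionalLimits (B.LWExists D) (B.LW D) V W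

end Basis

section Distances

variable {n : ℕ} {G : Subgroup (GL (Fin n) ℝ)}

/-- Left-invariance. -/
def IsLeftInvariant (D : G → G → ℝ) : Prop :=
  ∀ A V W : G, D (A * V) (A * W) = D V W

/-- Path generating functions; only parameters `σ ∈ [0,1]` matter. -/
structure IsPathGenerating (Φ : ℝ → G → G → G) : Prop where
  differentiable : ∀ V W, DifferentiableOn ℝ (fun σ => mat (Φ σ V W)) (Icc 0 1)
  zero : ∀ V W, Φ 0 V W = V
  one : ∀ V W, Φ 1 V W = W

/-- `D` is chainable along the path generating function `Φ`. -/
structure IsChainable (Φ : ℝ → G → G → G) (D : G → G → ℝ) : Prop where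
  path : IsPathGenerating Φ
  chain : ∀ V W, ∀ σ ∈ Icc (0 : ℝ) 1, D V W = D V (Φ σ V W) + D (Φ σ V W) W

/-- `D` is locally linear along `Φ`. -/
def IsLocallyLinear (Φ : ℝ → G → G → G) (D : G → G → ℝ) : Prop :=
  ∀ A C : G, A ≠ C → ∃ c : ℝ, 0 < c ∧
    Tendsto (fun σ : ℝ => (1 / σ) * D A (Φ σ A C)) (𝓝[>] 0) (𝓝 c)

/-- `s ∈ [0,1)` minimizes the distance from `H` to the points of the closed curve `Hd`. -/
def IsNearest (D : G → G → ℝ) (Hd : ℝ → G) (H : G) (s : ℝ) : Prop :=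
  s ∈ Ico (0 : ℝ) 1 ∧ ∀ s' ∈ Ico (0 : ℝ) 1, D H (Hd s) ≤ D H (Hd s')

open Classical in
/-- The unique minimizer `s*(H)` (a dummy value if it is not unique). -/
def sStar (D : G → G → ℝ) (Hd : ℝ → G) (H : G) : ℝ :=
  if h : ∃! s, IsNearest D Hd H s then h.choose else 0

/-- `𝒫₁`: the closest point of the curve is not unique. -/
def P1 (D : G → G → ℝ) (Hd : ℝ → G) : Set G := {H | ¬ ∃! s, IsNearest D Hd H s}

/-- The times `0 ≤ t < T`, where `T` may be infinite. -/
def timeDom (T : EReal) : Set ℝ := {t | 0 ≤ t ∧ (t : EReal) < T}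

/-- `H(t)` converges to the set `A` as `t → T⁻`: its distance to `A` tends to zero. -/
def ConvergesTo (T : EReal) (H : ℝ → G) (A : Set G) : Prop :=
  ∀ ε : ℝ, 0 < ε → ∃ t₀ ∈ timeDom T, ∀ t ∈ timeDom T, t₀ ≤ t →
    ∃ Y ∈ A, ∀ i j, |mat (H t) i j - mat Y i j| < ε

end Distances

section System

variable {n m : ℕ} {G : Subgroup (GL (Fin n) ℝ)} (B : LieBasis G m)

/-- The curve twist `ξ_d(s) = S⁻¹(Hd'(s) Hd(s)⁻¹)`. -/
def LieBasis.curveTwist (Hd : ℝ → G) (s : ℝ) : EuclideanSpace ℝ (Fin m) :=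
  B.Sinv (deriv (fun r => mat (Hd r)) s * (mat (Hd s))⁻¹)

/-- A proper `C¹` parametrization, of period `1`, of a closed curve without self-intersections. -/
structure IsProperClosedCurve (Hd : ℝ → G) : Prop where
  periodic : Function.Periodic Hd 1
  injOn : InjOn Hd (Ico 0 1)
  differentiable : Differentiable ℝ fun s => mat (Hd s)
  continuous_deriv : Continuous (deriv fun s => mat (Hd s))
  proper : ∀ s, B.curveTwist Hd s ≠ 0

/-- `𝒫₂`: off the curve, with a unique closest point, but the EE-distance is not differentiable at
the pair of these two points. -/
def LieBasis.P2 (D : G → G → ℝ) (Hd : ℝ → G) : Set G :=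
  {H | H ∉ P1 D Hd ∧ H ∉ range Hd ∧
    ¬ (B.DiffV D H (Hd (sStar D Hd H)) ∧ B.DiffW D H (Hd (sStar D Hd H)))}

/-- The singular set `𝒫 = 𝒫₁ ∪ 𝒫₂`. -/
def LieBasis.P (D : G → G → ℝ) (Hd : ℝ → G) : Set G := P1 D Hd ∪ B.P2 D Hd

/-- The normal component `ξ_N`. -/
def LieBasis.xiN (D : G → G → ℝ) (Hd : ℝ → G) (H : G) : EuclideanSpace ℝ (Fin m) :=
  -B.LV D H (Hd (sStar D Hd H))

/-- The tangent component `ξ_T`. -/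
def LieBasis.xiT (D : G → G → ℝ) (Hd : ℝ → G) (H : G) : EuclideanSpace ℝ (Fin m) :=
  B.curveTwist Hd (sStar D Hd H)

/-- The vector field `Ψ = k_N ξ_N + k_T ξ_T`. On the curve `k_N = 0`, so there the first summand is
zero, which is the limit value. -/
def LieBasis.Psi (D : G → G → ℝ) (Hd : ℝ → G) (kN kT : G → ℝ) (H : G) :
    EuclideanSpace ℝ (Fin m) :=
  kN H • B.xiN D Hd H + kT H • B.xiT D Hd H

/-- Conditions on the gains. -/
structure IsGainPair (Hd : ℝ → G) (kN kT : G → ℝ) : Prop where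
  continuous_kN : Continuous kN
  continuous_kT : Continuous kT
  kT_pos : ∀ H, 0 < kT H
  kN_zero : ∀ H ∈ range Hd, kN H = 0
  kN_pos : ∀ H ∉ range Hd, 0 < kN H

/-- A solution on `[0, T)` of `H' = S(Ψ(H)) H`, where the field `Ψ` is defined outside `P`. -/
def LieBasis.IsSolution (Psi : G → EuclideanSpace ℝ (Fin m)) (P : Set G) (T : EReal)
    (H : ℝ → G) : Prop :=
  0 < T ∧ ∀ t ∈ timeDom T, H t ∉ P ∧
    HasDerivWithinAt (fun r => mat (H r)) (B.S (Psi (H t)) * mat (H t)) (timeDom T) t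

/-- A solution on `[0, T)` that is not the restriction of one on a longer interval `[0, T')`. -/
def LieBasis.IsMaximalSolution (Psi : G → EuclideanSpace ℝ (Fin m)) (P : Set G) (T : EReal)
    (H : ℝ → G) : Prop :=
  B.IsSolution Psi P T H ∧
    ∀ (T' : EReal) (H' : ℝ → G), T < T' → B.IsSolution Psi P T' H' → ¬ EqOn H H' (timeDom T)

/-- A trajectory on `[0, ∞)` of the closed loop under the perturbation policy `π` with manoeuvres of
duration `τ`. `A` is the set of starting times of the manoeuvres. A manoeuvre starts only when the
state has reached `P` (as a point of `P` or as a limit of states), off the curve `C`; during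
`[a, a + τ]` the input is the constant twist `π (H a)`. At every other time the state is outside
`P` and follows `H' = S(Ψ(H)) H`. In particular a manoeuvre is in progress whenever the state is in
`P`. -/
structure LieBasis.IsPolicyTrajectory (Psi : G → EuclideanSpace ℝ (Fin m)) (C P : Set G)
    (π : G → EuclideanSpace ℝ (Fin m)) (τ : ℝ) (A : Set ℝ) (H : ℝ → G) : Prop where
  continuousOn : ContinuousOn H (Ici 0)
  start_nonneg : ∀ a ∈ A, 0 ≤ a
  separated : ∀ a ∈ A, ∀ b ∈ A, a < b → a + τ ≤ b
  start : ∀ a ∈ A, H a ∈ closure P \ C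
  manoeuvre : ∀ a ∈ A, ∀ t ∈ Icc a (a + τ), H t = B.expS ((t - a) • π (H a)) * H a
  flow : ∀ t : ℝ, 0 ≤ t → (∀ a ∈ A, t ∉ Ico a (a + τ)) →
    H t ∉ P ∧ HasDerivWithinAt (fun r => mat (H r)) (B.S (Psi (H t)) * mat (H t)) (Ici t) t

end System

end GuidanceField

end

noncomputable section

namespace GuidanceField

-- Topology of a closed matrix group.

attribute [local instance] Matrix.linftyOpNormedRing Matrix.linftyOpNormedAlgebra

variable {n m : ℕ} {G : Subgroup (GL (Fin n) ℝ)}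

/-! The distance to the curve, `curveDist`, is a Lyapunov function. Moving both arguments of `D`
along the same one-parameter group changes nothing, by left-invariance, so `LW = -LV` wherever both
are defined and continuous. At the closest point the derivative of `D` along the curve vanishes, so
`LW` annihilates the curve twist there. Hence `LV`, and with it the normal component, is orthogonal
to the tangent component (`sum_LV_mul_xiT`). Off the curve, the upper right derivative of
`curveDist` along the closed loop is therefore at most `-kN ‖xiN‖²` (`eventually_slope_lt`). This
rate is nonzero: along the chaining path from `V` to `W` the distance to `W` has a strictly negative
initial derivative, by chainability and local linearity, so `LV` cannot vanish (`LV_ne_zero`).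
Chainability and left-invariance also make the sublevel sets of `curveDist` compact
(`isCompact_sublevel`). Since `curveDist` never increases, every solution stays in a compact set on
which the field is bounded, and is Lipschitz.

Convergence. If `T` is finite, the Lipschitz bound gives an end point. An end point outside the
closure of the singular set would allow an extension by Peano's theorem (the field is only
continuous), so the end point lies in that closure. If `T` is infinite and the solution converges
neither to the curve nor to the singular set, it spends infinitely many time intervals of a fixed
length in a compact set avoiding both, where the rate is bounded below; `curveDist` would become
negative.

Escape. The policy aims at the point where the chaining path towards a nearest curve point leaves a
small translated neighbourhood, or at the curve point itself if that is already in reach. Each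
manoeuvre lands on the curve or lowers `curveDist` by an amount uniform on sublevel sets, and the
flow in between does not raise it. As the curve is forward invariant, only finitely many manoeuvres
occur.

Traversal. Invariance of the curve is again monotonicity of `curveDist`. A solution on the curve
never stops, because the curve carries explicit solutions for all times, which extend it. -/

theorem mat_mul (g h : G) : mat (g * h) = mat g * mat h := by simp [mat]

@[simp] theorem mat_one : mat (1 : G) = 1 := by simp [mat]

theorem mat_inv (g : G) : mat g⁻¹ = (mat g)⁻¹ := by simp [mat]

theorem mat_mul_inv (g : G) : mat g * (mat g)⁻¹ = 1 := by
  rw [← mat_inv, ← mat_mul, mul_inv_cancel, mat_one]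

theorem isEmbedding_mat : IsEmbedding (mat : G → Matrix (Fin n) (Fin n) ℝ) :=
  (Units.isOpenEmbedding_val (R := Matrix (Fin n) (Fin n) ℝ)).isEmbedding.comp
    IsEmbedding.subtypeVal

theorem continuous_mat : Continuous (mat : G → Matrix (Fin n) (Fin n) ℝ) :=
  isEmbedding_mat.continuous

theorem mat_injective : Function.Injective (mat : G → Matrix (Fin n) (Fin n) ℝ) :=
  isEmbedding_mat.injective

/-- The invertible matrices are not closed among all matrices, but the pairs of a matrix and its
inverse are. Compactness in `G` therefore needs bounds on both. -/
theorem isClosedEmbedding_prod (hG : IsClosed (G : Set (GL (Fin n) ℝ))) :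
    IsClosedEmbedding (fun g : G => (mat g, mat g⁻¹)) := by
  have h1 : IsClosedEmbedding (Subtype.val : G → GL (Fin n) ℝ) := hG.isClosedEmbedding_subtypeVal
  have h2 := (Units.isClosedEmbedding_embedProduct (α := Matrix (Fin n) (Fin n) ℝ)).comp h1
  exact ((Homeomorph.refl _).prodCongr MulOpposite.opHomeomorph.symm).isClosedEmbedding.comp h2

theorem isCompact_norm_le (hG : IsClosed (G : Set (GL (Fin n) ℝ))) (R : ℝ) :
    IsCompact {g : G | ‖mat g‖ ≤ R ∧ ‖mat g⁻¹‖ ≤ R} := by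
  have : FiniteDimensional ℝ (Matrix (Fin n) (Fin n) ℝ) := inferInstance
  have : ProperSpace (Matrix (Fin n) (Fin n) ℝ) := FiniteDimensional.proper ℝ _
  have h := (isClosedEmbedding_prod hG).isCompact_preimage
    ((isCompact_closedBall (0 : Matrix (Fin n) (Fin n) ℝ) R).prod
      (isCompact_closedBall (0 : Matrix (Fin n) (Fin n) ℝ) R))
  convert h using 1
  ext g
  simp

theorem locallyCompactSpace (hG : IsClosed (G : Set (GL (Fin n) ℝ))) : LocallyCompactSpace G := by
  have : LocallyCompactSpace (Matrix (Fin n) (Fin n) ℝ) :=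
    inferInstanceAs (LocallyCompactSpace (Fin n → Fin n → ℝ))
  exact (isClosedEmbedding_prod hG).locallyCompactSpace

theorem abs_entry_le (A : Matrix (Fin n) (Fin n) ℝ) (i j : Fin n) : |A i j| ≤ ‖A‖ := by
  have := Matrix.linfty_opNNNorm_def A
  have h1 : ‖A i j‖₊ ≤ ∑ j, ‖A i j‖₊ :=
    Finset.single_le_sum (f := fun j => ‖A i j‖₊) (fun _ _ => zero_le) (Finset.mem_univ j)
  have h2 : ∑ j, ‖A i j‖₊ ≤ ‖A‖₊ := by
    rw [this]
    exact Finset.le_sup (f := fun i => ∑ j, ‖A i j‖₊) (Finset.mem_univ i)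
  exact_mod_cast h1.trans h2

@[simp] theorem expGL_val (X : Matrix (Fin n) (Fin n) ℝ) :
    ((expGL X : GL (Fin n) ℝ) : Matrix (Fin n) (Fin n) ℝ) = NormedSpace.exp X := rfl

theorem continuous_expGL : Continuous (expGL : Matrix (Fin n) (Fin n) ℝ → GL (Fin n) ℝ) := by
  refine (Units.isOpenEmbedding_val (R := Matrix (Fin n) (Fin n) ℝ)).isEmbedding.continuous_iff.2 ?_
  exact NormedSpace.exp_continuous

theorem expGL_zpow (X : Matrix (Fin n) (Fin n) ℝ) (k : ℤ) :
    (expGL X) ^ k = expGL ((k : ℝ) • X) := by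
  apply Units.ext
  rw [Matrix.coe_units_zpow, expGL_val, expGL_val, ← Matrix.exp_zsmul]
  congr 1
  exact (Int.cast_smul_eq_zsmul ℝ k X).symm

/-! ### Lie algebra and local coordinates of a closed subgroup. -/

/-- A limit direction of small logarithms of elements of a closed group lies in its Lie algebra. -/
theorem mem_lieAlg_of_tendsto (hG : IsClosed (G : Set (GL (Fin n) ℝ)))
    {y : ℕ → Matrix (Fin n) (Fin n) ℝ} {r : ℕ → ℝ} (hr : ∀ k, 0 < r k)
    (hr0 : Tendsto r atTop (𝓝 0)) (hy : ∀ k, expGL (y k) ∈ G)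
    {Y : Matrix (Fin n) (Fin n) ℝ} (hY : Tendsto (fun k => (r k)⁻¹ • y k) atTop (𝓝 Y)) :
    Y ∈ lieAlg G := by
  intro t
  -- The integer power `⌊t / r k⌋` of `exp (y k)` stays in the group and tends to `exp (t Y)`.
  have h1 : Tendsto (fun k => (⌊t / r k⌋ : ℝ) * r k) atTop (𝓝 t) := by
    have h2 : Tendsto (fun k => t - r k) atTop (𝓝 t) := by
      simpa using tendsto_const_nhds.sub hr0
    refine tendsto_of_tendsto_of_tendsto_of_le_of_le h2 tendsto_const_nhds (fun k => ?_)
      (fun k => ?_)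
    · have := Int.sub_one_lt_floor (t / r k)
      have h3 := mul_lt_mul_of_pos_right this (hr k)
      rw [sub_mul, div_mul_cancel₀ _ (hr k).ne', one_mul] at h3
      exact h3.le
    · have := mul_le_mul_of_nonneg_right (Int.floor_le (t / r k)) (hr k).le
      rwa [div_mul_cancel₀ _ (hr k).ne'] at this
  have h2 : Tendsto (fun k => expGL ((⌊t / r k⌋ : ℝ) • y k)) atTop (𝓝 (expGL (t • Y))) := by
    refine (continuous_expGL.tendsto _).comp ?_
    refine (h1.smul hY).congr fun k => ?_
    rw [smul_smul, mul_assoc, mul_inv_cancel₀ (hr k).ne', mul_one]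
  refine hG.mem_of_tendsto h2 (Eventually.of_forall fun k => ?_)
  rw [← expGL_zpow]
  exact G.zpow_mem (hy k) _

/-- The map `S` as a continuous linear map. -/
def LieBasis.SL (B : LieBasis G m) : EuclideanSpace ℝ (Fin m) →L[ℝ] Matrix (Fin n) (Fin n) ℝ :=
  LinearMap.toContinuousLinearMap
    { toFun := B.S
      map_add' := fun x y => by simp [LieBasis.S, add_smul, Finset.sum_add_distrib]
      map_smul' := fun c x => by simp [LieBasis.S, Finset.smul_sum, smul_smul] }

theorem LieBasis.S_injective (B : LieBasis G m) : Function.Injective B.S := by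
  intro x y h
  have h1 : Function.Injective (Fintype.linearCombination ℝ B.E) :=
    linearIndependent_iff_injective_fintypeLinearCombination.1 B.linearIndependent
  have := @h1 x y (by simpa [Fintype.linearCombination_apply, LieBasis.S] using h)
  ext i
  exact congrFun this i

theorem LieBasis.Sinv_S (B : LieBasis G m) (x : EuclideanSpace ℝ (Fin m)) : B.Sinv (B.S x) = x :=
  Function.leftInverse_invFun B.S_injective x

theorem LieBasis.range_S (B : LieBasis G m) : range B.S = lieAlg G := by
  rw [← B.span_eq]
  ext X
  constructor
  · rintro ⟨x, rfl⟩
    exact Submodule.sum_mem _ fun k _ =>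
      Submodule.smul_mem _ _ (Submodule.subset_span (Set.mem_range_self k))
  · intro hX
    obtain ⟨c, hc⟩ := (Submodule.mem_span_range_iff_exists_fun ℝ).1 hX
    exact ⟨WithLp.toLp 2 c, hc⟩

/-- Otherwise there are nonzero `y k → 0` in `q` with exponentials in `G`. A limit of their
normalizations is a unit vector of `q` that lies in the Lie algebra. -/
theorem eventually_eq_zero_of_exp_mem (hG : IsClosed (G : Set (GL (Fin n) ℝ)))
    (q : Submodule ℝ (Matrix (Fin n) (Fin n) ℝ)) (hq : ∀ Y ∈ q, Y ∈ lieAlg G → Y = 0) :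
    ∀ᶠ y : q in 𝓝 0, expGL (y : Matrix (Fin n) (Fin n) ℝ) ∈ G → y = 0 := by
  by_contra hcon
  have hcon' : ∃ᶠ y : q in 𝓝 0, expGL (y : Matrix (Fin n) (Fin n) ℝ) ∈ G ∧ y ≠ 0 := by
    refine (not_eventually.1 hcon).mono fun y hy => ?_
    push Not at hy
    exact hy
  have : FirstCountableTopology (Matrix (Fin n) (Fin n) ℝ) :=
    inferInstanceAs (FirstCountableTopology (Fin n → Fin n → ℝ))
  have : FirstCountableTopology q :=
    TopologicalSpace.Subtype.firstCountableTopology (q : Set (Matrix (Fin n) (Fin n) ℝ))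
  obtain ⟨y, hy0, hy⟩ := exists_seq_forall_of_frequently hcon'
  have : ProperSpace q := FiniteDimensional.proper ℝ q
  have hs : ∀ k, ‖y k‖⁻¹ • y k ∈ Metric.sphere (0 : q) 1 := fun k => by
    have : ‖y k‖ ≠ 0 := norm_ne_zero_iff.2 (hy k).2
    rw [mem_sphere_zero_iff_norm, norm_smul, norm_inv, norm_norm, inv_mul_cancel₀ this]
  obtain ⟨Y, hY, φ, hφ, hlim⟩ := (isCompact_sphere (0 : q) 1).tendsto_subseq hs
  have hr : ∀ k, 0 < ‖y (φ k)‖ := fun k => norm_pos_iff.2 (hy _).2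
  have hr0 : Tendsto (fun k => ‖y (φ k)‖) atTop (𝓝 0) := by
    simpa using (hy0.comp hφ.tendsto_atTop).norm
  have hmem : (Y : Matrix (Fin n) (Fin n) ℝ) ∈ lieAlg G :=
    mem_lieAlg_of_tendsto hG hr hr0 (y := fun k => (y (φ k) : Matrix (Fin n) (Fin n) ℝ))
      (fun k => (hy _).1) ((continuous_subtype_val.tendsto _).comp hlim)
  have h0 := hq _ Y.2 hmem
  have : Y = 0 := Subtype.ext h0
  simp [this] at hY

/-- A map into a closed matrix group whose differential at `0` is the isomorphism `S` has a local
inverse defined around `1`. -/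
theorem LieBasis.exists_local_inverse (B : LieBasis G m) (hG : IsClosed (G : Set (GL (Fin n) ℝ)))
    {F : EuclideanSpace ℝ (Fin m) → G} (hF0 : F 0 = 1)
    (hF : HasStrictFDerivAt (fun x => mat (F x)) B.SL 0) :
    ∃ (ψ : Matrix (Fin n) (Fin n) ℝ → EuclideanSpace ℝ (Fin m))
      (ψ' : Matrix (Fin n) (Fin n) ℝ →L[ℝ] EuclideanSpace ℝ (Fin m)),
      HasStrictFDerivAt ψ ψ' 1 ∧ (∀ x, ψ' (B.S x) = x) ∧ ψ 1 = 0 ∧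
      ∀ᶠ g : G in 𝓝 1, F (ψ (mat g)) = g := by
  -- On the Lie algebra times a complement `q`, the map `(x, y) ↦ F x * exp y` has invertible
  -- differential at `0`, so the inverse function theorem applies to it.
  obtain ⟨q, hq⟩ := Submodule.exists_isCompl (LinearMap.range B.SL.toLinearMap)
  have hinj : Function.Injective B.SL.toLinearMap := B.S_injective
  let e : (EuclideanSpace ℝ (Fin m) × q) ≃L[ℝ] Matrix (Fin n) (Fin n) ℝ :=
    (((LinearEquiv.ofInjective _ hinj).prodCongr (LinearEquiv.refl ℝ q)).trans
      (Submodule.prodEquivOfIsCompl _ _ hq)).toContinuousLinearEquiv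
  have hf : HasStrictFDerivAt (fun p : EuclideanSpace ℝ (Fin m) × q =>
      mat (F p.1) * NormedSpace.exp (p.2 : Matrix (Fin n) (Fin n) ℝ))
      (e : (EuclideanSpace ℝ (Fin m) × q) →L[ℝ] Matrix (Fin n) (Fin n) ℝ) 0 := by
    have h1 : HasStrictFDerivAt (fun p : EuclideanSpace ℝ (Fin m) × q => mat (F p.1))
        (B.SL.comp (ContinuousLinearMap.fst ℝ _ _)) 0 :=
      HasStrictFDerivAt.comp (g := fun x => mat (F x)) (f := Prod.fst) (g' := B.SL)
        (0 : EuclideanSpace ℝ (Fin m) × q) hF hasStrictFDerivAt_fst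
    have h0 : HasStrictFDerivAt (fun p : EuclideanSpace ℝ (Fin m) × q =>
        (p.2 : Matrix (Fin n) (Fin n) ℝ)) (q.subtypeL.comp (ContinuousLinearMap.snd ℝ _ _)) 0 :=
      HasStrictFDerivAt.comp (g := fun y : q => (y : Matrix (Fin n) (Fin n) ℝ)) (f := Prod.snd)
        (0 : EuclideanSpace ℝ (Fin m) × q) q.subtypeL.hasStrictFDerivAt hasStrictFDerivAt_snd
    have h2 : HasStrictFDerivAt (fun p : EuclideanSpace ℝ (Fin m) × q =>
        NormedSpace.exp (p.2 : Matrix (Fin n) (Fin n) ℝ))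
        ((1 : Matrix (Fin n) (Fin n) ℝ →L[ℝ] Matrix (Fin n) (Fin n) ℝ).comp
          (q.subtypeL.comp (ContinuousLinearMap.snd ℝ _ _))) 0 :=
      HasStrictFDerivAt.comp (g := NormedSpace.exp) (0 : EuclideanSpace ℝ (Fin m) × q)
        (hasStrictFDerivAt_exp_zero (𝕂 := ℝ)) h0
    refine (h1.mul' h2).congr_fderiv ?_
    refine ContinuousLinearMap.ext fun p => ?_
    obtain ⟨x, y⟩ := p
    change mat (F 0) * (y : Matrix (Fin n) (Fin n) ℝ) +
      B.S x * NormedSpace.exp ((0 : q) : Matrix (Fin n) (Fin n) ℝ) = B.S x + y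
    simp [hF0, add_comm]
  have hF1 : mat (F (0 : EuclideanSpace ℝ (Fin m) × q).1) *
      NormedSpace.exp ((0 : EuclideanSpace ℝ (Fin m) × q).2 : Matrix (Fin n) (Fin n) ℝ) = 1 := by
    simp [hF0]
  have hinv := hf.to_localInverse
  have hright := hf.eventually_right_inverse
  have hΘ0 := hf.localInverse_apply_image
  have hcont := hf.localInverse_continuousAt
  set Θ := hf.localInverse with hΘ
  rw [hF1] at hinv hright hΘ0 hcont
  refine ⟨fun X => (Θ X).1, _, hasStrictFDerivAt_fst.comp _ hinv, fun x => ?_, by simp [hΘ0], ?_⟩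
  · have h3 : e (x, 0) = B.S x := (add_zero _ : B.S x + ((0 : q) : Matrix (Fin n) (Fin n) ℝ) = _)
    have h4 : e.symm (B.S x) = (x, 0) := by rw [← h3, e.symm_apply_apply]
    exact congrArg Prod.fst h4
  have hq0 : ∀ Y ∈ q, Y ∈ lieAlg G → Y = 0 := fun Y hY hYl => by
    rw [← B.range_S] at hYl
    obtain ⟨x, hx⟩ := hYl
    have := Submodule.disjoint_def.1 hq.disjoint Y ⟨x, hx⟩ hY
    exact this
  have hC := eventually_eq_zero_of_exp_mem hG q hq0
  have hmat1 : Tendsto (mat : G → _) (𝓝 1) (𝓝 1) := by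
    have := continuous_mat.tendsto (1 : G)
    rwa [mat_one] at this
  have hsnd : Tendsto (fun g : G => (Θ (mat g)).2) (𝓝 1) (𝓝 0) := by
    have h3 : Tendsto (fun g : G => Θ (mat g)) (𝓝 1) (𝓝 0) := by
      have := hcont.tendsto.comp hmat1
      rwa [hΘ0] at this
    exact (continuous_snd.tendsto (0 : EuclideanSpace ℝ (Fin m) × q)).comp h3
  filter_upwards [hmat1.eventually hright, hsnd.eventually hC] with g hg1 hg2
  -- For `g` in the group, the complementary factor `exp y = (F x)⁻¹ * g` is in the group too. As
  -- `y` is small, it vanishes.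
  have h4 : expGL (((Θ (mat g)).2 : q) : Matrix (Fin n) (Fin n) ℝ) =
      (((F (Θ (mat g)).1)⁻¹ * g : G) : GL (Fin n) ℝ) := by
    apply Units.ext
    have : (((((F (Θ (mat g)).1)⁻¹ * g : G) : GL (Fin n) ℝ)) : Matrix (Fin n) (Fin n) ℝ) =
      mat ((F (Θ (mat g)).1)⁻¹ * g) := rfl
    rw [this, mat_mul, ← hg1, ← mul_assoc, ← mat_mul]
    simp [hg1]
  have h5 := hg2 (by rw [h4]; exact Subtype.prop _)
  rw [h5] at hg1
  apply mat_injective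
  simpa using hg1

theorem LieBasis.mat_expS (B : LieBasis G m) (x : EuclideanSpace ℝ (Fin m)) :
    mat (B.expS x) = NormedSpace.exp (B.S x) := rfl

theorem LieBasis.S_smul (B : LieBasis G m) (c : ℝ) (x : EuclideanSpace ℝ (Fin m)) :
    B.S (c • x) = c • B.S x := B.SL.map_smul c x

@[simp] theorem LieBasis.S_zero (B : LieBasis G m) : B.S 0 = 0 := B.SL.map_zero

@[simp] theorem LieBasis.expS_zero (B : LieBasis G m) : B.expS 0 = 1 :=
  mat_injective (by simp [B.mat_expS])

theorem LieBasis.continuous_S (B : LieBasis G m) : Continuous B.S := B.SL.continuous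

theorem LieBasis.continuous_expS (B : LieBasis G m) : Continuous B.expS :=
  (continuous_expGL.comp B.continuous_S).subtype_mk _

theorem LieBasis.expS_add_smul (B : LieBasis G m) (s t : ℝ) (x : EuclideanSpace ℝ (Fin m)) :
    B.expS ((s + t) • x) = B.expS (s • x) * B.expS (t • x) := by
  apply mat_injective
  rw [mat_mul, B.mat_expS, B.mat_expS, B.mat_expS, B.S_smul, B.S_smul, B.S_smul, add_smul]
  exact Matrix.exp_add_of_commute _ _ ((Commute.refl (B.S x)).smul_left s |>.smul_right t)

theorem LieBasis.hasStrictFDerivAt_expS_comp (B : LieBasis G m)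
    (L : EuclideanSpace ℝ (Fin m) →L[ℝ] EuclideanSpace ℝ (Fin m)) :
    HasStrictFDerivAt (fun x => mat (B.expS (L x))) (B.SL.comp L) 0 := by
  have h : HasStrictFDerivAt (NormedSpace.exp : Matrix (Fin n) (Fin n) ℝ → _)
      (1 : Matrix (Fin n) (Fin n) ℝ →L[ℝ] Matrix (Fin n) (Fin n) ℝ) ((B.SL.comp L) 0) := by
    rw [map_zero]
    exact hasStrictFDerivAt_exp_zero (𝕂 := ℝ)
  exact HasStrictFDerivAt.comp (0 : EuclideanSpace ℝ (Fin m)) h (B.SL.comp L).hasStrictFDerivAt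

theorem LieBasis.hasStrictFDerivAt_expS (B : LieBasis G m) :
    HasStrictFDerivAt (fun x => mat (B.expS x)) B.SL 0 :=
  B.hasStrictFDerivAt_expS_comp (ContinuousLinearMap.id ℝ _)

/-- The partial products `exp(x_{k-1}E_{k-1}) ⋯ exp(x₀E₀)`. -/
def LieBasis.prodExp (B : LieBasis G m) (x : EuclideanSpace ℝ (Fin m)) : ℕ → G
  | 0 => 1
  | k + 1 => if h : k < m then
      B.expS (x ⟨k, h⟩ • EuclideanSpace.single ⟨k, h⟩ (1 : ℝ)) * B.prodExp x k
    else B.prodExp x k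

theorem LieBasis.prodExp_zero (B : LieBasis G m) (k : ℕ) : B.prodExp 0 k = 1 := by
  induction k with
  | zero => rfl
  | succ k ih =>
    rw [LieBasis.prodExp]
    split_ifs <;> simp [ih]

theorem LieBasis.hasStrictFDerivAt_prodExp_aux (B : LieBasis G m) (k : ℕ) :
    ∃ L : EuclideanSpace ℝ (Fin m) →L[ℝ] EuclideanSpace ℝ (Fin m),
      (∀ x i, L x i = if (i : ℕ) < k then x i else 0) ∧
      HasStrictFDerivAt (fun x => mat (B.prodExp x k)) (B.SL.comp L) 0 := by
  induction k with
  | zero =>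
    refine ⟨0, by simp, ?_⟩
    simpa [LieBasis.prodExp] using
      hasStrictFDerivAt_const (1 : Matrix (Fin n) (Fin n) ℝ) (0 : EuclideanSpace ℝ (Fin m))
  | succ k ih =>
    obtain ⟨L, hL, hd⟩ := ih
    by_cases h : k < m
    · let L' : EuclideanSpace ℝ (Fin m) →L[ℝ] EuclideanSpace ℝ (Fin m) :=
        (EuclideanSpace.proj (𝕜 := ℝ) (⟨k, h⟩ : Fin m)).smulRight
          (EuclideanSpace.single ⟨k, h⟩ (1 : ℝ))
      refine ⟨L' + L, fun x i => ?_, ?_⟩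
      · by_cases hik : i = ⟨k, h⟩
        · subst hik
          simp [L', hL]
        · have h1 : (i : ℕ) ≠ k := fun h2 => hik (Fin.ext h2)
          have h2 : (i : ℕ) < k + 1 ↔ (i : ℕ) < k := by omega
          simp [L', hL, hik, h2]
      · have h1 := (B.hasStrictFDerivAt_expS_comp L').mul' hd
        have h2 : (fun x => mat (B.prodExp x (k + 1))) =
            fun x => mat (B.expS (L' x)) * mat (B.prodExp x k) := by
          ext1 x
          rw [LieBasis.prodExp, dif_pos h, mat_mul]
          rfl
        rw [h2]
        refine h1.congr_fderiv ?_
        refine ContinuousLinearMap.ext fun x => ?_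
        change mat (B.expS (L' 0)) * B.SL (L x) + B.SL (L' x) * mat (B.prodExp 0 k) =
          B.SL (L' x + L x)
        rw [map_zero, B.expS_zero, B.prodExp_zero, mat_one, map_add, one_mul, mul_one, add_comm]
    · refine ⟨L, fun x i => ?_, ?_⟩
      · have h1 := i.2
        rw [hL, if_pos (by omega), if_pos (by omega)]
      · simpa [LieBasis.prodExp, h] using hd

theorem LieBasis.hasStrictFDerivAt_prodExp (B : LieBasis G m) :
    HasStrictFDerivAt (fun x => mat (B.prodExp x m)) B.SL 0 := by
  obtain ⟨L, hL, hd⟩ := B.hasStrictFDerivAt_prodExp_aux m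
  have : L = ContinuousLinearMap.id ℝ _ := by
    ext x i
    simp [hL]
  rw [this] at hd
  exact hd

/-- Reading a curve through the local inverse shows that its velocity is tangent to the group. With
`F = expS` this extracts the twist of a differentiable curve; with `F = prodExp` it feeds the chain
rule, whose partial derivatives go along one basis vector at a time. -/
theorem LieBasis.exists_coordinates (B : LieBasis G m) (hG : IsClosed (G : Set (GL (Fin n) ℝ)))
    {F : EuclideanSpace ℝ (Fin m) → G} (hF0 : F 0 = 1)
    (hF : HasStrictFDerivAt (fun x => mat (F x)) B.SL 0) {V : ℝ → G}
    {V' : Matrix (Fin n) (Fin n) ℝ} {s : Set ℝ} {t₀ : ℝ}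
    (hV : HasDerivWithinAt (fun t => mat (V t)) V' s t₀) :
    ∃ (x : ℝ → EuclideanSpace ℝ (Fin m)) (ξ : EuclideanSpace ℝ (Fin m)),
      HasDerivWithinAt x ξ s t₀ ∧ x t₀ = 0 ∧ (∀ᶠ t in 𝓝[s] t₀, V t = F (x t) * V t₀) ∧
      (∀ ζ, V' = B.S ζ * mat (V t₀) → ξ = ζ) ∧
      (UniqueDiffWithinAt ℝ s t₀ → t₀ ∈ s → V' = B.S ξ * mat (V t₀)) := by
  obtain ⟨ψ, ψ', hψ, hψ', hψ0, hψF⟩ := B.exists_local_inverse hG hF0 hF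
  have h1 : HasDerivWithinAt (fun t => mat (V t) * mat (V t₀)⁻¹) (V' * mat (V t₀)⁻¹) s t₀ :=
    hV.mul_const _
  have h2 : HasDerivWithinAt (fun t => ψ (mat (V t) * mat (V t₀)⁻¹)) (ψ' (V' * mat (V t₀)⁻¹))
      s t₀ := by
    refine HasFDerivAt.comp_hasDerivWithinAt (l := ψ) t₀ ?_ h1
    rw [mat_inv, mat_mul_inv]
    exact hψ.hasFDerivAt
  have hx0 : ψ (mat (V t₀) * mat (V t₀)⁻¹) = 0 := by rw [mat_inv, mat_mul_inv, hψ0]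
  have hcont : Tendsto (fun t => V t * (V t₀)⁻¹) (𝓝[s] t₀) (𝓝 1) := by
    rw [isEmbedding_mat.tendsto_nhds_iff]
    have := h1.continuousWithinAt.tendsto
    rw [mat_inv, mat_mul_inv] at this
    refine this.congr' ?_ |>.trans_eq ?_
    · exact Eventually.of_forall fun t => by simp [mat_mul, mat_inv]
    · rw [mat_one]
      rfl
  have hev : ∀ᶠ t in 𝓝[s] t₀, V t = F (ψ (mat (V t) * mat (V t₀)⁻¹)) * V t₀ := by
    filter_upwards [hcont.eventually hψF] with t ht
    rw [mat_mul] at ht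
    rw [ht, inv_mul_cancel_right]
  refine ⟨_, _, h2, hx0, hev, fun ζ hζ => ?_, fun hu ht₀ => ?_⟩
  · rw [hζ, mat_inv, mul_assoc, mat_mul_inv, mul_one, hψ']
  · set x := fun t => ψ (mat (V t) * mat (V t₀)⁻¹) with hx
    have h3 : HasDerivWithinAt (fun t => mat (F (x t)) * mat (V t₀))
        (B.SL (ψ' (V' * mat (V t₀)⁻¹)) * mat (V t₀)) s t₀ := by
      refine HasDerivWithinAt.mul_const ?_ _
      refine HasFDerivAt.comp_hasDerivWithinAt (l := fun x => mat (F x)) t₀ ?_ h2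
      have hx1 : x t₀ = 0 := hx0
      simp only [hx1]
      exact hF.hasFDerivAt
    have h4 : HasDerivWithinAt (fun t => mat (V t))
        (B.SL (ψ' (V' * mat (V t₀)⁻¹)) * mat (V t₀)) s t₀ := by
      refine h3.congr_of_eventuallyEq_of_mem ?_ ht₀
      filter_upwards [hev] with t ht
      rw [← mat_mul, ← ht]
    exact hu.eq_deriv _ hV h4

/-! ### Chain rule for the partial operators. -/

theorem LieBasis.continuous_prodExp (B : LieBasis G m) (k : ℕ) :
    Continuous fun x => B.prodExp x k := by
  induction k with
  | zero => exact continuous_const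
  | succ k ih =>
    by_cases h : k < m
    · simp only [LieBasis.prodExp, dif_pos h]
      refine (B.continuous_expS.comp ?_).mul ih
      fun_prop
    · simpa only [LieBasis.prodExp, dif_neg h] using ih

theorem LieBasis.LExists.hasDerivAt {B : LieBasis G m} {f : G → ℝ} {g : G} {k : Fin m} {θ : ℝ}
    (h : B.LExists f (B.expS (θ • EuclideanSpace.single k (1 : ℝ)) * g)) :
    HasDerivAt (fun ε : ℝ => f (B.expS (ε • EuclideanSpace.single k (1 : ℝ)) * g))
      (B.L f (B.expS (θ • EuclideanSpace.single k (1 : ℝ)) * g) k) θ := by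
  have h1 := (h k).hasDerivAt
  have h2 := HasDerivAt.comp_sub_const θ θ (by rw [sub_self]; exact h1)
  have h3 : (fun ε : ℝ => f (B.expS (ε • EuclideanSpace.single k (1 : ℝ)) * g)) = fun ε =>
      f (B.expS ((ε - θ) • EuclideanSpace.single k (1 : ℝ)) *
        (B.expS (θ • EuclideanSpace.single k (1 : ℝ)) * g)) := by
    ext ε
    rw [← mul_assoc, ← B.expS_add_smul, sub_add_cancel]
  rw [h3]
  exact h2

/-- The mean value inequality along a single factor of the product. Each new factor multiplies on
the left, which is the direction in which `LV` differentiates. The base point has moved, so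
continuity of `LV` jointly in both variables is needed. -/
theorem LieBasis.DiffV.eventually_step {B : LieBasis G m} {D : G → G → ℝ} {V W : G}
    (h : B.DiffV D V W) {k : ℕ} (hk : k < m) {η : ℝ} (hη : 0 < η) :
    ∀ᶠ p : EuclideanSpace ℝ (Fin m) × G in 𝓝 (0, W),
      |D (B.prodExp p.1 (k + 1) * V) p.2 - D (B.prodExp p.1 k * V) p.2 -
        B.LV D V W ⟨k, hk⟩ * p.1 ⟨k, hk⟩| ≤ η * ‖p.1‖ := by
  have hc : Tendsto (fun q : ℝ × (EuclideanSpace ℝ (Fin m) × G) =>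
      ((B.expS (q.1 • EuclideanSpace.single ⟨k, hk⟩ (1 : ℝ)) * (B.prodExp q.2.1 k * V), q.2.2) :
        G × G)) (𝓝 (0, (0, W))) (𝓝 (V, W)) := by
    have hcont : Continuous (fun q : ℝ × (EuclideanSpace ℝ (Fin m) × G) =>
      ((B.expS (q.1 • EuclideanSpace.single ⟨k, hk⟩ (1 : ℝ)) * (B.prodExp q.2.1 k * V), q.2.2) :
        G × G)) := by
      have h1 := B.continuous_expS
      have h2 := B.continuous_prodExp k
      fun_prop
    have := hcont.tendsto (0, (0, W))
    simpa [B.prodExp_zero] using this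
  have hL : ∀ᶠ p : G × G in 𝓝 (V, W), B.LVExists D p.1 p.2 ∧
      |B.LV D p.1 p.2 ⟨k, hk⟩ - B.LV D V W ⟨k, hk⟩| < η := by
    refine h.1.and ?_
    have := Metric.tendsto_nhds.1 h.2 η hη
    filter_upwards [this] with p hp
    rw [dist_eq_norm] at hp
    exact lt_of_le_of_lt (PiLp.norm_apply_le (B.LV D p.1 p.2 - B.LV D V W) ⟨k, hk⟩) hp
  have hL' := hc.eventually hL
  rw [nhds_prod_eq] at hL'
  obtain ⟨pa, hpa, pb, hpb, hab⟩ := eventually_prod_iff.1 hL'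
  obtain ⟨r, hr, hrball⟩ := Metric.eventually_nhds_iff.1 hpa
  have hn : ∀ᶠ p : EuclideanSpace ℝ (Fin m) × G in 𝓝 (0, W), ‖p.1‖ < r := by
    have : Tendsto (fun p : EuclideanSpace ℝ (Fin m) × G => ‖p.1‖) (𝓝 (0, W)) (𝓝 0) := by
      have := (continuous_norm.comp continuous_fst).tendsto
        ((0, W) : EuclideanSpace ℝ (Fin m) × G)
      simpa [Function.comp_def] using this
    exact this.eventually (gt_mem_nhds hr)
  filter_upwards [hpb, hn] with p hp hpr
  set g := B.prodExp p.1 k * V with hg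
  set c := B.LV D V W ⟨k, hk⟩ with hcdef
  -- With the linear part removed, the derivative of `u` is the variation of `LV`, which is below
  -- `η`.
  set u : ℝ → ℝ := fun ε => D (B.expS (ε • EuclideanSpace.single ⟨k, hk⟩ (1 : ℝ)) * g) p.2 - c * ε
    with hu
  have hder : ∀ θ ∈ Metric.closedBall (0 : ℝ) ‖p.1‖, HasDerivWithinAt u
      (B.LV D (B.expS (θ • EuclideanSpace.single ⟨k, hk⟩ (1 : ℝ)) * g) p.2 ⟨k, hk⟩ - c)
      (Metric.closedBall (0 : ℝ) ‖p.1‖) θ := by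
    intro θ hθ
    have h1 := hab (x := θ) (hrball (lt_of_le_of_lt (Metric.mem_closedBall.1 hθ) hpr)) hp
    have h2 := (LieBasis.LExists.hasDerivAt (f := fun V' => D V' p.2) h1.1)
    have h3 := h2.sub ((hasDerivAt_id θ).const_mul c)
    rw [mul_one] at h3
    exact h3.hasDerivWithinAt
  have hbound : ∀ θ ∈ Metric.closedBall (0 : ℝ) ‖p.1‖,
      ‖B.LV D (B.expS (θ • EuclideanSpace.single ⟨k, hk⟩ (1 : ℝ)) * g) p.2 ⟨k, hk⟩ - c‖ ≤ η := by
    intro θ hθ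
    exact (hab (x := θ) (hrball (lt_of_le_of_lt (Metric.mem_closedBall.1 hθ) hpr)) hp).2.le
  have hxk : ‖p.1 ⟨k, hk⟩‖ ≤ ‖p.1‖ := PiLp.norm_apply_le _ _
  have h4 := (convex_closedBall (0 : ℝ) ‖p.1‖).norm_image_sub_le_of_norm_hasDerivWithin_le hder
    hbound (Metric.mem_closedBall_self (norm_nonneg _)) (y := p.1 ⟨k, hk⟩) (by simpa using hxk)
  have h5 : B.prodExp p.1 (k + 1) * V =
      B.expS (p.1 ⟨k, hk⟩ • EuclideanSpace.single ⟨k, hk⟩ (1 : ℝ)) * g := by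
    rw [LieBasis.prodExp, dif_pos hk, mul_assoc]
  rw [h5]
  have h6 : u (p.1 ⟨k, hk⟩) - u 0 =
      D (B.expS (p.1 ⟨k, hk⟩ • EuclideanSpace.single ⟨k, hk⟩ (1 : ℝ)) * g) p.2 - D g p.2 -
        c * p.1 ⟨k, hk⟩ := by
    simp only [hu]
    simp
    ring
  rw [h6, sub_zero, Real.norm_eq_abs] at h4
  exact h4.trans (mul_le_mul_of_nonneg_left hxk hη.le)

/-- The increments of the `m` factors telescope. The tolerance is split by `m + 1` rather than `m`
to allow `m = 0`. -/
theorem LieBasis.DiffV.eventually_prodExp {B : LieBasis G m} {D : G → G → ℝ} {V W : G}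
    (h : B.DiffV D V W) {η : ℝ} (hη : 0 < η) :
    ∀ᶠ p : EuclideanSpace ℝ (Fin m) × G in 𝓝 (0, W),
      |D (B.prodExp p.1 m * V) p.2 - D V p.2 - ∑ j, B.LV D V W j * p.1 j| ≤ η * ‖p.1‖ := by
  have h1 : ∀ᶠ p : EuclideanSpace ℝ (Fin m) × G in 𝓝 (0, W), ∀ k : Fin m,
      |D (B.prodExp p.1 ((k : ℕ) + 1) * V) p.2 - D (B.prodExp p.1 k * V) p.2 -
        B.LV D V W k * p.1 k| ≤ η / (m + 1) * ‖p.1‖ :=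
    eventually_all.2 fun k => h.eventually_step k.2 (by positivity)
  filter_upwards [h1] with p hp
  have h2 : D (B.prodExp p.1 m * V) p.2 - D V p.2 = ∑ k : Fin m,
      (D (B.prodExp p.1 ((k : ℕ) + 1) * V) p.2 - D (B.prodExp p.1 k * V) p.2) := by
    rw [Fin.sum_univ_eq_sum_range
      (fun k => D (B.prodExp p.1 (k + 1) * V) p.2 - D (B.prodExp p.1 k * V) p.2) m,
      Finset.sum_range_sub (fun k => D (B.prodExp p.1 k * V) p.2)]
    simp [LieBasis.prodExp]
  rw [h2, ← Finset.sum_sub_distrib]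
  refine (Finset.abs_sum_le_sum_abs _ _).trans ((Finset.sum_le_sum fun k _ => hp k).trans ?_)
  rw [Finset.sum_const, Finset.card_univ, Fintype.card_fin, nsmul_eq_mul, ← mul_assoc]
  refine mul_le_mul_of_nonneg_right ?_ (norm_nonneg _)
  rw [mul_div_assoc', div_le_iff₀ (by positivity)]
  nlinarith

/-- Chain rule in the first variable, the second one moving continuously. -/
theorem LieBasis.DiffV.hasDerivWithinAt {B : LieBasis G m}
    (hG : IsClosed (G : Set (GL (Fin n) ℝ))) {D : G → G → ℝ} {V W : ℝ → G} {s : Set ℝ} {t₀ : ℝ}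
    (h : B.DiffV D (V t₀) (W t₀)) {ξ : EuclideanSpace ℝ (Fin m)}
    (hV : HasDerivWithinAt (fun t => mat (V t)) (B.S ξ * mat (V t₀)) s t₀)
    (hW : ContinuousWithinAt W s t₀) :
    HasDerivWithinAt (fun t => D (V t) (W t) - D (V t₀) (W t)) (∑ j, B.LV D (V t₀) (W t₀) j * ξ j)
      s t₀ := by
  obtain ⟨x, ξ', hx, hx0, hVx, hξ, -⟩ :=
    B.exists_coordinates hG (B.prodExp_zero m) B.hasStrictFDerivAt_prodExp hV
  obtain rfl := hξ ξ rfl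
  have hV0 : B.prodExp 0 m = 1 := B.prodExp_zero m
  have hlin : HasDerivWithinAt (fun t => ∑ j, B.LV D (V t₀) (W t₀) j * x t j)
      (∑ j, B.LV D (V t₀) (W t₀) j * ξ' j) s t₀ := by
    refine HasDerivWithinAt.fun_sum fun j _ => ?_
    refine HasDerivWithinAt.const_mul _ ?_
    exact HasFDerivAt.comp_hasDerivWithinAt t₀ (EuclideanSpace.proj (𝕜 := ℝ) j).hasFDerivAt hx
  have htend : Tendsto (fun t => (x t, W t)) (𝓝[s] t₀) (𝓝 (0, W t₀)) := by
    rw [nhds_prod_eq]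
    refine Tendsto.prodMk ?_ hW
    have := hx.continuousWithinAt.tendsto
    rwa [hx0] at this
  have hrem : HasDerivWithinAt (fun t => D (V t) (W t) - D (V t₀) (W t) -
      ∑ j, B.LV D (V t₀) (W t₀) j * x t j) 0 s t₀ := by
    rw [hasDerivWithinAt_iff_isLittleO]
    have h1 : (fun t => D (V t) (W t) - D (V t₀) (W t) -
        ∑ j, B.LV D (V t₀) (W t₀) j * x t j) =o[𝓝[s] t₀] x := by
      rw [Asymptotics.isLittleO_iff]
      intro η hη
      filter_upwards [htend.eventually (h.eventually_prodExp hη), hVx] with t ht1 ht2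
      rw [ht2, Real.norm_eq_abs]
      exact ht1
    have h2 : x =O[𝓝[s] t₀] fun t => t - t₀ := by
      have := hx.hasFDerivWithinAt.isBigO_sub
      simpa [hx0] using this
    refine (h1.trans_isBigO h2).congr_left fun t => ?_
    simp [hx0]
  refine (hrem.add hlin).congr_deriv (zero_add _) |>.congr (fun t _ => ?_) ?_ <;> simp

theorem LieBasis.DiffW.swap {B : LieBasis G m} {D : G → G → ℝ} {V W : G} (h : B.DiffW D V W) :
    B.DiffV (fun V W => D W V) W V :=
  ⟨continuous_swap.tendsto (W, V) |>.eventually h.1,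
    ContinuousAt.comp (f := Prod.swap) (x := (W, V)) h.2 continuous_swap.continuousAt⟩

theorem LieBasis.DiffW.hasDerivWithinAt {B : LieBasis G m}
    (hG : IsClosed (G : Set (GL (Fin n) ℝ))) {D : G → G → ℝ} {V : G} {W : ℝ → G} {s : Set ℝ}
    {t₀ : ℝ} (h : B.DiffW D V (W t₀)) {ξ : EuclideanSpace ℝ (Fin m)}
    (hW : HasDerivWithinAt (fun t => mat (W t)) (B.S ξ * mat (W t₀)) s t₀) :
    HasDerivWithinAt (fun t => D V (W t)) (∑ j, B.LW D V (W t₀) j * ξ j) s t₀ := by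
  have h1 := LieBasis.DiffV.hasDerivWithinAt hG (W := fun _ => V) h.swap hW
    continuousWithinAt_const
  exact (h1.add_const (D V (W t₀))).congr (fun t _ => (sub_add_cancel _ _).symm)
    (sub_add_cancel _ _).symm

theorem LieBasis.hasDerivAt_expS (B : LieBasis G m) (ζ : EuclideanSpace ℝ (Fin m)) (g : G) (t : ℝ) :
    HasDerivAt (fun t : ℝ => mat (B.expS (t • ζ) * g)) (B.S ζ * mat (B.expS (t • ζ) * g)) t := by
  simp only [mat_mul, B.mat_expS, B.S_smul, ← mul_assoc]
  exact (hasDerivAt_exp_smul_const' (𝕂 := ℝ) (B.S ζ) t).mul_const _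

/-- Left-invariance makes the two partial operators opposite to each other. -/
theorem LieBasis.LW_eq_neg_LV (B : LieBasis G m) (hG : IsClosed (G : Set (GL (Fin n) ℝ)))
    {D : G → G → ℝ} (hleft : IsLeftInvariant D) {V W : G} (hV : B.DiffV D V W)
    (hW : B.DiffW D V W) : B.LW D V W = -B.LV D V W := by
  ext j
  set e := EuclideanSpace.single j (1 : ℝ)
  have hdV := (B.hasDerivAt_expS e V 0).hasDerivWithinAt (s := univ)
  have hdW := (B.hasDerivAt_expS e W 0).hasDerivWithinAt (s := univ)
  have h0 : ∀ g : G, B.expS ((0 : ℝ) • e) * g = g := fun g => by simp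
  have h1 := LieBasis.DiffV.hasDerivWithinAt hG (D := D) (V := fun t => B.expS (t • e) * V)
    (W := fun t => B.expS (t • e) * W) (t₀ := 0) (by simpa [h0] using hV) hdV (by
      have : Continuous fun t : ℝ => B.expS (t • e) * W :=
        (B.continuous_expS.comp (by fun_prop)).mul continuous_const
      exact this.continuousWithinAt)
  have h2 := LieBasis.DiffW.hasDerivWithinAt hG (D := D) (V := V)
    (W := fun t => B.expS (t • e) * W) (t₀ := 0) (by simpa [h0] using hW) hdW
  have h3 := h1.add h2
  have h4 : HasDerivWithinAt (fun _ : ℝ => D V W) 0 univ 0 := hasDerivWithinAt_const _ _ _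
  -- The sum of the two partial increments is the distance of the two simultaneously translated
  -- points, a constant.
  have h5 := uniqueDiffWithinAt_univ.eq_deriv _ h3 (h4.congr (fun t _ => by
    simp only [Pi.add_apply, h0, sub_add_cancel]; exact hleft _ _ _) (by simp))
  simp only [h0] at h5
  simp [e] at h5
  simp
  linarith

/-! ### The curve and its twist. -/

/-- The standing assumptions on the group, the distance, the curve and the gains. -/
structure IsGuidance (B : LieBasis G m) (D : G → G → ℝ) (Φ : ℝ → G → G → G) (Hd : ℝ → G)
    (kN kT : G → ℝ) : Prop where
  isClosed : IsClosed (G : Set (GL (Fin n) ℝ))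
  ee : IsEEDistance B D
  left : IsLeftInvariant D
  chain : IsChainable Φ D
  lin : IsLocallyLinear Φ D
  curve : IsProperClosedCurve B Hd
  gain : IsGainPair Hd kN kT

section Curve

variable {B : LieBasis G m} {Hd : ℝ → G}

theorem IsProperClosedCurve.continuous (h : IsProperClosedCurve B Hd) : Continuous Hd :=
  isEmbedding_mat.continuous_iff.2 h.differentiable.continuous

/-- `Sinv` is meaningful only on the range of `S`; the velocity lies there because the curve stays
in the closed group. -/
theorem IsProperClosedCurve.hasDerivAt (h : IsProperClosedCurve B Hd)
    (hG : IsClosed (G : Set (GL (Fin n) ℝ))) (s : ℝ) :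
    HasDerivAt (fun s => mat (Hd s)) (B.S (B.curveTwist Hd s) * mat (Hd s)) s := by
  have h1 := (h.differentiable s).hasDerivAt
  obtain ⟨x, ξ, -, -, -, -, hξ⟩ := B.exists_coordinates hG B.expS_zero B.hasStrictFDerivAt_expS
    (V := Hd) (h1.hasDerivWithinAt (s := univ))
  have h2 := hξ uniqueDiffWithinAt_univ (mem_univ s)
  have h3 : B.curveTwist Hd s = ξ := by
    refine (congrArg (fun X => B.Sinv (X * (mat (Hd s))⁻¹)) h2).trans ?_
    rw [mul_assoc, mat_mul_inv, mul_one, B.Sinv_S]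
  rw [h3, ← h2]
  exact h1

/-- `Sinv` is an arbitrary left inverse, with no continuity of its own. On the velocities in
question it agrees with the continuous linear map `ψ'`. -/
theorem IsProperClosedCurve.continuous_curveTwist (h : IsProperClosedCurve B Hd)
    (hG : IsClosed (G : Set (GL (Fin n) ℝ))) : Continuous (B.curveTwist Hd) := by
  obtain ⟨ψ, ψ', -, hψ', -, -⟩ := B.exists_local_inverse hG B.expS_zero B.hasStrictFDerivAt_expS
  have h1 : B.curveTwist Hd = fun s => ψ' (deriv (fun s => mat (Hd s)) s * mat (Hd s)⁻¹) := by
    ext1 s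
    have h2 : deriv (fun s => mat (Hd s)) s = B.S (B.curveTwist Hd s) * mat (Hd s) :=
      (h.hasDerivAt hG s).deriv
    rw [h2, mul_assoc, mat_inv, mat_mul_inv, mul_one, hψ']
  rw [h1]
  refine ψ'.continuous.comp (h.continuous_deriv.mul ?_)
  exact continuous_mat.comp h.continuous.inv

theorem IsProperClosedCurve.periodic_curveTwist (h : IsProperClosedCurve B Hd) :
    Function.Periodic (B.curveTwist Hd) 1 := by
  intro s
  have h1 : (fun r => mat (Hd (r + 1))) = fun r => mat (Hd r) := by
    ext1 r
    rw [h.periodic r]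
  have h2 : deriv (fun r => mat (Hd r)) (s + 1) = deriv (fun r => mat (Hd r)) s :=
    (deriv_comp_add_const (fun r => mat (Hd r)) 1 s).symm.trans (congrArg (fun f => deriv f s) h1)
  rw [LieBasis.curveTwist, LieBasis.curveTwist, h2, h.periodic s]

theorem IsProperClosedCurve.range_eq (h : IsProperClosedCurve B Hd) :
    range Hd = Hd '' Icc 0 1 := by
  have := h.periodic.image_Icc zero_lt_one 0
  rw [← this, zero_add]

theorem IsProperClosedCurve.isCompact_range (h : IsProperClosedCurve B Hd) :
    IsCompact (range Hd) := by
  rw [h.range_eq]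
  exact isCompact_Icc.image h.continuous

end Curve

/-! ### Distance to the curve and closest points. -/

/-- The smallest distance from `H` to the points of the closed curve `Hd`. -/
def curveDist (D : G → G → ℝ) (Hd : ℝ → G) (H : G) : ℝ :=
  sInf ((fun s => D H (Hd s)) '' Icc 0 1)

namespace IsGuidance

variable {B : LieBasis G m} {D : G → G → ℝ} {Φ : ℝ → G → G → G} {Hd : ℝ → G} {kN kT : G → ℝ}

theorem continuous_dist (h : IsGuidance B D Φ Hd kN kT) : Continuous fun p : G × G => D p.1 p.2 :=
  h.ee.continuous

theorem continuous_curveDist (h : IsGuidance B D Φ Hd kN kT) : Continuous (curveDist D Hd) := by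
  refine isCompact_Icc.continuous_sInf (f := fun (H : G) (s : ℝ) => D H (Hd s)) ?_
  exact h.continuous_dist.comp (continuous_fst.prodMk (h.curve.continuous.comp continuous_snd))

theorem exists_isNearest (h : IsGuidance B D Φ Hd kN kT) (H : G) :
    ∃ s, IsNearest D Hd H s ∧ D H (Hd s) = curveDist D Hd H := by
  have hc : Continuous fun s => D H (Hd s) :=
    h.continuous_dist.comp (continuous_const.prodMk h.curve.continuous)
  obtain ⟨s, hs, hmin⟩ := isCompact_Icc.exists_sInf_image_eq (nonempty_Icc.2 zero_le_one)
    hc.continuousOn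
  have hle : ∀ s' ∈ Icc (0 : ℝ) 1, D H (Hd s) ≤ D H (Hd s') := fun s' hs' => by
    rw [← hmin]
    exact csInf_le ⟨0, by rintro _ ⟨r, -, rfl⟩; exact h.ee.nonneg _ _⟩ ⟨s', hs', rfl⟩
  -- Compactness requires the closed interval; a minimizer at its right end is traded for `0` by
  -- periodicity.
  by_cases h1 : s = 1
  · refine ⟨0, ⟨by simp, fun s' hs' => ?_⟩, ?_⟩
    · have := hle s' (Ico_subset_Icc_self hs')
      rw [h1, ← zero_add (1 : ℝ), h.curve.periodic 0] at this
      exact this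
    · rw [← h.curve.periodic 0, zero_add, ← h1]
      exact hmin.symm
  · exact ⟨s, ⟨⟨hs.1, lt_of_le_of_ne hs.2 h1⟩, fun s' hs' => hle s' (Ico_subset_Icc_self hs')⟩,
      hmin.symm⟩

theorem exists_Ico (h : IsGuidance B D Φ Hd kN kT) (s : ℝ) :
    ∃ s' ∈ Ico (0 : ℝ) 1, Hd s' = Hd s := by
  obtain ⟨s', hs', he⟩ := h.curve.periodic.exists_mem_Ico₀ zero_lt_one s
  exact ⟨s', hs', he.symm⟩

theorem curveDist_le (h : IsGuidance B D Φ Hd kN kT) (H : G) (s : ℝ) :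
    curveDist D Hd H ≤ D H (Hd s) := by
  obtain ⟨s₀, hs₀, he⟩ := h.exists_isNearest H
  obtain ⟨s', hs', he'⟩ := h.exists_Ico s
  rw [← he, ← he']
  exact hs₀.2 s' hs'

theorem eq_curveDist (h : IsGuidance B D Φ Hd kN kT) {H : G} {s : ℝ} (hs : IsNearest D Hd H s) :
    D H (Hd s) = curveDist D Hd H := by
  obtain ⟨s₀, hs₀, he⟩ := h.exists_isNearest H
  refine le_antisymm ?_ (h.curveDist_le H s)
  rw [← he]
  exact hs.2 s₀ hs₀.1

theorem curveDist_nonneg (h : IsGuidance B D Φ Hd kN kT) (H : G) : 0 ≤ curveDist D Hd H := by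
  obtain ⟨s₀, -, he⟩ := h.exists_isNearest H
  rw [← he]
  exact h.ee.nonneg _ _

theorem curveDist_eq_zero (h : IsGuidance B D Φ Hd kN kT) {H : G} :
    curveDist D Hd H = 0 ↔ H ∈ range Hd := by
  constructor
  · intro h0
    obtain ⟨s₀, -, he⟩ := h.exists_isNearest H
    rw [h0] at he
    exact ⟨s₀, ((h.ee.eq_zero_iff _ _).1 he).symm⟩
  · rintro ⟨s, rfl⟩
    refine le_antisymm ?_ (h.curveDist_nonneg _)
    have := h.curveDist_le (Hd s) s
    rwa [(h.ee.eq_zero_iff _ _).2 rfl] at this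

theorem curveDist_pos (h : IsGuidance B D Φ Hd kN kT) {H : G} (hH : H ∉ range Hd) :
    0 < curveDist D Hd H :=
  lt_of_le_of_ne (h.curveDist_nonneg H) fun h0 => hH (h.curveDist_eq_zero.1 h0.symm)

theorem isNearest_sStar {H : G} (hH : H ∉ P1 D Hd) : IsNearest D Hd H (sStar D Hd H) := by
  have hH' : ∃! s, IsNearest D Hd H s := not_not.1 hH
  rw [sStar, dif_pos hH']
  exact hH'.choose_spec.1

theorem eq_sStar {H : G} (hH : H ∉ P1 D Hd) {s : ℝ} (hs : IsNearest D Hd H s) :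
    s = sStar D Hd H := by
  have hH' : ∃! s, IsNearest D Hd H s := not_not.1 hH
  exact hH'.unique hs (isNearest_sStar hH)

theorem notMem_P_of_mem_range (h : IsGuidance B D Φ Hd kN kT) {H : G} (hH : H ∈ range Hd) :
    H ∉ B.P D Hd := by
  rintro (h1 | h2)
  · apply h1
    obtain ⟨r, rfl⟩ := hH
    obtain ⟨s, hs, he⟩ := h.exists_Ico r
    rw [← he]
    have h0 : D (Hd s) (Hd s) = 0 := (h.ee.eq_zero_iff _ _).2 rfl
    refine ⟨s, ⟨hs, fun s' _ => by rw [h0]; exact h.ee.nonneg _ _⟩, fun s' hs' => ?_⟩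
    have h3 : D (Hd s) (Hd s') ≤ 0 := by
      have := hs'.2 s hs
      rwa [h0] at this
    have h4 := (h.ee.eq_zero_iff _ _).1 (le_antisymm h3 (h.ee.nonneg _ _))
    exact h.curve.injOn hs'.1 hs h4.symm
  · exact h2.2.1 hH

theorem diff_of_notMem {H : G} (hP : H ∉ B.P D Hd) (hC : H ∉ range Hd) :
    B.DiffV D H (Hd (sStar D Hd H)) ∧ B.DiffW D H (Hd (sStar D Hd H)) := by
  by_contra hcon
  exact hP (Or.inr ⟨fun h1 => hP (Or.inl h1), hC, hcon⟩)

/-- A continuous periodic quantity evaluated at the closest point depends continuously on the state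
wherever the closest point is unique. -/
theorem continuousWithinAt_sStar (h : IsGuidance B D Φ Hd kN kT) {X : Type*} [TopologicalSpace X]
    {F : ℝ → X} (hF : Continuous F) (hper : F 1 = F 0) {H : G} (hH : H ∉ P1 D Hd) :
    ContinuousWithinAt (fun H => F (sStar D Hd H)) (P1 D Hd)ᶜ H := by
  rw [ContinuousWithinAt, tendsto_def]
  intro N hN
  obtain ⟨O, hON, hO, hmem⟩ := mem_nhds_iff.1 hN
  have hZ : IsCompact (Icc (0 : ℝ) 1 ∩ F ⁻¹' Oᶜ) :=
    isCompact_Icc.inter_right (hO.isClosed_compl.preimage hF)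
  -- Parameters with value outside `O` form a compact set without minimizers for `H`. The strict
  -- inequality there persists for nearby states, whose minimizers are thus elsewhere.
  have hev : ∀ᶠ H' in 𝓝 H, ∀ s ∈ Icc (0 : ℝ) 1 ∩ F ⁻¹' Oᶜ, curveDist D Hd H' < D H' (Hd s) := by
    refine hZ.eventually_forall_of_forall_eventually fun s hs => ?_
    have hc1 : Continuous fun p : G × ℝ => curveDist D Hd p.1 :=
      h.continuous_curveDist.comp continuous_fst
    have hc2 : Continuous fun p : G × ℝ => D p.1 (Hd p.2) :=
      h.continuous_dist.comp (continuous_fst.prodMk (h.curve.continuous.comp continuous_snd))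
    refine (isOpen_lt hc1 hc2).mem_nhds (lt_of_le_of_ne (h.curveDist_le H s) fun heq => ?_)
    rcases eq_or_ne s 1 with rfl | hne
    · have h0 : IsNearest D Hd H 0 := by
        refine ⟨by simp, fun s' _ => ?_⟩
        rw [← h.curve.periodic 0, zero_add]
        have : curveDist D Hd H = D H (Hd 1) := heq
        rw [← this]
        exact h.curveDist_le H s'
      apply hs.2
      rw [hper, eq_sStar hH h0]
      exact hmem
    · have h0 : IsNearest D Hd H s := by
        refine ⟨⟨hs.1.1, lt_of_le_of_ne hs.1.2 hne⟩, fun s' _ => ?_⟩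
        have : curveDist D Hd H = D H (Hd s) := heq
        rw [← this]
        exact h.curveDist_le H s'
      apply hs.2
      rw [eq_sStar hH h0]
      exact hmem
  filter_upwards [mem_nhdsWithin_of_mem_nhds hev, self_mem_nhdsWithin] with H' h1 h2
  have h3 := isNearest_sStar h2
  apply hON
  by_contra hcon
  exact (h1 _ ⟨Ico_subset_Icc_self h3.1, hcon⟩).ne' (h.eq_curveDist h3)

/-- By periodicity a minimizer on `[0,1)` is a minimizer on the whole line, so Fermat's rule applies
even at `s = 0`. -/
theorem sum_LW_mul_curveTwist (h : IsGuidance B D Φ Hd kN kT) {H : G} {s : ℝ}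
    (hs : IsNearest D Hd H s) (hW : B.DiffW D H (Hd s)) :
    ∑ j, B.LW D H (Hd s) j * B.curveTwist Hd s j = 0 := by
  have h1 := LieBasis.DiffW.hasDerivWithinAt h.isClosed (W := Hd) hW
    ((h.curve.hasDerivAt h.isClosed s).hasDerivWithinAt (s := univ))
  refine IsLocalMin.hasDerivAt_eq_zero (a := s) ?_ (hasDerivWithinAt_univ.1 h1)
  refine Eventually.of_forall fun r => ?_
  change D H (Hd s) ≤ D H (Hd r)
  rw [h.eq_curveDist hs]
  exact h.curveDist_le H r

/-- Left-invariance transfers the stationarity at the closest point from the second variable to the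
first. Motion along the tangent component hence does not affect the distance to first order. -/
theorem sum_LV_mul_xiT (h : IsGuidance B D Φ Hd kN kT) {H : G} (hP : H ∉ B.P D Hd)
    (hC : H ∉ range Hd) :
    ∑ j, B.LV D H (Hd (sStar D Hd H)) j * B.xiT D Hd H j = 0 := by
  obtain ⟨hV, hW⟩ := diff_of_notMem hP hC
  have h1 := h.sum_LW_mul_curveTwist (isNearest_sStar fun h1 => hP (Or.inl h1)) hW
  rw [B.LW_eq_neg_LV h.isClosed h.left hV hW] at h1
  simpa [LieBasis.xiT] using h1

/-- If `LV` vanished, the chain rule would give `σ ↦ D (Φ σ V W) W` derivative zero at `0`. By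
chainability this function is `D V W - D V (Φ σ V W)`, and local linearity makes its right
derivative strictly negative. -/
theorem LV_ne_zero (h : IsGuidance B D Φ Hd kN kT) {V W : G} (hne : V ≠ W)
    (hV : B.DiffV D V W) : B.LV D V W ≠ 0 := by
  intro h0
  have hdiff := ((h.chain.path.differentiable V W) 0 (by simp)).hasDerivWithinAt
  have hΦ0 := h.chain.path.zero V W
  obtain ⟨x, ξ, -, -, -, -, hξ⟩ := B.exists_coordinates h.isClosed B.expS_zero
    B.hasStrictFDerivAt_expS (V := fun σ => Φ σ V W) hdiff
  have h2 := hξ (uniqueDiffOn_Icc zero_lt_one 0 (by simp)) (by simp)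
  rw [h2] at hdiff
  have h1 := LieBasis.DiffV.hasDerivWithinAt h.isClosed (D := D) (V := fun σ => Φ σ V W)
    (W := fun _ => W) (by simpa only [hΦ0] using hV) hdiff continuousWithinAt_const
  simp only [hΦ0, h0, PiLp.zero_apply, zero_mul, Finset.sum_const_zero] at h1
  obtain ⟨c, hc, hlim⟩ := h.lin V W hne
  have h3 : HasDerivWithinAt (fun σ => D V (Φ σ V W)) 0 (Icc 0 1) 0 := by
    have := h1.neg
    rw [neg_zero] at this
    refine this.congr (fun σ hσ => ?_) ?_
    · have := h.chain.chain V W σ hσ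
      simp only [Pi.neg_apply]
      linarith
    · simp [hΦ0, (h.ee.eq_zero_iff V V).2 rfl]
  have h4 := (hasDerivWithinAt_iff_tendsto_slope.1 h3)
  have h5 : Icc (0 : ℝ) 1 \ {0} = Ioc 0 1 := by
    ext σ
    simp only [Set.mem_sdiff, mem_Icc, mem_singleton_iff, mem_Ioc]
    exact ⟨fun hσ => ⟨lt_of_le_of_ne hσ.1.1 (Ne.symm hσ.2), hσ.1.2⟩,
      fun hσ => ⟨⟨hσ.1.le, hσ.2⟩, hσ.1.ne'⟩⟩
  rw [h5, nhdsWithin_Ioc_eq_nhdsGT zero_lt_one] at h4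
  have h6 := tendsto_nhds_unique (h4.congr fun σ => ?_) hlim
  · exact hc.ne h6
  · simp [slope_def_field, hΦ0, (h.ee.eq_zero_iff V V).2 rfl, div_eq_inv_mul]

end IsGuidance

/-- This cuts a chaining path where it leaves a compact neighbourhood; compactness of the frontier
then bounds the length of the cut piece from below. -/
theorem exists_mem_frontier_of_path {X : Type*} [TopologicalSpace X] {γ : ℝ → X} {A : Set X}
    (hγ : ContinuousOn γ (Icc 0 1)) (hA : IsClosed A) (h0 : γ 0 ∈ A) (h1 : γ 1 ∉ A) :
    ∃ σ ∈ Icc (0 : ℝ) 1, γ σ ∈ frontier A := by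
  by_contra! hcon
  have hpre := isPreconnected_Icc.image γ hγ
  have h2 : ∀ x ∈ γ '' Icc 0 1, x ∈ A → x ∈ interior A := by
    rintro _ ⟨σ, hσ, rfl⟩ hx
    by_contra hx'
    exact hcon σ hσ ⟨subset_closure hx, hx'⟩
  obtain ⟨x, -, hx1, hx2⟩ := hpre (interior A) Aᶜ isOpen_interior hA.isOpen_compl
    (fun x hx => by
      by_cases hxA : x ∈ A
      · exact Or.inl (h2 x hx hxA)
      · exact Or.inr hxA)
    ⟨γ 0, mem_image_of_mem _ (by simp), h2 _ (mem_image_of_mem _ (by simp)) h0⟩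
    ⟨γ 1, mem_image_of_mem _ (by simp), h1⟩
  exact hx2 (interior_subset hx1)

theorem IsCompact.exists_pos_le {X : Type*} [TopologicalSpace X] {K : Set X} (hK : IsCompact K)
    {f : X → ℝ} (hf : ContinuousOn f K) (hpos : ∀ x ∈ K, 0 < f x) :
    ∃ c, 0 < c ∧ ∀ x ∈ K, c ≤ f x := by
  rcases K.eq_empty_or_nonempty with rfl | hne
  · exact ⟨1, one_pos, by simp⟩
  · obtain ⟨x, hx, hmin⟩ := hK.exists_isMinOn hne hf
    exact ⟨f x, hpos x hx, fun y hy => hmin hy⟩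

theorem IsCompact.exists_nonneg_norm_le {X E : Type*} [TopologicalSpace X]
    [SeminormedAddCommGroup E] {K : Set X} (hK : IsCompact K)
    {f : X → E} (hf : ContinuousOn f K) : ∃ c, 0 ≤ c ∧ ∀ x ∈ K, ‖f x‖ ≤ c := by
  obtain ⟨c, hc⟩ := hK.exists_bound_of_continuousOn hf
  exact ⟨max c 0, le_max_right _ _, fun x hx => (hc x hx).trans (le_max_left _ _)⟩

/-! ### Compact sublevel sets, bounds and continuity of the field. -/

namespace IsGuidance

variable {B : LieBasis G m} {D : G → G → ℝ} {Φ : ℝ → G → G → G} {Hd : ℝ → G} {kN kT : G → ℝ}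

theorem continuousOn_path (h : IsGuidance B D Φ Hd kN kT) (V W : G) :
    ContinuousOn (fun σ => Φ σ V W) (Icc 0 1) :=
  isEmbedding_mat.continuousOn_iff.2 (h.chain.path.differentiable V W).continuousOn

/-- Induction on the radius. A chaining path that leaves a compact neighbourhood `A` of the first
point spends at least `δ`, the minimum of `D 1` on the frontier of `A`. By chainability the
remaining distance is below the previous radius, and left-invariance makes the constants independent
of the point. -/
theorem exists_isCompact_of_dist_lt (h : IsGuidance B D Φ Hd kN kT) :
    ∃ δ : ℝ, 0 < δ ∧ ∀ k : ℕ, ∃ Z : Set G, IsCompact Z ∧ ∀ V W, D V W < k * δ → V⁻¹ * W ∈ Z := by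
  have := locallyCompactSpace h.isClosed
  obtain ⟨A, hA, hA1⟩ := exists_compact_mem_nhds (1 : G)
  have hfr : IsCompact (frontier A) := hA.of_isClosed_subset isClosed_frontier
    (frontier_subset_iff_isClosed.2 hA.isClosed)
  have hc : Continuous fun g : G => D 1 g :=
    h.continuous_dist.comp (continuous_const.prodMk continuous_id)
  obtain ⟨δ, hδ, hδle⟩ := IsCompact.exists_pos_le hfr hc.continuousOn (fun g hg =>
    lt_of_le_of_ne (h.ee.nonneg 1 g) fun h0 => by
      have h1 := (h.ee.eq_zero_iff 1 g).1 h0.symm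
      rw [← h1] at hg
      exact hg.2 (mem_interior_iff_mem_nhds.2 hA1))
  refine ⟨δ, hδ, fun k => ?_⟩
  induction k with
  | zero => exact ⟨∅, isCompact_empty, fun V W hVW => by
      have := h.ee.nonneg V W
      simp at hVW
      linarith⟩
  | succ k ih =>
    obtain ⟨Z, hZ, hZmem⟩ := ih
    refine ⟨A ∪ (fun p : G × G => p.1 * p.2) '' (A ×ˢ Z),
      hA.union ((hA.prod hZ).image (by fun_prop)), fun V W hVW => ?_⟩
    by_cases hA' : V⁻¹ * W ∈ A
    · exact Or.inl hA'
    · right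
      obtain ⟨σ, hσ, hfrσ⟩ := exists_mem_frontier_of_path (γ := fun σ => V⁻¹ * Φ σ V W)
        (continuousOn_const.mul (h.continuousOn_path V W)) hA.isClosed
        (by simpa [h.chain.path.zero] using mem_of_mem_nhds hA1)
        (by simpa [h.chain.path.one] using hA')
      have h1 := hδle _ hfrσ
      have h2 : D 1 (V⁻¹ * Φ σ V W) = D V (Φ σ V W) := by
        rw [← h.left V 1 (V⁻¹ * Φ σ V W), mul_one, mul_inv_cancel_left]
      have h3 := h.chain.chain V W σ hσ
      refine ⟨(V⁻¹ * Φ σ V W, (Φ σ V W)⁻¹ * W),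
        ⟨frontier_subset_iff_isClosed.2 hA.isClosed hfrσ, hZmem _ _ ?_⟩, by simp [mul_assoc]⟩
      push_cast at hVW
      linarith

theorem isCompact_sublevel (h : IsGuidance B D Φ Hd kN kT) (c : ℝ) :
    IsCompact {H | curveDist D Hd H ≤ c} := by
  obtain ⟨δ, hδ, hk⟩ := h.exists_isCompact_of_dist_lt
  obtain ⟨k, hkc⟩ := exists_nat_gt (c / δ)
  obtain ⟨Z, hZ, hmem⟩ := hk k
  refine IsCompact.of_isClosed_subset
    ((h.curve.isCompact_range.prod hZ).image (f := fun p : G × G => p.1 * p.2⁻¹) (by fun_prop))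
    (isClosed_le h.continuous_curveDist continuous_const) fun H hH => ?_
  obtain ⟨s, -, hs⟩ := h.exists_isNearest H
  refine ⟨(Hd s, H⁻¹ * Hd s), ⟨mem_range_self s, hmem _ _ ?_⟩, by simp⟩
  rw [hs]
  exact lt_of_le_of_lt hH ((div_lt_iff₀ hδ).1 hkc)

/-- At points of differentiability a local bound comes from continuity, at the others it is part of
the definition of an EE-distance; compactness makes it uniform. -/
theorem exists_LV_bound (h : IsGuidance B D Φ Hd kN kT) {K : Set (G × G)} (hK : IsCompact K) :
    ∃ M, 0 ≤ M ∧ ∀ p ∈ K, B.LVExists D p.1 p.2 → ‖B.LV D p.1 p.2‖ ≤ M := by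
  refine hK.induction_on (p := fun K => ∃ M, 0 ≤ M ∧ ∀ p ∈ K, B.LVExists D p.1 p.2 →
    ‖B.LV D p.1 p.2‖ ≤ M) ⟨0, le_rfl, by simp⟩ ?_ ?_ ?_
  · rintro s t hst ⟨M, hM0, hM⟩
    exact ⟨M, hM0, fun p hp => hM p (hst hp)⟩
  · rintro s t ⟨M, hM0, hM⟩ ⟨N, hN0, hN⟩
    refine ⟨max M N, le_max_of_le_left hM0, ?_⟩
    rintro p (hp | hp) hL
    · exact (hM p hp hL).trans (le_max_left _ _)
    · exact (hN p hp hL).trans (le_max_right _ _)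
  · rintro ⟨V, W⟩ -
    suffices ∃ M, ∀ᶠ p : G × G in 𝓝 (V, W), B.LVExists D p.1 p.2 → ‖B.LV D p.1 p.2‖ ≤ M by
      obtain ⟨M, hM⟩ := this
      exact ⟨_, mem_nhdsWithin_of_mem_nhds hM, max M 0, le_max_right _ _,
        fun p hp hL => (hp hL).trans (le_max_left _ _)⟩
    by_cases hV : B.DiffV D V W
    · refine ⟨‖B.LV D V W‖ + 1, ?_⟩
      have := hV.2.norm.eventually (gt_mem_nhds (lt_add_one _))
      filter_upwards [this] with p hp _
      exact hp.le
    · exact (h.ee.limits_V V W hV).2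

theorem exists_xiN_bound (h : IsGuidance B D Φ Hd kN kT) (c : ℝ) :
    ∃ M, 0 ≤ M ∧ ∀ H, curveDist D Hd H ≤ c → H ∉ B.P D Hd → H ∉ range Hd →
      ‖B.xiN D Hd H‖ ≤ M := by
  obtain ⟨M, hM0, hM⟩ := h.exists_LV_bound ((h.isCompact_sublevel c).prod h.curve.isCompact_range)
  refine ⟨M, hM0, fun H hH hP hC => ?_⟩
  rw [LieBasis.xiN, norm_neg]
  exact hM (H, _) ⟨hH, mem_range_self _⟩ (diff_of_notMem hP hC).1.1.self_of_nhds

theorem exists_curveTwist_bounds (h : IsGuidance B D Φ Hd kN kT) :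
    ∃ a M, 0 < a ∧ 0 ≤ M ∧ ∀ s, a ≤ ‖B.curveTwist Hd s‖ ∧ ‖B.curveTwist Hd s‖ ≤ M := by
  have hc := h.curve.continuous_curveTwist h.isClosed
  obtain ⟨a, ha, hle⟩ := IsCompact.exists_pos_le (isCompact_Icc (a := (0 : ℝ)) (b := 1))
    hc.norm.continuousOn (fun s _ => norm_pos_iff.2 (h.curve.proper s))
  obtain ⟨M, hM, hMle⟩ := IsCompact.exists_nonneg_norm_le (isCompact_Icc (a := (0 : ℝ)) (b := 1))
    hc.continuousOn
  refine ⟨a, M, ha, hM, fun s => ?_⟩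
  obtain ⟨s', hs', he⟩ := h.curve.periodic_curveTwist.exists_mem_Ico₀ zero_lt_one s
  rw [he]
  exact ⟨hle _ (Ico_subset_Icc_self hs'), hMle _ (Ico_subset_Icc_self hs')⟩

theorem exists_Psi_bound (h : IsGuidance B D Φ Hd kN kT) (c : ℝ) :
    ∃ M, 0 ≤ M ∧ ∀ H, curveDist D Hd H ≤ c → H ∉ B.P D Hd → ‖B.Psi D Hd kN kT H‖ ≤ M := by
  obtain ⟨M, hM0, hM⟩ := h.exists_xiN_bound c
  obtain ⟨a, N, -, hN0, hN⟩ := h.exists_curveTwist_bounds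
  obtain ⟨b, hb0, hb⟩ := IsCompact.exists_nonneg_norm_le (h.isCompact_sublevel c)
    h.gain.continuous_kN.continuousOn
  obtain ⟨d, hd0, hd⟩ := IsCompact.exists_nonneg_norm_le (h.isCompact_sublevel c)
    h.gain.continuous_kT.continuousOn
  refine ⟨b * M + d * N, by positivity, fun H hH hP => ?_⟩
  refine (norm_add_le _ _).trans (add_le_add ?_ ?_)
  · by_cases hC : H ∈ range Hd
    · rw [h.gain.kN_zero H hC, zero_smul, norm_zero]
      positivity
    · rw [norm_smul]
      exact mul_le_mul (hb H hH) (hM H hH hP hC) (norm_nonneg _) hb0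
  · rw [norm_smul]
    exact mul_le_mul (hd H hH) (hN _).2 (norm_nonneg _) hd0

theorem continuousOn_xiN (h : IsGuidance B D Φ Hd kN kT) :
    ContinuousOn (B.xiN D Hd) ((B.P D Hd)ᶜ \ range Hd) := by
  intro H hH
  have h1 : H ∉ P1 D Hd := fun h1 => hH.1 (Or.inl h1)
  have hsub : (B.P D Hd)ᶜ \ range Hd ⊆ (P1 D Hd)ᶜ := fun H' hH' h1' => hH'.1 (Or.inl h1')
  have h2 := (h.continuousWithinAt_sStar h.curve.continuous
    (by have := h.curve.periodic 0; rwa [zero_add] at this) h1).mono hsub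
  have h3 := (diff_of_notMem hH.1 hH.2).1.2
  refine ContinuousWithinAt.neg ?_
  exact ContinuousAt.comp_continuousWithinAt (f := fun H => (H, Hd (sStar D Hd H))) h3
    (continuousWithinAt_id.prodMk h2)

theorem continuousOn_xiT (h : IsGuidance B D Φ Hd kN kT) :
    ContinuousOn (B.xiT D Hd) (B.P D Hd)ᶜ := by
  intro H hH
  have h1 : H ∉ P1 D Hd := fun h1 => hH (Or.inl h1)
  have hsub : (B.P D Hd)ᶜ ⊆ (P1 D Hd)ᶜ := fun H' hH' h1' => hH' (Or.inl h1')
  exact (h.continuousWithinAt_sStar (h.curve.continuous_curveTwist h.isClosed)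
    (by have := h.curve.periodic_curveTwist 0; rwa [zero_add] at this) h1).mono hsub

/-- At the curve nothing is known about the continuity of `xiN`; it stays bounded near the curve,
while the gain `kN` tends to zero. -/
theorem continuousOn_Psi (h : IsGuidance B D Φ Hd kN kT) :
    ContinuousOn (B.Psi D Hd kN kT) (B.P D Hd)ᶜ := by
  have hT : ContinuousOn (fun H => kT H • B.xiT D Hd H) (B.P D Hd)ᶜ :=
    h.gain.continuous_kT.continuousOn.smul h.continuousOn_xiT
  refine ContinuousOn.add (fun H hH => ?_) hT
  by_cases hC : H ∈ range Hd
  · have h0 : kN H • B.xiN D Hd H = 0 := by rw [h.gain.kN_zero H hC, zero_smul]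
    rw [ContinuousWithinAt, h0]
    obtain ⟨M, hM0, hM⟩ := h.exists_xiN_bound 1
    have hlim : Tendsto (fun H => ‖kN H‖ * M) (𝓝[(B.P D Hd)ᶜ] H) (𝓝 0) := by
      have : Continuous fun H => ‖kN H‖ * M := by
        have := h.gain.continuous_kN
        fun_prop
      have := this.tendsto H
      rw [h.gain.kN_zero H hC, norm_zero, zero_mul] at this
      exact this.mono_left nhdsWithin_le_nhds
    refine squeeze_zero_norm' ?_ hlim
    have hev : ∀ᶠ H' in 𝓝 H, curveDist D Hd H' < 1 :=
      h.continuous_curveDist.tendsto H |>.eventually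
        (gt_mem_nhds (by rw [h.curveDist_eq_zero.2 hC]; exact one_pos))
    filter_upwards [mem_nhdsWithin_of_mem_nhds hev, self_mem_nhdsWithin] with H' h1 h2
    rw [norm_smul]
    by_cases hC' : H' ∈ range Hd
    · rw [h.gain.kN_zero H' hC', norm_zero, zero_mul, zero_mul]
    · exact mul_le_mul_of_nonneg_left (hM H' h1.le h2 hC') (norm_nonneg _)
  · have hopen : (range Hd)ᶜ ∈ 𝓝 H := h.curve.isCompact_range.isClosed.isOpen_compl.mem_nhds hC
    have := (h.gain.continuous_kN.continuousWithinAt).smul (h.continuousOn_xiN H ⟨hH, hC⟩)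
    exact this.mono_of_mem_nhdsWithin (inter_mem_nhdsWithin _ hopen)

theorem Psi_eq_of_mem_range (h : IsGuidance B D Φ Hd kN kT) {H : G} (hC : H ∈ range Hd) :
    B.Psi D Hd kN kT H = kT H • B.xiT D Hd H := by
  rw [LieBasis.Psi, h.gain.kN_zero H hC, zero_smul, zero_add]

theorem xiT_curve (h : IsGuidance B D Φ Hd kN kT) (s : ℝ) :
    B.xiT D Hd (Hd s) = B.curveTwist Hd s := by
  -- Point and twist are paired so that one representative in `[0,1)` serves both.
  have hper : Function.Periodic (fun s => (Hd s, B.curveTwist Hd s)) 1 := fun s =>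
    Prod.ext (h.curve.periodic s) (h.curve.periodic_curveTwist s)
  obtain ⟨s', hs', he⟩ := hper.exists_mem_Ico₀ zero_lt_one s
  obtain ⟨he1, he2⟩ := Prod.mk.inj he
  have h1 : IsNearest D Hd (Hd s) s' := by
    refine ⟨hs', fun r _ => ?_⟩
    rw [← he1, (h.ee.eq_zero_iff _ _).2 rfl]
    exact h.ee.nonneg _ _
  have hP : Hd s ∉ P1 D Hd := fun h2 => h.notMem_P_of_mem_range (mem_range_self s) (Or.inl h2)
  rw [LieBasis.xiT, ← eq_sStar hP h1]
  exact he2.symm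

end IsGuidance

/-! ### Descent of the distance along the closed loop. -/

/-- `H` stays outside `P` and follows the field `Psi` at time `t` in the forward direction. -/
def LieBasis.FollowsAt (B : LieBasis G m) (Psi : G → EuclideanSpace ℝ (Fin m)) (P : Set G)
    (H : ℝ → G) (t : ℝ) : Prop :=
  H t ∉ P ∧ HasDerivWithinAt (fun r => mat (H r)) (B.S (Psi (H t)) * mat (H t)) (Ici t) t

namespace IsGuidance

variable {B : LieBasis G m} {D : G → G → ℝ} {Φ : ℝ → G → G → G} {Hd : ℝ → G} {kN kT : G → ℝ}
  {H : ℝ → G} {a b : ℝ}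

/-- The minimum over the curve need not be differentiable. Freezing the closest point `W` gives a
differentiable majorant that touches it at time `t`, which suffices for an upper bound on right
slopes. -/
theorem eventually_slope_lt (h : IsGuidance B D Φ Hd kN kT) {t : ℝ}
    (hf : B.FollowsAt (B.Psi D Hd kN kT) (B.P D Hd) H t) (hC : H t ∉ range Hd) {r : ℝ}
    (hr : -(kN (H t) * ‖B.xiN D Hd (H t)‖ ^ 2) < r) :
    ∀ᶠ z in 𝓝[>] t, slope (fun z => curveDist D Hd (H z)) t z < r := by
  obtain ⟨hP, hd⟩ := hf
  set W := Hd (sStar D Hd (H t)) with hW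
  have hV := (diff_of_notMem hP hC).1
  have h1 := LieBasis.DiffV.hasDerivWithinAt h.isClosed (W := fun _ => W) hV hd
    continuousWithinAt_const
  have hval : ∑ j, B.LV D (H t) W j * B.Psi D Hd kN kT (H t) j =
      -(kN (H t) * ‖B.xiN D Hd (H t)‖ ^ 2) := by
    have h2 := h.sum_LV_mul_xiT hP hC
    rw [← hW] at h2
    have h3 : ‖B.xiN D Hd (H t)‖ ^ 2 = ∑ j, B.LV D (H t) W j ^ 2 := by
      rw [LieBasis.xiN, norm_neg, EuclideanSpace.norm_sq_eq]
      simp [hW]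
    rw [h3, Finset.mul_sum, ← Finset.sum_neg_distrib]
    have h4 : ∀ j, B.LV D (H t) W j * B.Psi D Hd kN kT (H t) j =
        -(kN (H t) * B.LV D (H t) W j ^ 2) +
          kT (H t) * (B.LV D (H t) W j * B.xiT D Hd (H t) j) := by
      intro j
      simp only [LieBasis.Psi, LieBasis.xiN, PiLp.add_apply, PiLp.smul_apply, PiLp.neg_apply,
        smul_eq_mul, ← hW]
      ring
    rw [Finset.sum_congr rfl fun j _ => h4 j, Finset.sum_add_distrib, ← Finset.mul_sum, h2,
      mul_zero, add_zero]
  rw [hval] at h1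
  have h5 := (hasDerivWithinAt_iff_tendsto_slope.1 h1).eventually (gt_mem_nhds hr)
  rw [Ici_sdiff_left] at h5
  filter_upwards [h5, self_mem_nhdsWithin] with z hz hzt
  refine lt_of_le_of_lt ?_ hz
  have hzt' : 0 < z - t := sub_pos.2 hzt
  rw [slope_def_field, slope_def_field]
  refine div_le_div_of_nonneg_right ?_ hzt'.le
  have h6 : D (H t) W = curveDist D Hd (H t) :=
    h.eq_curveDist (isNearest_sStar fun h1 => hP (Or.inl h1))
  have h7 : curveDist D Hd (H z) ≤ D (H z) W := h.curveDist_le _ _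
  linarith

theorem curveDist_le_sub (h : IsGuidance B D Φ Hd kN kT) (hab : a ≤ b)
    (hc : ContinuousOn H (Icc a b))
    (hf : ∀ t ∈ Ico a b, B.FollowsAt (B.Psi D Hd kN kT) (B.P D Hd) H t)
    (hC : ∀ t ∈ Ico a b, H t ∉ range Hd) {μ : ℝ}
    (hμ : ∀ t ∈ Ico a b, μ ≤ kN (H t) * ‖B.xiN D Hd (H t)‖ ^ 2) :
    curveDist D Hd (H b) ≤ curveDist D Hd (H a) - μ * (b - a) := by
  have h1 : ∀ x : ℝ, HasDerivAt (fun x => curveDist D Hd (H a) - μ * (x - a)) (-μ) x := fun x => by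
    have := (((hasDerivAt_id x).sub_const a).const_mul μ).const_sub (curveDist D Hd (H a))
    simpa using this
  refine image_le_of_liminf_slope_right_le_deriv_boundary
    (f := fun t => curveDist D Hd (H t)) (B := fun x => curveDist D Hd (H a) - μ * (x - a))
    (B' := fun _ => -μ) (h.continuous_curveDist.comp_continuousOn hc) (by simp)
    (fun x _ => (h1 x).continuousAt.continuousWithinAt) (fun x _ => (h1 x).hasDerivWithinAt)
    (fun x hx r hr => ?_) (right_mem_Icc.2 hab)
  exact (h.eventually_slope_lt (hf x hx) (hC x hx)
    (lt_of_le_of_lt (neg_le_neg (hμ x hx)) hr)).frequently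

/-- The slope estimate holds only off the curve. If the curve is visited, it is applied after the
last visit `c`; by continuity the distance starts from zero there. -/
theorem curveDist_le_of_follows (h : IsGuidance B D Φ Hd kN kT) (hab : a ≤ b)
    (hc : ContinuousOn H (Icc a b))
    (hf : ∀ t ∈ Ico a b, B.FollowsAt (B.Psi D Hd kN kT) (B.P D Hd) H t) :
    curveDist D Hd (H b) ≤ curveDist D Hd (H a) := by
  have key : ∀ c ∈ Icc a b, (∀ t ∈ Ico c b, H t ∉ range Hd) →
      curveDist D Hd (H b) ≤ curveDist D Hd (H c) := fun c hcab hcC => by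
    have := h.curveDist_le_sub hcab.2 (hc.mono (Icc_subset_Icc_left hcab.1))
      (fun t ht => hf t ⟨hcab.1.trans ht.1, ht.2⟩) hcC (μ := 0) (fun t ht => by
        have := h.gain.kN_pos _ (hcC t ht)
        positivity)
    simpa using this
  by_cases hb : H b ∈ range Hd
  · rw [h.curveDist_eq_zero.2 hb]
    exact h.curveDist_nonneg _
  have hcomp : IsCompact (Icc a b ∩ H ⁻¹' range Hd) :=
    isCompact_Icc.of_isClosed_subset
      (hc.preimage_isClosed_of_isClosed isClosed_Icc h.curve.isCompact_range.isClosed)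
      inter_subset_left
  rcases (Icc a b ∩ H ⁻¹' range Hd).eq_empty_or_nonempty with he | hne
  · exact key a (left_mem_Icc.2 hab) fun t ht htC =>
      (he ▸ (⟨Ico_subset_Icc_self ht, htC⟩ : t ∈ Icc a b ∩ H ⁻¹' range Hd) : t ∈ (∅ : Set ℝ))
  · obtain ⟨c, ⟨hcab, hcC⟩, hmax⟩ := hcomp.exists_isGreatest hne
    have hcb : c < b := lt_of_le_of_ne hcab.2 fun h0 => hb (h0 ▸ hcC)
    have hlim : Tendsto (fun t => curveDist D Hd (H t)) (𝓝[>] c) (𝓝 (curveDist D Hd (H c))) := by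
      have h1 := (h.continuous_curveDist.comp_continuousOn hc) c hcab
      rw [ContinuousWithinAt] at h1
      refine h1.mono_left ?_
      rw [← nhdsWithin_Ioc_eq_nhdsGT hcb]
      exact nhdsWithin_mono _ fun t ht => ⟨hcab.1.trans ht.1.le, ht.2⟩
    -- The estimate holds from every time just after `c`, where the state is off the curve, and
    -- passes to the limit.
    have hle : curveDist D Hd (H b) ≤ curveDist D Hd (H c) := by
      refine ge_of_tendsto hlim ?_
      filter_upwards [Ioc_mem_nhdsGT hcb] with t ht
      refine key t ⟨hcab.1.trans ht.1.le, ht.2⟩ fun r hr hrC => ?_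
      have := hmax ⟨⟨(hcab.1.trans ht.1.le).trans hr.1, hr.2.le⟩, hrC⟩
      linarith [ht.1, hr.1]
    rw [h.curveDist_eq_zero.2 hcC] at hle
    exact hle.trans (h.curveDist_nonneg _)

theorem mem_range_of_follows (h : IsGuidance B D Φ Hd kN kT) (hab : a ≤ b)
    (hc : ContinuousOn H (Icc a b))
    (hf : ∀ t ∈ Ico a b, B.FollowsAt (B.Psi D Hd kN kT) (B.P D Hd) H t)
    (ha : H a ∈ range Hd) : H b ∈ range Hd := by
  have h1 := h.curveDist_le_of_follows hab hc hf
  rw [h.curveDist_eq_zero.2 ha] at h1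
  exact h.curveDist_eq_zero.1 (le_antisymm h1 (h.curveDist_nonneg _))

end IsGuidance

/-! ### Peano's theorem by Euler polygons. -/

theorem norm_sub_sub_smul_le_of_step {E : Type*} [NormedAddCommGroup E] [NormedSpace ℝ E]
    {u : ℕ → E} {w : E} {c : ℝ} {i j : ℕ} (hij : i ≤ j)
    (h : ∀ k, i ≤ k → k < j → ‖u (k + 1) - u k - w‖ ≤ c) :
    ‖u j - u i - ((j : ℝ) - i) • w‖ ≤ ((j : ℝ) - i) * c := by
  induction j, hij using Nat.le_induction with
  | base => simp
  | succ j hij ih =>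
    have h1 := ih fun k hk hkj => h k hk (hkj.trans (Nat.lt_succ_self j))
    have h2 := h j hij (Nat.lt_succ_self j)
    have h3 : u (j + 1) - u i - (((j + 1 : ℕ) : ℝ) - i) • w =
        (u j - u i - ((j : ℝ) - i) • w) + (u (j + 1) - u j - w) := by
      push_cast
      module
    rw [h3]
    refine (norm_add_le _ _).trans ((add_le_add h1 h2).trans (le_of_eq ?_))
    push_cast
    ring

/-- The Euler scheme with step `h` on the group. -/
def LieBasis.euler (B : LieBasis G m) (Ψ : G → EuclideanSpace ℝ (Fin m)) (g₀ : G) (h : ℝ) : ℕ → G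
  | 0 => g₀
  | k + 1 => B.expS (h • Ψ (B.euler Ψ g₀ h k)) * B.euler Ψ g₀ h k

theorem exists_norm_exp_sub_le {η : ℝ} (hη : 0 < η) :
    ∃ r, 0 < r ∧ ∀ X : Matrix (Fin n) (Fin n) ℝ, ‖X‖ < r →
      ‖NormedSpace.exp X - 1 - X‖ ≤ η * ‖X‖ := by
  have h := (hasStrictFDerivAt_exp_zero (𝕂 := ℝ) (𝔸 := Matrix (Fin n) (Fin n) ℝ)).hasFDerivAt
  have h1 := (hasFDerivAt_iff_isLittleO.1 h).def hη
  obtain ⟨r, hr, hball⟩ := Metric.eventually_nhds_iff.1 h1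
  refine ⟨r, hr, fun X hX => ?_⟩
  have h2 := hball (y := X) (by simpa [dist_eq_norm] using hX)
  rw [NormedSpace.exp_zero, sub_zero] at h2
  exact h2

namespace LieBasis

variable (B : LieBasis G m) {Ψ : G → EuclideanSpace ℝ (Fin m)} {M : ℝ}

theorem exists_norm_S_le : ∃ K, 0 < K ∧ ∀ x, ‖B.S x‖ ≤ K * ‖x‖ :=
  ContinuousLinearMap.bound (F := Matrix (Fin n) (Fin n) ℝ) B.SL

theorem exists_exp_step (hM0 : 0 ≤ M) {η : ℝ} (hη : 0 < η) :
    ∃ r, 0 < r ∧ ∀ h : ℝ, |h| < r → ∀ x, ‖x‖ ≤ M →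
      ‖NormedSpace.exp (B.S (h • x)) - 1 - h • B.S x‖ ≤ η * |h| := by
  obtain ⟨K, hK, hS⟩ := B.exists_norm_S_le
  set L := K * M + 1 with hL
  have hL0 : 0 < L := by positivity
  obtain ⟨r, hr, hexp⟩ := exists_norm_exp_sub_le (n := n) (div_pos hη hL0)
  refine ⟨r / L, by positivity, fun h hh x hx => ?_⟩
  have h1 : ‖B.S (h • x)‖ ≤ |h| * L := by
    rw [B.S_smul, norm_smul, Real.norm_eq_abs]
    refine mul_le_mul_of_nonneg_left ?_ (abs_nonneg _)
    exact (hS x).trans (by nlinarith)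
  have h2 := hexp _ (lt_of_le_of_lt h1 ((lt_div_iff₀ hL0).1 hh))
  rw [← B.S_smul]
  refine h2.trans ((mul_le_mul_of_nonneg_left h1 (by positivity)).trans (le_of_eq ?_))
  field_simp

theorem exists_exp_sub_one (hM0 : 0 ≤ M) :
    ∃ L r, 0 < L ∧ 0 < r ∧ ∀ h : ℝ, |h| < r → ∀ x, ‖x‖ ≤ M →
      ‖NormedSpace.exp (B.S (h • x)) - 1‖ ≤ L * |h| := by
  obtain ⟨r, hr, hexp⟩ := B.exists_exp_step hM0 one_pos
  obtain ⟨K, hK, hS⟩ := B.exists_norm_S_le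
  refine ⟨1 + K * M, r, by positivity, hr, fun h hh x hx => ?_⟩
  have h1 := hexp h hh x hx
  have h2 : ‖h • B.S x‖ ≤ |h| * (K * M) := by
    rw [norm_smul, Real.norm_eq_abs]
    exact mul_le_mul_of_nonneg_left
      ((hS x).trans (mul_le_mul_of_nonneg_left hx hK.le)) (abs_nonneg _)
  have h3 : NormedSpace.exp (B.S (h • x)) - 1 =
      (NormedSpace.exp (B.S (h • x)) - 1 - h • B.S x) + h • B.S x := by abel
  rw [h3]
  refine (norm_add_le _ _).trans ((add_le_add h1 h2).trans (le_of_eq ?_))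
  ring

theorem expS_neg (x : EuclideanSpace ℝ (Fin m)) : (B.expS x)⁻¹ = B.expS (-x) := by
  have h := B.expS_add_smul 1 (-1) x
  rw [add_neg_cancel, zero_smul, B.expS_zero, one_smul, neg_one_smul] at h
  exact inv_eq_of_mul_eq_one_right h.symm

/-- Each step multiplies by a matrix within `L h` of the identity, of norm effect at most `1 + L h ≤
exp (L h)`. The inverse is bounded too, since compactness in the group needs both. -/
theorem norm_euler_le {L r h : ℝ} (hL : 0 < L) (hΨ : ∀ g, ‖Ψ g‖ ≤ M) (hh : 0 < h) (hr : h < r)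
    (hexp : ∀ h : ℝ, |h| < r → ∀ x, ‖x‖ ≤ M → ‖NormedSpace.exp (B.S (h • x)) - 1‖ ≤ L * |h|)
    (g₀ : G) {T : ℝ} {k : ℕ} (hk : k * h ≤ T) :
    ‖mat (B.euler Ψ g₀ h k)‖ ≤ (‖mat g₀‖ + ‖mat g₀⁻¹‖) * Real.exp (L * T) ∧
      ‖mat (B.euler Ψ g₀ h k)⁻¹‖ ≤ (‖mat g₀‖ + ‖mat g₀⁻¹‖) * Real.exp (L * T) := by
  have key : ‖mat (B.euler Ψ g₀ h k)‖ ≤ (‖mat g₀‖ + ‖mat g₀⁻¹‖) * Real.exp (L * h) ^ k ∧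
      ‖mat (B.euler Ψ g₀ h k)⁻¹‖ ≤ (‖mat g₀‖ + ‖mat g₀⁻¹‖) * Real.exp (L * h) ^ k := by
    clear hk
    induction k with
    | zero => simp [LieBasis.euler]
    | succ k ih =>
      set g := B.euler Ψ g₀ h k with hg
      have h1 : ‖NormedSpace.exp (B.S (h • Ψ g)) - 1‖ ≤ L * h := by
        simpa [abs_of_pos hh] using hexp h (by rwa [abs_of_pos hh]) (Ψ g) (hΨ g)
      have h2 : ‖NormedSpace.exp (B.S (-(h • Ψ g))) - 1‖ ≤ L * h := by
        simpa [abs_of_pos hh] using hexp (-h) (by rwa [abs_neg, abs_of_pos hh]) (Ψ g) (hΨ g)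
      have h3 := Real.add_one_le_exp (L * h)
      -- Both orders are needed: the inverse of a step multiplies on the right.
      have hstep : ∀ (X Y : Matrix (Fin n) (Fin n) ℝ), ‖X - 1‖ ≤ L * h →
          ‖Y‖ ≤ (‖mat g₀‖ + ‖mat g₀⁻¹‖) * Real.exp (L * h) ^ k →
          ‖X * Y‖ ≤ (‖mat g₀‖ + ‖mat g₀⁻¹‖) * Real.exp (L * h) ^ (k + 1) ∧
          ‖Y * X‖ ≤ (‖mat g₀‖ + ‖mat g₀⁻¹‖) * Real.exp (L * h) ^ (k + 1) := by
        intro X Y hX hY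
        have hb : (L * h + 1) * ‖Y‖ ≤
            (‖mat g₀‖ + ‖mat g₀⁻¹‖) * Real.exp (L * h) ^ (k + 1) := by
          rw [pow_succ, ← mul_assoc, mul_comm]
          exact mul_le_mul hY h3 (by positivity) (by positivity)
        constructor
        · have : X * Y = (X - 1) * Y + Y := by noncomm_ring
          rw [this]
          refine (norm_add_le _ _).trans (le_trans ?_ hb)
          have := (norm_mul_le (X - 1) Y).trans (mul_le_mul_of_nonneg_right hX (norm_nonneg _))
          linarith
        · have : Y * X = Y * (X - 1) + Y := by noncomm_ring
          rw [this]
          refine (norm_add_le _ _).trans (le_trans ?_ hb)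
          have := (norm_mul_le Y (X - 1)).trans (mul_le_mul_of_nonneg_left hX (norm_nonneg _))
          linarith
      constructor
      · rw [LieBasis.euler, mat_mul, B.mat_expS]
        exact (hstep _ _ h1 ih.1).1
      · rw [LieBasis.euler, mul_inv_rev, mat_mul, B.expS_neg, B.mat_expS]
        exact (hstep _ _ h2 ih.2).2
  have hpow : Real.exp (L * h) ^ k ≤ Real.exp (L * T) := by
    rw [← Real.exp_nat_mul]
    apply Real.exp_le_exp.2
    nlinarith
  have h0 : 0 ≤ ‖mat g₀‖ + ‖mat g₀⁻¹‖ := by positivity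
  exact ⟨key.1.trans (mul_le_mul_of_nonneg_left hpow h0),
    key.2.trans (mul_le_mul_of_nonneg_left hpow h0)⟩

theorem mat_euler_succ (g₀ : G) (h : ℝ) (k : ℕ) :
    mat (B.euler Ψ g₀ h (k + 1)) =
      NormedSpace.exp (B.S (h • Ψ (B.euler Ψ g₀ h k))) * mat (B.euler Ψ g₀ h k) := by
  rw [LieBasis.euler, mat_mul, B.mat_expS]

theorem tendsto_floor_mul_div {b : ℝ} (hb : 0 ≤ b) :
    Tendsto (fun N : ℕ => (⌊b * ((N : ℝ) + 1)⌋₊ : ℝ) * ((N : ℝ) + 1)⁻¹) atTop (𝓝 b) := by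
  have h1 : Tendsto (fun N : ℕ => b - ((N : ℝ) + 1)⁻¹) atTop (𝓝 b) := by
    have := tendsto_one_div_add_atTop_nhds_zero_nat (𝕜 := ℝ)
    simpa using tendsto_const_nhds.sub this
  refine tendsto_of_tendsto_of_tendsto_of_le_of_le h1 tendsto_const_nhds (fun N => ?_) fun N => ?_
  · have hN : (0 : ℝ) < (N : ℝ) + 1 := by positivity
    have := Nat.lt_floor_add_one (b * ((N : ℝ) + 1))
    have h2 : b * ((N : ℝ) + 1) - 1 ≤ ⌊b * ((N : ℝ) + 1)⌋₊ := by linarith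
    have h3 := mul_le_mul_of_nonneg_right h2 (inv_pos.2 hN).le
    rw [sub_mul, mul_inv_cancel_right₀ hN.ne', one_mul] at h3
    exact h3
  · have hN : (0 : ℝ) < (N : ℝ) + 1 := by positivity
    have h2 := Nat.floor_le (mul_nonneg hb hN.le)
    have h3 := mul_le_mul_of_nonneg_right h2 (inv_pos.2 hN).le
    rwa [mul_inv_cancel_right₀ hN.ne'] at h3

/-- Peano's theorem on a closed matrix group: the limit of Euler polygons of a bounded field solves
the equation at every time at which it is in an open set on which the field is continuous. -/
theorem exists_solution (hG : IsClosed (G : Set (GL (Fin n) ℝ))) (hM : ∀ g, ‖Ψ g‖ ≤ M)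
    {U : Set G} (hU : IsOpen U) (hΨ : ContinuousOn Ψ U) (g₀ : G) :
    ∃ H : ℝ → G, H 0 = g₀ ∧ ContinuousOn H (Ici 0) ∧ ∀ t, 0 ≤ t → H t ∈ U →
      HasDerivWithinAt (fun r => mat (H r)) (B.S (Ψ (H t)) * mat (H t)) (Ici 0) t := by
  have hM0 : 0 ≤ M := (norm_nonneg _).trans (hM g₀)
  obtain ⟨L, r, hL, hr, hexp⟩ := B.exists_exp_sub_one hM0
  set h : ℕ → ℝ := fun N => ((N : ℝ) + 1)⁻¹ with hh
  have hpos : ∀ N, 0 < h N := fun N => by positivity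
  have hlim0 : Tendsto h atTop (𝓝 0) := by
    have := tendsto_one_div_add_atTop_nhds_zero_nat (𝕜 := ℝ)
    simpa [hh] using this
  set idx : ℕ → ℝ → ℕ := fun N b => ⌊b * ((N : ℝ) + 1)⌋₊ with hidx
  have hidxle : ∀ N b, 0 ≤ b → (idx N b : ℝ) * h N ≤ b := fun N b hb => by
    have hN : (0 : ℝ) < (N : ℝ) + 1 := by positivity
    have h3 := mul_le_mul_of_nonneg_right (Nat.floor_le (mul_nonneg hb hN.le)) (inv_pos.2 hN).le
    rwa [mul_inv_cancel_right₀ hN.ne'] at h3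
  have hidxmono : ∀ N a b, a ≤ b → idx N a ≤ idx N b := fun N a b hab =>
    Nat.floor_mono (mul_le_mul_of_nonneg_right hab (by positivity))
  have hidxlim : ∀ b, 0 ≤ b → Tendsto (fun N => (idx N b : ℝ) * h N) atTop (𝓝 b) :=
    fun b hb => tendsto_floor_mul_div hb
  set R : ℝ → ℝ := fun T => (‖mat g₀‖ + ‖mat g₀⁻¹‖) * Real.exp (L * T) with hR
  have hR0 : ∀ T, 0 ≤ R T := fun T => by positivity
  set p : ℕ → ℕ → G := fun N k => B.euler Ψ g₀ (h N) k with hp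
  -- An ultrafilter gives limits of the polygons at all times at once, in place of a subsequence
  -- from Arzelà–Ascoli.
  set 𝒰 : Ultrafilter ℕ := Ultrafilter.of atTop with h𝒰
  have h𝒰le : (𝒰 : Filter ℕ) ≤ atTop := Ultrafilter.of_le atTop
  have hsmall : ∀ᶠ N in (𝒰 : Filter ℕ), h N < r :=
    h𝒰le (hlim0.eventually (gt_mem_nhds hr))
  have hlimex : ∀ b : ℝ, ∃ g : G, 0 ≤ b → Tendsto (fun N => p N (idx N b)) 𝒰 (𝓝 g) := fun b => by
    by_cases hb : 0 ≤ b
    · have hev : ∀ᶠ N in (𝒰 : Filter ℕ), p N (idx N b) ∈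
          {g : G | ‖mat g‖ ≤ R b ∧ ‖mat g⁻¹‖ ≤ R b} := by
        filter_upwards [hsmall] with N hN
        exact B.norm_euler_le hL hM (hpos N) hN hexp g₀ (hidxle N b hb)
      obtain ⟨g, -, hg⟩ := (isCompact_norm_le hG (R b)).ultrafilter_le_nhds
        (𝒰.map fun N => p N (idx N b)) (le_principal_iff.2 hev)
      exact ⟨g, fun _ => hg⟩
    · exact ⟨1, fun hb' => absurd hb' hb⟩
  choose H hH using hlimex
  have hHmat : ∀ b, 0 ≤ b → Tendsto (fun N => mat (p N (idx N b))) 𝒰 (𝓝 (mat (H b))) :=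
    fun b hb => (continuous_mat.tendsto _).comp (hH b hb)
  have hstep : ∀ N T, h N < r → ∀ k : ℕ, (k : ℝ) * h N ≤ T →
      ‖mat (p N (k + 1)) - mat (p N k)‖ ≤ h N * (L * R T) := fun N T hN k hk => by
    have h1 := (B.norm_euler_le hL hM (hpos N) hN hexp g₀ hk).1
    have h2 := hexp (h N) (by rwa [abs_of_pos (hpos N)]) (Ψ (p N k)) (hM _)
    rw [abs_of_pos (hpos N)] at h2
    have h3 : mat (p N (k + 1)) - mat (p N k) =
        (NormedSpace.exp (B.S (h N • Ψ (p N k))) - 1) * mat (p N k) := by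
      rw [sub_mul, one_mul]
      exact congrArg (· - mat (p N k)) (B.mat_euler_succ g₀ (h N) k)
    rw [h3]
    refine (norm_mul_le _ _).trans ((mul_le_mul h2 h1 (norm_nonneg _)
      (mul_nonneg hL.le (hpos N).le)).trans (le_of_eq ?_))
    ring
  have hidxk : ∀ N b (k : ℕ), 0 ≤ b → k ≤ idx N b → (k : ℝ) * h N ≤ b := fun N b k hb hk =>
    (mul_le_mul_of_nonneg_right (Nat.cast_le.2 hk) (hpos N).le).trans (hidxle N b hb)
  have hincr : ∀ N T, h N < r → 0 ≤ T → ∀ i j : ℕ, i ≤ j → j ≤ idx N T →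
      ‖mat (p N j) - mat (p N i)‖ ≤ (j * h N - i * h N) * (L * R T) :=
    fun N T hN hT i j hij hj => by
    have h1 := norm_sub_sub_smul_le_of_step (u := fun k => mat (p N k)) (w := 0)
      (c := h N * (L * R T)) hij fun k _ hk => by
        rw [sub_zero]
        exact hstep N T hN k (hidxk N T k hT (hk.le.trans hj))
    rw [smul_zero, sub_zero] at h1
    refine h1.trans (le_of_eq ?_)
    ring
  have hlip : ∀ a b, 0 ≤ a → a ≤ b → ‖mat (H b) - mat (H a)‖ ≤ (b - a) * (L * R b) :=
    fun a b ha hab => by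
    have hb := ha.trans hab
    refine le_of_tendsto_of_tendsto (((hHmat b hb).sub (hHmat a ha)).norm)
      ((((hidxlim b hb).sub (hidxlim a ha)).mul_const (L * R b)).mono_left h𝒰le) ?_
    filter_upwards [hsmall] with N hN
    exact hincr N b hN hb _ _ (hidxmono N a b hab) le_rfl
  refine ⟨H, ?_, ?_, fun t ht htU => ?_⟩
  · refine tendsto_nhds_unique (hH 0 le_rfl) ?_
    simp only [hidx, hp, zero_mul, Nat.floor_zero, LieBasis.euler]
    exact tendsto_const_nhds
  · rw [isEmbedding_mat.continuousOn_iff]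
    intro t ht
    have hC0 : 0 ≤ L * R (t + 1) := by
      have := hR0 (t + 1)
      positivity
    have hRmono : ∀ a b, a ≤ b → R a ≤ R b := fun a b hab => by
      refine mul_le_mul_of_nonneg_left (Real.exp_le_exp.2 ?_) (by positivity)
      exact mul_le_mul_of_nonneg_left hab hL.le
    have hb : ∀ᶠ s in 𝓝[Ici 0] t, ‖mat (H s) - mat (H t)‖ ≤ |s - t| * (L * R (t + 1)) := by
      have h1 : ∀ᶠ s in 𝓝[Ici 0] t, s < t + 1 :=
        mem_nhdsWithin_of_mem_nhds (gt_mem_nhds (lt_add_one t))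
      filter_upwards [h1, self_mem_nhdsWithin] with s hs1 hs0
      rcases le_total t s with hts | hst
      · rw [abs_of_nonneg (sub_nonneg.2 hts)]
        refine (hlip t s ht hts).trans (mul_le_mul_of_nonneg_left ?_ (sub_nonneg.2 hts))
        exact mul_le_mul_of_nonneg_left (hRmono _ _ hs1.le) hL.le
      · rw [norm_sub_rev, abs_sub_comm, abs_of_nonneg (sub_nonneg.2 hst)]
        refine (hlip s t hs0 hst).trans (mul_le_mul_of_nonneg_left ?_ (sub_nonneg.2 hst))
        exact mul_le_mul_of_nonneg_left (hRmono _ _ (by linarith)) hL.le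
    refine tendsto_iff_norm_sub_tendsto_zero.2 (squeeze_zero' (Eventually.of_forall fun _ =>
      norm_nonneg _) hb ?_)
    have : Continuous fun s : ℝ => |s - t| * (L * R (t + 1)) := by fun_prop
    have := this.tendsto t
    simp only [sub_self, abs_zero, zero_mul] at this
    exact this.mono_left nhdsWithin_le_nhds
  · set v := B.S (Ψ (H t)) * mat (H t) with hv
    set C := L * R (t + 1) with hC
    have hC0 : 0 ≤ C := mul_nonneg hL.le (hR0 _)
    have hRmono : R t ≤ R (t + 1) := by
      refine mul_le_mul_of_nonneg_left (Real.exp_le_exp.2 ?_) (by positivity)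
      exact mul_le_mul_of_nonneg_left (by linarith) hL.le
    -- The increment across `t` equals `(b - a) • v` up to a small multiple of `b - a`. In the
    -- factor `R (t + 1) + 1`, the first term comes from the exponential remainder times the bound
    -- on the polygon, the second from the variation of the field.
    have hclaim : ∀ η > 0, ∃ δ > 0, ∀ a b, 0 ≤ a → a ≤ b → t - δ < a → b < t + δ → a ≤ t → t ≤ b →
        ‖mat (H b) - mat (H a) - (b - a) • v‖ ≤ (b - a) * (η * (R (t + 1) + 1)) := by
      intro η hη
      have hcv : ContinuousAt (fun g : G => B.S (Ψ g) * mat g) (H t) :=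
        (B.continuous_S.continuousAt.comp (hΨ.continuousAt (hU.mem_nhds htU))).mul
          continuous_mat.continuousAt
      have hnear := Metric.tendsto_nhds.1 hcv η hη
      rw [isEmbedding_mat.nhds_eq_comap, eventually_comap] at hnear
      obtain ⟨ρ, hρ, hball⟩ := Metric.eventually_nhds_iff.1 hnear
      -- Between the indices of `a` and `b` a polygon drifts by at most `2 * δ * C`, which must stay
      -- below `ρ / 2`.
      have hδex : ∃ δ > 0, δ ≤ 1 ∧ 4 * δ * C < ρ := by
        refine ⟨min 1 (ρ / (8 * (C + 1))), by positivity, min_le_left _ _, ?_⟩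
        have h1 : min 1 (ρ / (8 * (C + 1))) ≤ ρ / (8 * (C + 1)) := min_le_right _ _
        have h2 : 4 * min 1 (ρ / (8 * (C + 1))) * C ≤ 4 * (ρ / (8 * (C + 1))) * C := by gcongr
        refine lt_of_le_of_lt h2 ?_
        rw [mul_div_assoc', div_mul_eq_mul_div, div_lt_iff₀ (by positivity)]
        nlinarith
      obtain ⟨δ, hδ, hδ1, hδρ⟩ := hδex
      refine ⟨δ, hδ, fun a b ha hab hta hbt hat htb => ?_⟩
      obtain ⟨r₂, hr₂, hexp₂⟩ := B.exists_exp_step hM0 hη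
      have hb := ha.trans hab
      have e1 : ∀ᶠ N in (𝒰 : Filter ℕ), h N < r₂ := h𝒰le (hlim0.eventually (gt_mem_nhds hr₂))
      have e2 : ∀ᶠ N in (𝒰 : Filter ℕ), ‖mat (p N (idx N t)) - mat (H t)‖ < ρ / 2 := by
        have := Metric.tendsto_nhds.1 (hHmat t ht) (ρ / 2) (by positivity)
        simpa [dist_eq_norm] using this
      have e3 : ∀ᶠ N in (𝒰 : Filter ℕ), (idx N b : ℝ) * h N - idx N a * h N < 2 * δ := by
        have := (hidxlim b hb).sub (hidxlim a ha)
        exact h𝒰le (this.eventually (gt_mem_nhds (by linarith)))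
      refine le_of_tendsto_of_tendsto
        ((((hHmat b hb).sub (hHmat a ha)).sub
          ((((hidxlim b hb).sub (hidxlim a ha)).mono_left h𝒰le).smul_const v)).norm)
        ((((hidxlim b hb).sub (hidxlim a ha)).mul_const _).mono_left h𝒰le) ?_
      filter_upwards [hsmall, e1, e2, e3] with N hN hN1 hN2 hN3
      have hb1 : idx N b ≤ idx N (t + 1) := hidxmono N _ _ (by linarith)
      have hnearN : ∀ k, idx N a ≤ k → k ≤ idx N b → ‖mat (p N k) - mat (H t)‖ < ρ := by
        intro k hka hkb
        have h1 : ‖mat (p N k) - mat (p N (idx N t))‖ ≤ 2 * δ * C := by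
          have hmono1 := mul_le_mul_of_nonneg_right (Nat.cast_le (α := ℝ).2 hka) (hpos N).le
          have hmono2 := mul_le_mul_of_nonneg_right (Nat.cast_le (α := ℝ).2 hkb) (hpos N).le
          have hmono3 := mul_le_mul_of_nonneg_right
            (Nat.cast_le (α := ℝ).2 (hidxmono N a t hat)) (hpos N).le
          have hmono4 := mul_le_mul_of_nonneg_right
            (Nat.cast_le (α := ℝ).2 (hidxmono N t b htb)) (hpos N).le
          rcases le_total (idx N t) k with hk | hk
          · refine (hincr N (t + 1) hN (by linarith) _ _ hk (hkb.trans hb1)).trans ?_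
            exact mul_le_mul_of_nonneg_right (by linarith) hC0
          · rw [norm_sub_rev]
            refine (hincr N (t + 1) hN (by linarith) _ _ hk
              (hidxmono N _ _ (by linarith))).trans ?_
            exact mul_le_mul_of_nonneg_right (by linarith) hC0
        have h2 : mat (p N k) - mat (H t) =
          (mat (p N k) - mat (p N (idx N t))) + (mat (p N (idx N t)) - mat (H t)) := by abel
        rw [h2]
        refine lt_of_le_of_lt (norm_add_le _ _) ?_
        linarith
      have hs := norm_sub_sub_smul_le_of_step (u := fun k => mat (p N k)) (w := h N • v)
        (c := h N * (η * (R (t + 1) + 1))) (hidxmono N a b hab) fun k hka hkb => by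
          have h1 := (B.norm_euler_le hL hM (hpos N) hN hexp g₀
            (hidxk N (t + 1) k (by linarith) (hkb.le.trans hb1))).1
          have h2 := hexp₂ (h N) (by rwa [abs_of_pos (hpos N)]) (Ψ (p N k)) (hM _)
          rw [abs_of_pos (hpos N)] at h2
          have h3 := hball (y := mat (p N k)) (by
            rw [dist_eq_norm]; exact hnearN k hka hkb.le) (p N k) rfl
          rw [dist_eq_norm] at h3
          have h4 : mat (p N (k + 1)) - mat (p N k) - h N • v =
              (NormedSpace.exp (B.S (h N • Ψ (p N k))) - 1 - h N • B.S (Ψ (p N k))) *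
                mat (p N k) + h N • (B.S (Ψ (p N k)) * mat (p N k) - v) := by
            have h5 : mat (p N (k + 1)) =
              NormedSpace.exp (B.S (h N • Ψ (p N k))) * mat (p N k) := B.mat_euler_succ g₀ (h N) k
            rw [h5, smul_sub, sub_mul, sub_mul, one_mul, smul_mul_assoc]
            abel
          rw [h4]
          refine (norm_add_le _ _).trans ?_
          rw [norm_smul, Real.norm_eq_abs, abs_of_pos (hpos N)]
          have h6 := (norm_mul_le _ _).trans (mul_le_mul h2 h1 (norm_nonneg (mat (p N k)))
            (mul_nonneg hη.le (hpos N).le))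
          have h7 := mul_le_mul_of_nonneg_left h3.le (hpos N).le
          refine (add_le_add h6 h7).trans (le_of_eq ?_)
          ring
      rw [smul_smul] at hs
      refine (le_of_eq ?_).trans (hs.trans (le_of_eq ?_))
      · rw [sub_mul]
      · ring
    refine hasDerivWithinAt_iff_isLittleO.2 (Asymptotics.isLittleO_iff.2 fun c hc => ?_)
    have hη : 0 < c / (R (t + 1) + 1) := div_pos hc (by linarith [hR0 (t + 1)])
    obtain ⟨δ, hδ, hδc⟩ := hclaim _ hη
    have hcR : c / (R (t + 1) + 1) * (R (t + 1) + 1) = c :=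
      div_mul_cancel₀ _ (by linarith [hR0 (t + 1)])
    have h1 : ∀ᶠ s in 𝓝[Ici 0] t, s ∈ Ioo (t - δ) (t + δ) :=
      mem_nhdsWithin_of_mem_nhds (Ioo_mem_nhds (by linarith) (by linarith))
    filter_upwards [h1, self_mem_nhdsWithin] with s hs hs0
    rcases le_total t s with hts | hst
    · have h2 := hδc t s ht hts (by linarith) hs.2 le_rfl hts
      rw [Real.norm_eq_abs, abs_of_nonneg (sub_nonneg.2 hts)]
      refine h2.trans (le_of_eq ?_)
      rw [hcR]; ring
    · have h2 := hδc s t hs0 hst hs.1 (by linarith) hst le_rfl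
      rw [Real.norm_eq_abs, abs_sub_comm, abs_of_nonneg (sub_nonneg.2 hst)]
      have h3 : mat (H s) - mat (H t) - (s - t) • v =
        -(mat (H t) - mat (H s) - (t - s) • v) := by module
      rw [h3, norm_neg]
      refine h2.trans (le_of_eq ?_)
      rw [hcR]; ring

end LieBasis

/-! ### Solutions on the curve, end points and gluing. -/

theorem timeDom_top : timeDom ⊤ = Ici 0 := by
  ext t
  simp [timeDom]

theorem timeDom_coe (T : ℝ) : timeDom (T : EReal) = Ico 0 T := by
  ext t
  simp [timeDom]

theorem mem_timeDom_of_le {T : EReal} {s t : ℝ} (ht : t ∈ timeDom T) (hs : 0 ≤ s) (hst : s ≤ t) :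
    s ∈ timeDom T :=
  ⟨hs, lt_of_le_of_lt (EReal.coe_le_coe_iff.2 hst) ht.2⟩

theorem convex_timeDom (T : EReal) : Convex ℝ (timeDom T) := by
  refine (ordConnected_iff.2 fun a ha b hb _ => ?_).convex
  exact fun c hc => mem_timeDom_of_le hb (ha.1.trans hc.1) hc.2

theorem timeDom_mem_nhdsGE {T : EReal} {t : ℝ} (ht : t ∈ timeDom T) : timeDom T ∈ 𝓝[≥] t := by
  have h1 : ∀ᶠ s : ℝ in 𝓝 t, (s : EReal) < T :=
    continuous_coe_real_ereal.continuousAt.eventually (gt_mem_nhds ht.2)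
  filter_upwards [mem_nhdsWithin_of_mem_nhds h1, self_mem_nhdsWithin] with s hs hst
  exact ⟨ht.1.trans hst, hs⟩

theorem continuousOn_of_hasDerivWithinAt {H : ℝ → G} {H' : ℝ → Matrix (Fin n) (Fin n) ℝ}
    {s : Set ℝ} (h : ∀ t ∈ s, HasDerivWithinAt (fun r => mat (H r)) (H' t) s t) :
    ContinuousOn H s :=
  isEmbedding_mat.continuousOn_iff.2 fun t ht => (h t ht).continuousWithinAt

/-- `F` is the time needed to reach the parameter `s`, and `θ` is its inverse. The lower bound on
`φ` makes `F` onto, so `θ` exists for all times. -/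
theorem exists_time_change {φ : ℝ → ℝ} (hφ : Continuous φ) {c : ℝ} (hc : 0 < c)
    (hle : ∀ s, c ≤ φ s) (s₀ : ℝ) :
    ∃ θ : ℝ → ℝ, θ 0 = s₀ ∧ ∀ t, HasDerivAt θ (φ (θ t))⁻¹ t := by
  set F : ℝ → ℝ := fun s => ∫ x in s₀..s, φ x with hF
  have hd : ∀ s, HasDerivAt F (φ s) s := fun s =>
    intervalIntegral.integral_hasDerivAt_right (hφ.intervalIntegrable _ _)
      (hφ.stronglyMeasurableAtFilter _ _) hφ.continuousAt
  have hcont : Continuous F := continuous_iff_continuousAt.2 fun s => (hd s).continuousAt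
  have hmono : StrictMono F := strictMono_of_deriv_pos fun s => by
    rw [(hd s).deriv]
    exact hc.trans_le (hle s)
  have hF0 : F s₀ = 0 := by simp [hF]
  have hmono' : Monotone fun s => F s - c * s := by
    have hd' : ∀ s, HasDerivAt (fun s => F s - c * s) (φ s - c) s := fun s => by
      have := (hd s).sub ((hasDerivAt_id s).const_mul c)
      rw [mul_one] at this
      exact this
    refine monotone_of_deriv_nonneg (fun s => (hd' s).differentiableAt) fun s => ?_
    rw [(hd' s).deriv]
    linarith [hle s]
  have htop : Tendsto F atTop atTop := by
    refine tendsto_atTop_mono' atTop (f₁ := fun s => c * s + (- (c * s₀))) ?_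
      (tendsto_atTop_add_const_right _ _ (tendsto_id.const_mul_atTop hc))
    filter_upwards [eventually_ge_atTop s₀] with s hs
    have := hmono' hs
    simp only [hF0] at this
    linarith
  have hbot : Tendsto F atBot atBot := by
    refine tendsto_atBot_mono' atBot (f₁ := fun s => c * s + (- (c * s₀))) ?_
      (tendsto_atBot_add_const_right _ _ (tendsto_id.const_mul_atBot hc))
    filter_upwards [eventually_le_atBot s₀] with s hs
    have := hmono' hs
    simp only [hF0] at this
    linarith
  let e : ℝ ≃o ℝ := hmono.orderIsoOfSurjective F (hcont.surjective htop hbot)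
  have he : ∀ t, F (e.symm t) = t := fun t => e.apply_symm_apply t
  refine ⟨e.symm, ?_, fun t => ?_⟩
  · apply hmono.injective
    rw [he, hF0]
  · exact HasDerivAt.of_local_left_inverse e.symm.continuous.continuousAt (hd _)
      (hc.trans_le (hle _)).ne' (Eventually.of_forall he)

namespace IsGuidance

variable {B : LieBasis G m} {D : G → G → ℝ} {Φ : ℝ → G → G → G} {Hd : ℝ → G} {kN kT : G → ℝ}
  {H : ℝ → G} {T : EReal}

/-- The curve is not shown to avoid the closure of the singular set, so Peano's theorem on an open
set is not available here. Reparametrizing `Hd` with speed `kT` gives a solution explicitly. -/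
theorem exists_solution_on_curve (h : IsGuidance B D Φ Hd kN kT) {g : G} (hg : g ∈ range Hd) :
    ∃ H : ℝ → G, H 0 = g ∧ ∀ t, H t ∈ range Hd ∧
      HasDerivAt (fun r => mat (H r)) (B.S (B.Psi D Hd kN kT (H t)) * mat (H t)) t := by
  obtain ⟨s₀, rfl⟩ := hg
  obtain ⟨d, hd0, hd⟩ := IsCompact.exists_nonneg_norm_le h.curve.isCompact_range
    h.gain.continuous_kT.continuousOn
  have hdpos : 0 < d + 1 := by positivity
  have hφ : Continuous fun s => (kT (Hd s))⁻¹ :=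
    (h.gain.continuous_kT.comp h.curve.continuous).inv₀ fun s => (h.gain.kT_pos _).ne'
  obtain ⟨θ, hθ0, hθ⟩ := exists_time_change hφ (inv_pos.2 hdpos) (fun s => by
    have h1 := hd (Hd s) (mem_range_self s)
    rw [Real.norm_eq_abs] at h1
    exact inv_anti₀ (h.gain.kT_pos _) (by linarith [le_abs_self (kT (Hd s))])) s₀
  refine ⟨fun t => Hd (θ t), congrArg Hd hθ0, fun t => ⟨mem_range_self _, ?_⟩⟩
  have h1 := (h.curve.hasDerivAt h.isClosed (θ t)).scomp t (hθ t)
  rw [inv_inv] at h1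
  rw [h.Psi_eq_of_mem_range (mem_range_self _), h.xiT_curve, B.S_smul, smul_mul_assoc]
  exact h1

theorem follows_of_isSolution
    (hs : B.IsSolution (B.Psi D Hd kN kT) (B.P D Hd) T H) {t : ℝ} (ht : t ∈ timeDom T) :
    B.FollowsAt (B.Psi D Hd kN kT) (B.P D Hd) H t :=
  ⟨(hs.2 t ht).1, (hs.2 t ht).2.mono_of_mem_nhdsWithin (timeDom_mem_nhdsGE ht)⟩

theorem continuousOn_of_isSolution
    (hs : B.IsSolution (B.Psi D Hd kN kT) (B.P D Hd) T H) : ContinuousOn H (timeDom T) :=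
  continuousOn_of_hasDerivWithinAt fun t ht => (hs.2 t ht).2

theorem curveDist_antitone (h : IsGuidance B D Φ Hd kN kT)
    (hs : B.IsSolution (B.Psi D Hd kN kT) (B.P D Hd) T H) {a b : ℝ} (ha : 0 ≤ a) (hab : a ≤ b)
    (hb : b ∈ timeDom T) : curveDist D Hd (H b) ≤ curveDist D Hd (H a) :=
  h.curveDist_le_of_follows hab
    ((continuousOn_of_isSolution hs).mono fun _ ht => mem_timeDom_of_le hb (ha.trans ht.1) ht.2)
    fun _ ht => follows_of_isSolution hs (mem_timeDom_of_le hb (ha.trans ht.1) ht.2.le)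

theorem exists_lipschitz (h : IsGuidance B D Φ Hd kN kT)
    (hs : B.IsSolution (B.Psi D Hd kN kT) (B.P D Hd) T H) :
    ∃ L, 0 < L ∧ ∀ s ∈ timeDom T, ∀ t ∈ timeDom T, ‖mat (H t) - mat (H s)‖ ≤ L * |t - s| := by
  set c := curveDist D Hd (H 0)
  have hle : ∀ t ∈ timeDom T, curveDist D Hd (H t) ≤ c := fun t ht =>
    h.curveDist_antitone hs le_rfl ht.1 ht
  obtain ⟨M, hM0, hM⟩ := h.exists_Psi_bound c
  obtain ⟨K, hK, hS⟩ := B.exists_norm_S_le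
  obtain ⟨R, hR0, hR⟩ := IsCompact.exists_nonneg_norm_le (h.isCompact_sublevel c)
    continuous_mat.continuousOn
  refine ⟨K * M * R + 1, by positivity, fun s hs' t ht => ?_⟩
  refine (convex_timeDom T).norm_image_sub_le_of_norm_hasDerivWithin_le
    (f := fun r => mat (H r)) (fun r hr => (hs.2 r hr).2) (fun r hr => ?_) hs' ht
  refine (norm_mul_le _ _).trans (le_trans ?_ (le_add_of_nonneg_right zero_le_one))
  refine mul_le_mul ((hS _).trans ?_) (hR _ (hle r hr)) (norm_nonneg _) (by positivity)
  exact mul_le_mul_of_nonneg_left (hM _ (hle r hr) (hs.2 r hr).1) hK.le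

/-- A cluster point exists in the compact sublevel set, and the Lipschitz bound makes it the limit.
-/
theorem exists_tendsto (h : IsGuidance B D Φ Hd kN kT) {T : ℝ}
    (hs : B.IsSolution (B.Psi D Hd kN kT) (B.P D Hd) T H) :
    ∃ g, Tendsto H (𝓝[<] T) (𝓝 g) ∧ curveDist D Hd g ≤ curveDist D Hd (H 0) := by
  have hT : 0 < T := by simpa using hs.1
  obtain ⟨L, hL, hlip⟩ := h.exists_lipschitz hs
  rw [timeDom_coe] at hlip
  have hmem : Ico 0 T ∈ 𝓝[<] T := Ico_mem_nhdsLT hT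
  have hle : ∀ᶠ t in 𝓝[<] T, H t ∈ {g | curveDist D Hd g ≤ curveDist D Hd (H 0)} := by
    filter_upwards [hmem] with t ht
    exact h.curveDist_antitone hs le_rfl ht.1 (by rwa [timeDom_coe])
  have hK := h.isCompact_sublevel (curveDist D Hd (H 0))
  obtain ⟨g, hg, hcl⟩ := hK.exists_clusterPt (f := map H (𝓝[<] T)) (le_principal_iff.2 hle)
  refine ⟨g, ?_, hg⟩
  refine isEmbedding_mat.tendsto_nhds_iff.2 (Metric.tendsto_nhds.2 fun ε hε => ?_)
  have hnear : ∀ᶠ t in 𝓝[<] T, T - t < ε / (2 * L) := by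
    have : Tendsto (fun t : ℝ => T - t) (𝓝[<] T) (𝓝 (T - T)) :=
      ((continuous_const.sub continuous_id).tendsto T).mono_left nhdsWithin_le_nhds
    rw [sub_self] at this
    exact this.eventually (gt_mem_nhds (by positivity))
  have hfreq : ∃ᶠ t in 𝓝[<] T, dist (mat (H t)) (mat g) < ε / 2 := by
    have h1 : ∃ᶠ g' in map H (𝓝[<] T), dist (mat g') (mat g) < ε / 2 :=
      hcl.frequently ((continuous_mat.tendsto g).eventually
        (Metric.ball_mem_nhds _ (by positivity)))
    exact frequently_map.1 h1
  obtain ⟨s, hs1, hs2, hs3⟩ := (hfreq.and_eventually (hnear.and hmem)).exists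
  filter_upwards [hnear, hmem, self_mem_nhdsWithin] with t ht1 ht2 ht3
  have h1 := hlip s hs3 t ht2
  have h2 : |t - s| < ε / (2 * L) := by
    rw [abs_lt]
    have h4 := hs3.2
    have h5 : t < T := ht3
    constructor <;> linarith
  have h3 : L * |t - s| < ε / 2 := by
    have := mul_lt_mul_of_pos_left h2 hL
    rwa [show L * (ε / (2 * L)) = ε / 2 by field_simp] at this
  rw [← dist_eq_norm] at h1
  have := dist_triangle (mat (H t)) (mat (H s)) (mat g)
  simp only [Function.comp]
  linarith

/-- Gluing a solution with one that starts at its end point. -/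
theorem isSolution_glue (h : IsGuidance B D Φ Hd kN kT) {T : ℝ} {T' : EReal}
    (hTT' : (T : EReal) < T') (hs : B.IsSolution (B.Psi D Hd kN kT) (B.P D Hd) T H) {K : ℝ → G}
    (hlim : Tendsto H (𝓝[<] T) (𝓝 (K 0)))
    (hK : ∀ t, 0 ≤ t → t + T ∈ timeDom T' → K t ∉ B.P D Hd ∧
      HasDerivWithinAt (fun r => mat (K r)) (B.S (B.Psi D Hd kN kT (K t)) * mat (K t)) (Ici 0) t) :
    B.IsSolution (B.Psi D Hd kN kT) (B.P D Hd) T' (fun t => if t < T then H t else K (t - T)) := by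
  have hT : 0 < T := by simpa using hs.1
  set N : ℝ → G := fun t => if t < T then H t else K (t - T) with hN
  have hlt : ∀ t, t < T → N t = H t := fun t ht => if_pos ht
  have hge : ∀ t, T ≤ t → N t = K (t - T) := fun t ht => if_neg (not_lt.2 ht)
  have hderlt : ∀ t, 0 ≤ t → t < T → HasDerivWithinAt (fun r => mat (N r))
      (B.S (B.Psi D Hd kN kT (N t)) * mat (N t)) (Ici 0) t := fun t h0 ht => by
    rw [hlt t ht]
    have h1 := (hs.2 t (by rw [timeDom_coe]; exact ⟨h0, ht⟩)).2
    have h2 : timeDom (T : EReal) ∈ 𝓝[Ici 0] t := by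
      rw [timeDom_coe]
      filter_upwards [mem_nhdsWithin_of_mem_nhds (gt_mem_nhds ht), self_mem_nhdsWithin] with s h1 h2
      exact ⟨h2, h1⟩
    refine (h1.mono_of_mem_nhdsWithin h2).congr_of_eventuallyEq ?_ (by rw [hlt t ht])
    filter_upwards [mem_nhdsWithin_of_mem_nhds (gt_mem_nhds ht)] with s hs
    rw [hlt s hs]
  have hderge : ∀ t, T ≤ t → t ∈ timeDom T' → HasDerivWithinAt (fun r => mat (N r))
      (B.S (B.Psi D Hd kN kT (N t)) * mat (N t)) (Ici T) t := fun t ht htT => by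
    rw [hge t ht]
    have h1 := (hK (t - T) (sub_nonneg.2 ht) (by rwa [sub_add_cancel])).2
    have h2 : HasDerivWithinAt (fun r => r - T) (1 : ℝ) (Ici T) t :=
      ((hasDerivAt_id t).sub_const T).hasDerivWithinAt
    have h3 := HasDerivWithinAt.scomp (g₁ := fun r => mat (K r)) t h1 h2
      (fun r hr => sub_nonneg.2 hr)
    rw [one_smul] at h3
    exact h3.congr (fun r hr => by rw [hge r hr]; rfl) (by rw [hge t ht]; rfl)
  refine ⟨lt_trans hs.1 hTT', fun t ht => ?_⟩
  rcases lt_trichotomy t T with hlt' | rfl | hgt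
  · refine ⟨?_, (hderlt t ht.1 hlt').mono fun s hs => hs.1⟩
    rw [hlt t hlt']
    exact (hs.2 t (by rw [timeDom_coe]; exact ⟨ht.1, hlt'⟩)).1
  · have hP : N t ∉ B.P D Hd := by
      rw [hge t le_rfl, sub_self]
      exact (hK 0 le_rfl (by simpa using ht)).1
    refine ⟨hP, ?_⟩
    have hright := hderge t le_rfl ht
    have hNt : N t = K 0 := by rw [hge t le_rfl, sub_self]
    have hmem : Ioo 0 t ∈ 𝓝[<] t := Ioo_mem_nhdsLT hT
    have hlimN : Tendsto N (𝓝[<] t) (𝓝 (N t)) := by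
      rw [hNt]
      refine hlim.congr' ?_
      filter_upwards [self_mem_nhdsWithin] with s hs
      exact (hlt s hs).symm
    have hderAt : ∀ s ∈ Ioo 0 t, HasDerivAt (fun r => mat (N r))
        (B.S (B.Psi D Hd kN kT (N s)) * mat (N s)) s := fun s hs' =>
      (hderlt s hs'.1.le hs'.2).hasDerivAt (Ici_mem_nhds hs'.1)
    -- At the junction the left derivative is the limit of the derivatives before it, which exists
    -- because the field is continuous off the singular set.
    have hleft : HasDerivWithinAt (fun r => mat (N r))
        (B.S (B.Psi D Hd kN kT (N t)) * mat (N t)) (Iic t) t := by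
      refine hasDerivWithinAt_Iic_of_tendsto_deriv (s := Ioo 0 t)
        (fun s hs' => (hderAt s hs').differentiableAt.differentiableWithinAt) ?_ hmem ?_
      · exact ((continuous_mat.tendsto _).comp hlimN).mono_left
          (nhdsWithin_mono _ fun s hs' => hs'.2)
      · have hPsi : Tendsto (fun s => B.Psi D Hd kN kT (N s)) (𝓝[<] t)
            (𝓝 (B.Psi D Hd kN kT (N t))) := by
          refine (h.continuousOn_Psi (N t) hP).tendsto.comp
            (tendsto_nhdsWithin_iff.2 ⟨hlimN, ?_⟩)
          filter_upwards [hmem] with s hs'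
          rw [mem_compl_iff, hlt s hs'.2]
          exact (hs.2 s (by rw [timeDom_coe]; exact ⟨hs'.1.le, hs'.2⟩)).1
        have h1 : Tendsto (fun s => B.S (B.Psi D Hd kN kT (N s)) * mat (N s)) (𝓝[<] t)
            (𝓝 (B.S (B.Psi D Hd kN kT (N t)) * mat (N t))) :=
          ((B.continuous_S.tendsto _).comp hPsi).mul ((continuous_mat.tendsto _).comp hlimN)
        refine h1.congr' ?_
        filter_upwards [hmem] with s hs'
        exact (hderAt s hs').deriv.symm
    have := hleft.union hright
    exact this.mono fun s _ => le_total s t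
  · refine ⟨?_, ((hderge t hgt.le ht).hasDerivAt (Ici_mem_nhds hgt)).hasDerivWithinAt⟩
    rw [hge t hgt.le]
    exact (hK (t - T) (sub_nonneg.2 hgt.le) (by rwa [sub_add_cancel])).1

/-- Peano's theorem needs a globally bounded field. The field is cut to zero outside an open set on
which it is continuous and bounded. -/
theorem exists_flow (h : IsGuidance B D Φ Hd kN kT) (g : G) (c : ℝ) :
    ∃ H : ℝ → G, H 0 = g ∧ ContinuousOn H (Ici 0) ∧ ∀ t, 0 ≤ t → H t ∉ closure (B.P D Hd) →
      curveDist D Hd (H t) < c → HasDerivWithinAt (fun r => mat (H r))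
        (B.S (B.Psi D Hd kN kT (H t)) * mat (H t)) (Ici 0) t := by
  classical
  obtain ⟨M, hM0, hM⟩ := h.exists_Psi_bound c
  set U : Set G := (closure (B.P D Hd))ᶜ ∩ {g | curveDist D Hd g < c} with hU
  have hopen : IsOpen U :=
    isClosed_closure.isOpen_compl.inter (isOpen_lt h.continuous_curveDist continuous_const)
  have heq : ∀ g ∈ U, U.indicator (B.Psi D Hd kN kT) g = B.Psi D Hd kN kT g :=
    fun g hg => indicator_of_mem hg _
  obtain ⟨H, h0, hc, hd⟩ := B.exists_solution h.isClosed (Ψ := U.indicator (B.Psi D Hd kN kT))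
    (M := M) (fun g => by
      by_cases hg : g ∈ U
      · rw [heq g hg]
        exact hM g (le_of_lt hg.2) fun h1 => hg.1 (subset_closure h1)
      · rw [indicator_of_notMem hg, norm_zero]
        exact hM0) hopen
    ((h.continuousOn_Psi.mono fun g hg h1 => hg.1 (subset_closure h1)).congr heq) g
  refine ⟨H, h0, hc, fun t ht hP hlt => ?_⟩
  have h1 := hd t ht ⟨hP, hlt⟩
  rwa [heq _ ⟨hP, hlt⟩] at h1

end IsGuidance

/-! ### Convergence and traversal. -/

theorem isClosed_setOf_le_norm_sub (S : Set G) (ε : ℝ) :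
    IsClosed {g : G | ∀ Y ∈ S, ε ≤ ‖mat g - mat Y‖} := by
  simp only [ofPred_forall]
  refine isClosed_iInter fun Y => isClosed_iInter fun _ => ?_
  exact isClosed_le continuous_const (continuous_mat.sub continuous_const).norm

theorem exists_far_of_not_convergesTo {T : EReal} {H : ℝ → G} {S : Set G}
    (h : ¬ ConvergesTo T H S) :
    ∃ ε, 0 < ε ∧ ∀ t₀ ∈ timeDom T, ∃ t ∈ timeDom T, t₀ ≤ t ∧ ∀ Y ∈ S, ε ≤ ‖mat (H t) - mat Y‖ := by
  unfold ConvergesTo at h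
  push Not at h
  obtain ⟨ε, hε, hfar⟩ := h
  refine ⟨ε, hε, fun t₀ ht₀ => ?_⟩
  obtain ⟨t, ht, hle, hY⟩ := hfar t₀ ht₀
  refine ⟨t, ht, hle, fun Y hYS => ?_⟩
  obtain ⟨i, j, hij⟩ := hY Y hYS
  exact hij.trans (abs_entry_le (mat (H t) - mat Y) i j)

theorem convergesTo_of_tendsto {T : ℝ} (hT : 0 < T) {H : ℝ → G} {S : Set G} {g : G}
    (hlim : Tendsto H (𝓝[<] T) (𝓝 g)) (hg : g ∈ closure S) : ConvergesTo (T : EReal) H S := by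
  intro ε hε
  have hball : {g' : G | ‖mat g' - mat g‖ < ε / 2} ∈ 𝓝 g := by
    have := (continuous_mat.tendsto g).eventually (Metric.ball_mem_nhds _ (half_pos hε))
    simp only [dist_eq_norm] at this
    exact this
  obtain ⟨Y, hY1, hY2⟩ := mem_closure_iff_nhds.1 hg _ hball
  have hev : ∀ᶠ t in 𝓝[<] T, ‖mat (H t) - mat g‖ < ε / 2 := hlim.eventually hball
  obtain ⟨l, hl, hsub⟩ := (mem_nhdsLT_iff_exists_Ioo_subset' hT).1 hev
  have hl' : max l 0 < T := max_lt hl hT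
  obtain ⟨t₀, ht₀, ht₀T⟩ := exists_between hl'
  refine ⟨t₀, by rw [timeDom_coe]; exact ⟨((le_max_right _ _).trans_lt ht₀).le, ht₀T⟩,
    fun t ht htt => ⟨Y, hY2, fun i j => ?_⟩⟩
  rw [timeDom_coe] at ht
  have h1 : ‖mat (H t) - mat g‖ < ε / 2 :=
    hsub ⟨((le_max_left _ _).trans_lt ht₀).trans_le htt, ht.2⟩
  have h2 : ‖mat Y - mat g‖ < ε / 2 := hY1
  refine lt_of_le_of_lt (abs_entry_le (mat (H t) - mat Y) i j) ?_
  have h3 : mat (H t) - mat Y = (mat (H t) - mat g) - (mat Y - mat g) := by abel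
  rw [h3]
  exact lt_of_le_of_lt (norm_sub_le _ _) (by linarith)

namespace IsGuidance

variable {B : LieBasis G m} {D : G → G → ℝ} {Φ : ℝ → G → G → G} {Hd : ℝ → G} {kN kT : G → ℝ}
  {H : ℝ → G} {T : EReal}

theorem not_isMaximal_of_extension (h : IsGuidance B D Φ Hd kN kT) {T : ℝ} {T' : EReal}
    (hTT' : (T : EReal) < T')
    (hmax : B.IsMaximalSolution (B.Psi D Hd kN kT) (B.P D Hd) T H) {K : ℝ → G}
    (hlim : Tendsto H (𝓝[<] T) (𝓝 (K 0)))
    (hK : ∀ t, 0 ≤ t → t + T ∈ timeDom T' → K t ∉ B.P D Hd ∧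
      HasDerivWithinAt (fun r => mat (K r)) (B.S (B.Psi D Hd kN kT (K t)) * mat (K t)) (Ici 0) t) :
    False := by
  refine hmax.2 T' _ hTT' (h.isSolution_glue hTT' hmax.1 hlim hK) fun t ht => ?_
  rw [timeDom_coe] at ht
  exact (if_pos ht.2).symm

/-- Away from the closure of the singular set a local Peano solution from the end point would extend
the maximal one. -/
theorem limit_mem_closure (h : IsGuidance B D Φ Hd kN kT) {T : ℝ}
    (hmax : B.IsMaximalSolution (B.Psi D Hd kN kT) (B.P D Hd) T H) {g : G}
    (hlim : Tendsto H (𝓝[<] T) (𝓝 g)) : g ∈ closure (B.P D Hd) := by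
  by_contra hg
  obtain ⟨K, rfl, hc, hd⟩ := h.exists_flow g (curveDist D Hd g + 1)
  have hev : ∀ᶠ t in 𝓝[≥] (0 : ℝ), K t ∉ closure (B.P D Hd) ∧
      curveDist D Hd (K t) < curveDist D Hd (K 0) + 1 := by
    have hev' : ∀ᶠ g in 𝓝 (K 0), g ∉ closure (B.P D Hd) ∧
        curveDist D Hd g < curveDist D Hd (K 0) + 1 :=
      (isClosed_closure.isOpen_compl.eventually_mem hg).and
        ((h.continuous_curveDist.tendsto _).eventually (gt_mem_nhds (lt_add_one _)))
    exact (hc 0 self_mem_Ici).eventually hev'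
  obtain ⟨δ, hδ, hsub⟩ := (mem_nhdsGE_iff_exists_Ico_subset' (zero_lt_one' ℝ)).1 hev
  have hδ' : (0 : ℝ) < δ := hδ
  refine h.not_isMaximal_of_extension (T' := ((T + δ : ℝ) : EReal))
    (EReal.coe_lt_coe_iff.2 (by linarith)) hmax hlim fun t ht htT => ?_
  rw [timeDom_coe] at htT
  obtain ⟨h1, h2⟩ := hsub (⟨ht, by linarith [htT.2]⟩ : t ∈ Ico 0 δ)
  exact ⟨fun h3 => h1 (subset_closure h3), hd t ht h1 h2⟩

theorem limit_notMem_range (h : IsGuidance B D Φ Hd kN kT) {T : ℝ}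
    (hmax : B.IsMaximalSolution (B.Psi D Hd kN kT) (B.P D Hd) T H) {g : G}
    (hlim : Tendsto H (𝓝[<] T) (𝓝 g)) : g ∉ range Hd := by
  intro hg
  obtain ⟨K, rfl, hK⟩ := h.exists_solution_on_curve hg
  exact h.not_isMaximal_of_extension (EReal.coe_lt_top T) hmax hlim fun t _ _ =>
    ⟨h.notMem_P_of_mem_range (hK t).1, (hK t).2.hasDerivWithinAt⟩

theorem rate_pos (h : IsGuidance B D Φ Hd kN kT) {g : G} (hP : g ∉ B.P D Hd) (hC : g ∉ range Hd) :
    0 < kN g * ‖B.xiN D Hd g‖ ^ 2 := by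
  have h1 := h.gain.kN_pos g hC
  have h2 : B.xiN D Hd g ≠ 0 := neg_ne_zero.2 (h.LV_ne_zero
    (fun heq => hC ⟨_, heq.symm⟩) (diff_of_notMem hP hC).1)
  have h3 := norm_pos_iff.2 h2
  positivity

/-- At arbitrarily late times the state is in a compact set away from the curve, where the distance
is bounded below. By monotonicity the bound holds at all earlier times. -/
theorem exists_curveDist_ge (h : IsGuidance B D Φ Hd kN kT)
    (hs : B.IsSolution (B.Psi D Hd kN kT) (B.P D Hd) T H)
    (hconv : ¬ ConvergesTo T H (range Hd)) :
    ∃ d, 0 < d ∧ ∀ t ∈ timeDom T, d ≤ curveDist D Hd (H t) := by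
  obtain ⟨ε, hε, hfar⟩ := exists_far_of_not_convergesTo hconv
  have hQ : IsCompact ({g | curveDist D Hd g ≤ curveDist D Hd (H 0)} ∩
      {g : G | ∀ Y ∈ range Hd, ε ≤ ‖mat g - mat Y‖}) :=
    (h.isCompact_sublevel _).inter_right (isClosed_setOf_le_norm_sub _ _)
  obtain ⟨d, hd, hle⟩ := IsCompact.exists_pos_le hQ h.continuous_curveDist.continuousOn
    fun g hg => h.curveDist_pos fun hgC => by
      have := hg.2 g hgC
      rw [sub_self, norm_zero] at this
      linarith
  refine ⟨d, hd, fun t ht => ?_⟩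
  obtain ⟨t', ht', htt', hY⟩ := hfar t ht
  exact (hle _ ⟨h.curveDist_antitone hs le_rfl ht'.1 ht', hY⟩).trans
    (h.curveDist_antitone hs ht.1 htt' ht')

/-- A solution for all times that stays away from the curve approaches the singular set. -/
theorem convergesTo_or_convergesTo (h : IsGuidance B D Φ Hd kN kT)
    (hs : B.IsSolution (B.Psi D Hd kN kT) (B.P D Hd) ⊤ H) :
    ConvergesTo ⊤ H (range Hd) ∨ ConvergesTo ⊤ H (B.P D Hd) := by
  by_contra! hcon
  obtain ⟨hcC, hcP⟩ := hcon
  obtain ⟨d, hd, hdle⟩ := h.exists_curveDist_ge hs hcC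
  obtain ⟨ε, hε, hfar⟩ := exists_far_of_not_convergesTo hcP
  obtain ⟨L, hL, hlip⟩ := h.exists_lipschitz hs
  rw [timeDom_top] at hdle hfar hlip
  have hant : ∀ a b, 0 ≤ a → a ≤ b → curveDist D Hd (H b) ≤ curveDist D Hd (H a) :=
    fun a b ha hab => h.curveDist_antitone hs ha hab (by rw [timeDom_top]; exact ha.trans hab)
  set Q : Set G := {g | curveDist D Hd g ≤ curveDist D Hd (H 0)} ∩
    ({g : G | ∀ Y ∈ B.P D Hd, ε / 2 ≤ ‖mat g - mat Y‖} ∩ {g | d ≤ curveDist D Hd g}) with hQdef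
  have hQ : IsCompact Q := (h.isCompact_sublevel _).inter_right
    ((isClosed_setOf_le_norm_sub _ _).inter (isClosed_le continuous_const h.continuous_curveDist))
  have hQP : ∀ g ∈ Q, g ∉ B.P D Hd := fun g hg hgP => by
    have := hg.2.1 g hgP
    rw [sub_self, norm_zero] at this
    linarith
  have hQC : ∀ g ∈ Q, g ∉ range Hd := fun g hg hgC => by
    have : d ≤ curveDist D Hd g := hg.2.2
    rw [h.curveDist_eq_zero.2 hgC] at this
    linarith
  obtain ⟨μ, hμ, hμle⟩ := IsCompact.exists_pos_le hQ
    (f := fun g => kN g * ‖B.xiN D Hd g‖ ^ 2)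
    (h.gain.continuous_kN.continuousOn.mul
      ((h.continuousOn_xiN.mono fun g hg => ⟨hQP g hg, hQC g hg⟩).norm.pow 2))
    fun g hg => h.rate_pos (hQP g hg) (hQC g hg)
  -- In a time `δ` the state moves by at most `ε / 2`, so from a point `ε`-far from the singular set
  -- it stays `ε / 2`-far, inside `Q`.
  set δ := ε / (2 * L) with hδdef
  have hδ : 0 < δ := by positivity
  have hdrop : ∀ t, 0 ≤ t → (∀ Y ∈ B.P D Hd, ε ≤ ‖mat (H t) - mat Y‖) →
      curveDist D Hd (H (t + δ)) ≤ curveDist D Hd (H t) - μ * δ := by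
    intro t ht hY
    have hinQ : ∀ r ∈ Ico t (t + δ), H r ∈ Q := fun r hr => by
      refine ⟨hant 0 r le_rfl (ht.trans hr.1), fun Y hYP => ?_, hdle r (ht.trans hr.1)⟩
      have h1 := hY Y hYP
      have h2 := hlip t ht r (ht.trans hr.1)
      rw [abs_of_nonneg (sub_nonneg.2 hr.1)] at h2
      have h3 : L * (r - t) ≤ ε / 2 := by
        have : L * (r - t) ≤ L * δ := mul_le_mul_of_nonneg_left (by linarith [hr.2]) hL.le
        rwa [hδdef, show L * (ε / (2 * L)) = ε / 2 by field_simp] at this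
      have h4 : mat (H t) - mat Y = (mat (H r) - mat Y) - (mat (H r) - mat (H t)) := by abel
      have h5 := norm_sub_le (mat (H r) - mat Y) (mat (H r) - mat (H t))
      rw [← h4] at h5
      linarith
    have := h.curveDist_le_sub (a := t) (b := t + δ) (by linarith)
      ((continuousOn_of_isSolution hs).mono fun r hr => by
        rw [timeDom_top]; exact ht.trans hr.1)
      (fun r hr => follows_of_isSolution hs (by rw [timeDom_top]; exact ht.trans hr.1))
      (fun r hr => hQC _ (hinQ r hr)) (μ := μ) fun r hr => hμle _ (hinQ r hr)
    simpa using this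
  -- Recurrent visits `ε`-far from the singular set each cost `μ * δ`, which exhausts the initial
  -- distance.
  have hiter : ∀ k : ℕ, ∃ t, 0 ≤ t ∧ curveDist D Hd (H t) ≤ curveDist D Hd (H 0) - k * (μ * δ) := by
    intro k
    induction k with
    | zero => exact ⟨0, le_rfl, by simp⟩
    | succ k ih =>
      obtain ⟨t, ht, hle⟩ := ih
      obtain ⟨t', ht', htt', hY⟩ := hfar t ht
      refine ⟨t' + δ, by linarith [mem_Ici.1 ht'], ?_⟩
      have h1 := hdrop t' ht' hY
      have h2 := hant t t' ht htt'
      push_cast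
      linarith
  obtain ⟨k, hk⟩ := exists_nat_gt (curveDist D Hd (H 0) / (μ * δ))
  obtain ⟨t, -, ht⟩ := hiter k
  have h1 := h.curveDist_nonneg (H t)
  rw [div_lt_iff₀ (by positivity)] at hk
  linarith

theorem convergence (h : IsGuidance B D Φ Hd kN kT)
    (hmax : B.IsMaximalSolution (B.Psi D Hd kN kT) (B.P D Hd) T H) :
    (T = ⊤ ∧ ConvergesTo T H (range Hd)) ∨ ConvergesTo T H (B.P D Hd) := by
  induction T with
  | bot => exact absurd hmax.1.1 not_lt_bot
  | top =>
    rcases h.convergesTo_or_convergesTo hmax.1 with h1 | h1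
    · exact Or.inl ⟨rfl, h1⟩
    · exact Or.inr h1
  | coe T =>
    obtain ⟨g, hg, -⟩ := h.exists_tendsto hmax.1
    exact Or.inr (convergesTo_of_tendsto (by simpa using hmax.1.1) hg (h.limit_mem_closure hmax hg))

theorem exists_tangent_bound (h : IsGuidance B D Φ Hd kN kT)
    (hs : B.IsSolution (B.Psi D Hd kN kT) (B.P D Hd) T H) :
    ∃ c, 0 < c ∧ ∀ t ∈ timeDom T, c ≤ ‖kT (H t) • B.xiT D Hd (H t)‖ := by
  obtain ⟨a, _, ha, -, hle⟩ := h.exists_curveTwist_bounds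
  obtain ⟨b, hb, hble⟩ := IsCompact.exists_pos_le (h.isCompact_sublevel (curveDist D Hd (H 0)))
    h.gain.continuous_kT.continuousOn fun g _ => h.gain.kT_pos g
  refine ⟨b * a, by positivity, fun t ht => ?_⟩
  rw [norm_smul, Real.norm_eq_abs, abs_of_pos (h.gain.kT_pos _)]
  exact mul_le_mul (hble _ (h.curveDist_antitone hs le_rfl ht.1 ht)) (hle _).1 ha.le
    (h.gain.kT_pos _).le

theorem mem_range_of_isSolution (h : IsGuidance B D Φ Hd kN kT)
    (hs : B.IsSolution (B.Psi D Hd kN kT) (B.P D Hd) T H) {t₀ t : ℝ} (ht₀ : 0 ≤ t₀) (htt : t₀ ≤ t)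
    (ht : t ∈ timeDom T) (hC : H t₀ ∈ range Hd) : H t ∈ range Hd :=
  h.mem_range_of_follows htt
    ((continuousOn_of_isSolution hs).mono fun _ hr => mem_timeDom_of_le ht (ht₀.trans hr.1) hr.2)
    (fun _ hr => follows_of_isSolution hs (mem_timeDom_of_le ht (ht₀.trans hr.1) hr.2.le)) hC

/-- After `t₀` the state stays on the curve, which is closed. A finite end point would lie on it,
and the solution there would extend the given one. -/
theorem eq_top_of_mem_range (h : IsGuidance B D Φ Hd kN kT)
    (hmax : B.IsMaximalSolution (B.Psi D Hd kN kT) (B.P D Hd) T H) {t₀ : ℝ} (ht₀ : t₀ ∈ timeDom T)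
    (hC : H t₀ ∈ range Hd) : T = ⊤ := by
  induction T with
  | bot => exact absurd hmax.1.1 not_lt_bot
  | top => rfl
  | coe T =>
    exfalso
    obtain ⟨g, hg, -⟩ := h.exists_tendsto hmax.1
    refine h.limit_notMem_range hmax hg
      (h.curve.isCompact_range.isClosed.mem_of_tendsto hg ?_)
    have ht₀' := ht₀
    rw [timeDom_coe] at ht₀'
    filter_upwards [Ico_mem_nhdsLT ht₀'.2] with t ht
    exact h.mem_range_of_isSolution hmax.1 ht₀.1 ht.1
      (by rw [timeDom_coe]; exact ⟨ht₀.1.trans ht.1, ht.2⟩) hC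

theorem traversal (h : IsGuidance B D Φ Hd kN kT)
    (hmax : B.IsMaximalSolution (B.Psi D Hd kN kT) (B.P D Hd) T H) {t₀ : ℝ} (ht₀ : t₀ ∈ timeDom T)
    (hC : H t₀ ∈ range Hd) :
    T = ⊤ ∧ ∀ t : ℝ, t₀ ≤ t → H t ∈ range Hd ∧
      B.Psi D Hd kN kT (H t) = kT (H t) • B.xiT D Hd (H t) ∧ B.Psi D Hd kN kT (H t) ≠ 0 := by
  obtain rfl := h.eq_top_of_mem_range hmax ht₀ hC
  refine ⟨rfl, fun t ht => ?_⟩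
  have h1 := h.mem_range_of_isSolution hmax.1 ht₀.1 ht
    (by rw [timeDom_top]; exact ht₀.1.trans ht) hC
  refine ⟨h1, h.Psi_eq_of_mem_range h1, ?_⟩
  rw [h.Psi_eq_of_mem_range h1]
  exact smul_ne_zero (h.gain.kT_pos _).ne' (h.curve.proper _)

end IsGuidance

/-! ### Escape from the singular set. -/

theorem LieBasis.exists_compact_subset_expS (B : LieBasis G m)
    (hG : IsClosed (G : Set (GL (Fin n) ℝ))) {ε τ : ℝ} (hε : 0 < ε) (hτ : 0 < τ) :
    ∃ A : Set G, IsCompact A ∧ A ∈ 𝓝 1 ∧ ∀ g ∈ A, ∃ ζ, ‖ζ‖ ≤ ε ∧ B.expS (τ • ζ) = g := by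
  have := locallyCompactSpace hG
  obtain ⟨ψ, ψ', hψ, -, hψ0, hF⟩ := B.exists_local_inverse hG B.expS_zero B.hasStrictFDerivAt_expS
  have hlim : Tendsto (fun g : G => ‖ψ (mat g)‖) (𝓝 1) (𝓝 0) := by
    have h1 : Tendsto (mat : G → Matrix (Fin n) (Fin n) ℝ) (𝓝 1) (𝓝 1) := by
      have := continuous_mat.tendsto (1 : G)
      rwa [mat_one] at this
    have h2 := (hψ.continuousAt.tendsto.comp h1).norm
    rwa [hψ0, norm_zero] at h2
  have hN : {g : G | ∃ ζ, ‖ζ‖ ≤ ε ∧ B.expS (τ • ζ) = g} ∈ 𝓝 1 := by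
    filter_upwards [hF, hlim.eventually (gt_mem_nhds (mul_pos hτ hε))] with g h1 h2
    refine ⟨τ⁻¹ • ψ (mat g), ?_, ?_⟩
    · rw [norm_smul, norm_inv, Real.norm_eq_abs, abs_of_pos hτ, inv_mul_le_iff₀ hτ]
      exact h2.le
    · rw [smul_smul, mul_inv_cancel₀ hτ.ne', one_smul, h1]
  obtain ⟨A, hA, hsub, hcomp⟩ := local_compact_nhds hN
  exact ⟨A, hcomp, hA, fun g hg => hsub hg⟩

/-- Putting a finished part of a policy trajectory in front of another one. -/
theorem LieBasis.IsPolicyTrajectory.concat {B : LieBasis G m} {Psi : G → EuclideanSpace ℝ (Fin m)}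
    {C P : Set G} {π : G → EuclideanSpace ℝ (Fin m)} {τ : ℝ} {A A₀ : Set ℝ} {H K : ℝ → G} {T : ℝ}
    (h : B.IsPolicyTrajectory Psi C P π τ A H) (hτ : 0 < τ) (hT : 0 ≤ T)
    (hK : ContinuousOn K (Icc 0 T)) (hKT : K T = H 0) (hA₀ : ∀ a ∈ A₀, 0 ≤ a ∧ a + τ ≤ T)
    (hsep : ∀ a ∈ A₀, ∀ b ∈ A₀, a < b → a + τ ≤ b)
    (hstart : ∀ a ∈ A₀, K a ∈ closure P \ C)
    (hman : ∀ a ∈ A₀, ∀ t ∈ Icc a (a + τ), K t = B.expS ((t - a) • π (K a)) * K a)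
    (hflow : ∀ t ∈ Ico 0 T, (∀ a ∈ A₀, t ∉ Ico a (a + τ)) → B.FollowsAt Psi P K t) :
    B.IsPolicyTrajectory Psi C P π τ (A₀ ∪ (fun a => a + T) '' A)
      (fun t => if t ≤ T then K t else H (t - T)) := by
  set N : ℝ → G := fun t => if t ≤ T then K t else H (t - T) with hN
  have hle : ∀ t, t ≤ T → N t = K t := fun t ht => if_pos ht
  have hge : ∀ t, T ≤ t → N t = H (t - T) := fun t ht => by
    rcases ht.eq_or_lt with rfl | hlt
    · rw [hle _ le_rfl, hKT, sub_self]
    · exact if_neg (not_le.2 hlt)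
  refine ⟨?_, ?_, ?_, ?_, ?_, ?_⟩
  · have h1 : ContinuousOn N (Icc 0 T) := hK.congr fun t ht => hle t ht.2
    have h2 : ContinuousOn N (Ici T) := by
      have : ContinuousOn (fun t => H (t - T)) (Ici T) :=
        h.continuousOn.comp (by fun_prop) fun t ht => mem_Ici.2 (sub_nonneg.2 ht)
      exact this.congr fun t ht => hge t ht
    have h3 := h1.union_of_isClosed h2 isClosed_Icc isClosed_Ici
    rwa [Icc_union_Ici_eq_Ici hT] at h3
  · rintro _ (ha | ⟨a, ha, rfl⟩)
    · exact (hA₀ _ ha).1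
    · exact add_nonneg (h.start_nonneg a ha) hT
  · rintro _ (ha | ⟨a, ha, rfl⟩) _ (hb | ⟨b, hb, rfl⟩) hab
    · exact hsep _ ha _ hb hab
    · have := (hA₀ _ ha).2
      have := h.start_nonneg b hb
      linarith
    · have h1 := (hA₀ _ hb).2
      have h2 := h.start_nonneg a ha
      simp only at hab
      linarith
    · have := h.separated a ha b hb (by simpa using hab)
      simp only
      linarith
  · rintro _ (ha | ⟨a, ha, rfl⟩)
    · rw [hle _ (by linarith [(hA₀ _ ha).2])]
      exact hstart _ ha
    · rw [hge _ (by linarith [h.start_nonneg a ha]), add_sub_cancel_right]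
      exact h.start a ha
  · rintro _ (ha | ⟨a, ha, rfl⟩) t ht
    · rw [hle t (ht.2.trans (hA₀ _ ha).2), hle _ (by linarith [(hA₀ _ ha).2])]
      exact hman _ ha t ht
    · have h0 := h.start_nonneg a ha
      simp only at ht
      rw [hge t (by linarith [ht.1]), hge _ (by linarith), add_sub_cancel_right,
        h.manoeuvre a ha (t - T) ⟨by linarith [ht.1], by linarith [ht.2]⟩]
      congr 3
      ring
  · intro t ht hno
    rcases lt_or_ge t T with hlt | hTt
    · obtain ⟨h1, h2⟩ := hflow t ⟨ht, hlt⟩ fun a ha => hno a (Or.inl ha)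
      rw [hle t hlt.le]
      refine ⟨h1, h2.congr_of_eventuallyEq ?_ (by rw [hle t hlt.le])⟩
      filter_upwards [mem_nhdsWithin_of_mem_nhds (gt_mem_nhds hlt)] with s hs
      rw [hle s (le_of_lt hs)]
    -- Only right derivatives are required, so the junction `T` belongs to the second part and no
    -- matching condition arises.
    · obtain ⟨h1, h2⟩ := h.flow (t - T) (sub_nonneg.2 hTt) fun a ha hmem =>
        hno (a + T) (Or.inr ⟨a, ha, rfl⟩) ⟨by linarith [hmem.1], by linarith [hmem.2]⟩
      rw [hge t hTt]
      refine ⟨h1, ?_⟩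
      have h3 : HasDerivWithinAt (fun r => r - T) (1 : ℝ) (Ici t) t :=
        ((hasDerivAt_id t).sub_const T).hasDerivWithinAt
      have h4 := HasDerivWithinAt.scomp (g₁ := fun r => mat (H r)) t h2 h3
        (fun r hr => sub_le_sub_right (mem_Ici.1 hr) T)
      rw [one_smul] at h4
      exact h4.congr (fun r hr => by rw [hge r (hTt.trans hr)]; rfl) (by rw [hge t hTt]; rfl)

namespace IsGuidance

variable {B : LieBasis G m} {D : G → G → ℝ} {Φ : ℝ → G → G → G} {Hd : ℝ → G} {kN kT : G → ℝ}
  {H : ℝ → G} {A : Set ℝ} {π : G → EuclideanSpace ℝ (Fin m)} {τ : ℝ}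

/-- A policy of small twists each of which decreases the distance to the curve by a definite amount
or leads onto the curve. -/
theorem exists_policy (h : IsGuidance B D Φ Hd kN kT) {ε τ : ℝ} (hε : 0 < ε) (hτ : 0 < τ) :
    ∃ π : G → EuclideanSpace ℝ (Fin m), (∀ g, ‖π g‖ ≤ ε) ∧ ∀ c, ∃ δ, 0 < δ ∧
      ∀ g, g ∉ range Hd → curveDist D Hd g ≤ c → B.expS (τ • π g) * g ∈ range Hd ∨
        curveDist D Hd (B.expS (τ • π g) * g) ≤ curveDist D Hd g - δ := by
  obtain ⟨A, hA, hA1, hexp⟩ := B.exists_compact_subset_expS h.isClosed hε hτ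
  have hfrA : frontier A ⊆ A := frontier_subset_iff_isClosed.2 hA.isClosed
  have hex : ∀ g : G, ∃ ζ : EuclideanSpace ℝ (Fin m), ‖ζ‖ ≤ ε ∧ (B.expS (τ • ζ) * g ∈ range Hd ∨
      ∃ a ∈ frontier A, curveDist D Hd (B.expS (τ • ζ) * g) ≤ curveDist D Hd g - D g (a * g)) := by
    intro g
    obtain ⟨s, -, hs⟩ := h.exists_isNearest g
    -- Either the nearest curve point is reachable in one manoeuvre, or the chaining path towards it
    -- is cut where it leaves the translate of `A` by `g`; chainability converts the piece covered
    -- into a decrease.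
    by_cases hW : Hd s * g⁻¹ ∈ A
    · obtain ⟨ζ, hζ, he⟩ := hexp _ hW
      exact ⟨ζ, hζ, Or.inl ⟨s, by rw [he, inv_mul_cancel_right]⟩⟩
    · obtain ⟨σ, hσ, hfr⟩ := exists_mem_frontier_of_path (γ := fun σ => Φ σ g (Hd s) * g⁻¹)
        ((h.continuousOn_path g (Hd s)).mul continuousOn_const) hA.isClosed
        (by simpa [h.chain.path.zero] using mem_of_mem_nhds hA1)
        (by simpa [h.chain.path.one] using hW)
      obtain ⟨ζ, hζ, he⟩ := hexp _ (hfrA hfr)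
      refine ⟨ζ, hζ, Or.inr ⟨_, hfr, ?_⟩⟩
      rw [he, inv_mul_cancel_right]
      have h1 := h.curveDist_le (Φ σ g (Hd s)) s
      have h2 := h.chain.chain g (Hd s) σ hσ
      linarith
  choose π hπ hdec using hex
  refine ⟨π, hπ, fun c => ?_⟩
  have hcomp : IsCompact ({g | curveDist D Hd g ≤ c} ×ˢ frontier A) :=
    (h.isCompact_sublevel c).prod (hA.of_isClosed_subset isClosed_frontier hfrA)
  have hcont : Continuous fun p : G × G => D p.1 (p.2 * p.1) :=
    h.continuous_dist.comp (continuous_fst.prodMk (continuous_snd.mul continuous_fst))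
  -- The distance from `g` to `a * g` is positive since `1` is interior to `A`, hence `a ≠ 1` on the
  -- frontier; compactness makes this uniform.
  obtain ⟨δ, hδ, hle⟩ := IsCompact.exists_pos_le hcomp hcont.continuousOn fun p hp =>
    lt_of_le_of_ne (h.ee.nonneg _ _) fun h0 => by
      have h1 := (h.ee.eq_zero_iff _ _).1 h0.symm
      have h2 : p.2 = 1 := by simpa using h1.symm
      have h3 := hp.2
      rw [h2] at h3
      exact h3.2 (mem_interior_iff_mem_nhds.2 hA1)
  refine ⟨δ, hδ, fun g _ hgc => (hdec g).imp_right ?_⟩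
  rintro ⟨a, ha, hle'⟩
  have := hle (g, a) ⟨hgc, ha⟩
  simp only at this
  linarith

theorem follows_of_policy
    (ht : B.IsPolicyTrajectory (B.Psi D Hd kN kT) (range Hd) (B.P D Hd) π τ A H) {a b : ℝ}
    (ha : 0 ≤ a) (hno : ∀ t ∈ Ico a b, ∀ c ∈ A, t ∉ Ico c (c + τ)) :
    ContinuousOn H (Icc a b) ∧
      ∀ t ∈ Ico a b, B.FollowsAt (B.Psi D Hd kN kT) (B.P D Hd) H t :=
  ⟨ht.continuousOn.mono fun _ hr => ha.trans hr.1, fun t hr => ht.flow t (ha.trans hr.1) (hno t hr)⟩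

/-- Each earlier manoeuvre has cost `δ`. One that lands on the curve has no successor, since the
curve is invariant and manoeuvres start off it. Starting times are `τ` apart, so induction on
multiples of `τ` reaches all of them. -/
theorem curveDist_le_at_start (h : IsGuidance B D Φ Hd kN kT) (hτ : 0 < τ)
    (ht : B.IsPolicyTrajectory (B.Psi D Hd kN kT) (range Hd) (B.P D Hd) π τ A H) {δ : ℝ}
    (hδ : 0 < δ) (hdec : ∀ g, g ∉ range Hd → curveDist D Hd g ≤ curveDist D Hd (H 0) →
      B.expS (τ • π g) * g ∈ range Hd ∨
        curveDist D Hd (B.expS (τ • π g) * g) ≤ curveDist D Hd g - δ) (k : ℕ) :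
    ∀ a ∈ A, a ≤ k * τ → (A ∩ Iio a).Finite ∧
      curveDist D Hd (H a) ≤ curveDist D Hd (H 0) - δ * (A ∩ Iio a).ncard := by
  have hfirst : ∀ a ∈ A, A ∩ Iio a = ∅ → (A ∩ Iio a).Finite ∧
      curveDist D Hd (H a) ≤ curveDist D Hd (H 0) - δ * (A ∩ Iio a).ncard := by
    intro a ha he
    rw [he]
    refine ⟨finite_empty, ?_⟩
    have ha0 := ht.start_nonneg a ha
    obtain ⟨h1, h2⟩ := follows_of_policy ht (a := 0) (b := a) le_rfl fun t hta c hc hmem =>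
      (he ▸ (⟨hc, hmem.1.trans_lt hta.2⟩ : c ∈ A ∩ Iio a) : c ∈ (∅ : Set ℝ))
    simpa using h.curveDist_le_of_follows ha0 h1 h2
  induction k with
  | zero =>
    intro a ha hle
    refine hfirst a ha (eq_empty_of_forall_notMem fun b hb => ?_)
    have h1 := ht.start_nonneg b hb.1
    have h2 : b < a := hb.2
    simp at hle
    linarith
  | succ k ih =>
    intro a ha hle
    rcases (A ∩ Iio a).eq_empty_or_nonempty with he | hne
    · exact hfirst a ha he
    have hbdd : BddAbove (A ∩ Iio a) := ⟨a, fun b hb => le_of_lt hb.2⟩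
    -- By separation, an earlier start within `τ` of the supremum is the last one before `a`.
    obtain ⟨b, ⟨hbA, hba⟩, hb⟩ := exists_lt_of_lt_csSup hne
      (show sSup (A ∩ Iio a) - τ < sSup (A ∩ Iio a) by linarith)
    have hba' : b < a := hba
    have hmax : ∀ c ∈ A, c < a → c ≤ b := fun c hc hca => by
      by_contra! hbc
      have h1 := ht.separated b hbA c hc hbc
      have h2 := le_csSup hbdd (⟨hc, hca⟩ : c ∈ A ∩ Iio a)
      linarith
    have hsep := ht.separated b hbA a ha hba'
    obtain ⟨hfin, hbd⟩ := ih b hbA (by push_cast at hle; linarith)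
    have hins : A ∩ Iio a = insert b (A ∩ Iio b) := by
      ext c
      constructor
      · rintro ⟨hcA, hca⟩
        rcases (hmax c hcA hca).eq_or_lt with rfl | hlt
        · exact mem_insert _ _
        · exact mem_insert_of_mem _ ⟨hcA, hlt⟩
      · rintro (rfl | ⟨hcA, hcb⟩)
        · exact ⟨hbA, hba⟩
        · exact ⟨hcA, lt_trans hcb hba'⟩
    have hcard : (A ∩ Iio a).ncard = (A ∩ Iio b).ncard + 1 := by
      rw [hins]
      exact ncard_insert_of_notMem (fun h1 => lt_irrefl b h1.2) hfin
    have hb0 := ht.start_nonneg b hbA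
    obtain ⟨h1, h2⟩ := follows_of_policy ht (a := b + τ) (b := a) (by linarith)
      fun t hta c hc hmem => by
        have h3 := hmax c hc (hmem.1.trans_lt hta.2)
        linarith [hmem.2, hta.1]
    have hend : H (b + τ) = B.expS (τ • π (H b)) * H b := by
      have := ht.manoeuvre b hbA (b + τ) ⟨by linarith, le_rfl⟩
      rwa [add_sub_cancel_left] at this
    have hdecb := hdec (H b) (ht.start b hbA).2 (hbd.trans (sub_le_self _ (by positivity)))
    rw [← hend] at hdecb
    refine ⟨hins ▸ hfin.insert b, ?_⟩
    rcases hdecb with hC | hC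
    · exact absurd (h.mem_range_of_follows hsep h1 h2 hC) (ht.start a ha).2
    · have h3 := h.curveDist_le_of_follows hsep h1 h2
      rw [hcard]
      push_cast
      linarith

theorem finite_manoeuvres (h : IsGuidance B D Φ Hd kN kT) (hτ : 0 < τ)
    (ht : B.IsPolicyTrajectory (B.Psi D Hd kN kT) (range Hd) (B.P D Hd) π τ A H) {δ : ℝ}
    (hδ : 0 < δ) (hdec : ∀ g, g ∉ range Hd → curveDist D Hd g ≤ curveDist D Hd (H 0) →
      B.expS (τ • π g) * g ∈ range Hd ∨
        curveDist D Hd (B.expS (τ • π g) * g) ≤ curveDist D Hd g - δ) : A.Finite := by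
  by_contra hinf
  obtain ⟨k, hk⟩ := exists_nat_gt (curveDist D Hd (H 0) / δ)
  -- The latest of `k + 1` starts has `k` predecessors, which already cost more than the initial
  -- distance.
  obtain ⟨s, hsA, hcard⟩ := Set.Infinite.exists_subset_card_eq hinf (k + 1)
  have hne : s.Nonempty := Finset.card_pos.1 (by omega)
  set a := s.max' hne
  have haA : a ∈ A := hsA (s.max'_mem hne)
  obtain ⟨N, hN⟩ := exists_nat_ge (a / τ)
  obtain ⟨hfin, hle⟩ := h.curveDist_le_at_start hτ ht hδ hdec N a haA ((div_le_iff₀ hτ).1 hN)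
  have hsub : ((s.erase a : Finset ℝ) : Set ℝ) ⊆ A ∩ Iio a := fun b hb => by
    obtain ⟨hb1, hb2⟩ := Finset.mem_erase.1 (Finset.mem_coe.1 hb)
    exact ⟨hsA hb2, lt_of_le_of_ne (s.le_max' b hb2) hb1⟩
  have h1 := ncard_le_ncard hsub hfin
  rw [ncard_coe_finset, Finset.card_erase_of_mem (s.max'_mem hne), hcard,
    Nat.add_sub_cancel] at h1
  have h2 : (k : ℝ) ≤ (A ∩ Iio a).ncard := by exact_mod_cast h1
  have h3 := h.curveDist_nonneg (H a)
  rw [div_lt_iff₀ hδ] at hk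
  nlinarith

theorem exists_end_of_manoeuvres (h : IsGuidance B D Φ Hd kN kT) (hτ : 0 < τ)
    (ht : B.IsPolicyTrajectory (B.Psi D Hd kN kT) (range Hd) (B.P D Hd) π τ A H) {δ : ℝ}
    (hδ : 0 < δ) (hdec : ∀ g, g ∉ range Hd → curveDist D Hd g ≤ curveDist D Hd (H 0) →
      B.expS (τ • π g) * g ∈ range Hd ∨
        curveDist D Hd (B.expS (τ • π g) * g) ≤ curveDist D Hd g - δ) :
    ∃ t' : ℝ, 0 ≤ t' ∧ (∀ a ∈ A, a + τ ≤ t') ∧ ∀ t, t' ≤ t → H t ∉ B.P D Hd := by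
  obtain ⟨u, hu⟩ := (h.finite_manoeuvres hτ ht hδ hdec).bddAbove
  have h1 : ∀ a ∈ A, a + τ ≤ max 0 (u + τ) := fun a ha =>
    le_max_of_le_right (by linarith [hu ha])
  refine ⟨max 0 (u + τ), le_max_left _ _, h1, fun t htt => ?_⟩
  exact (ht.flow t ((le_max_left _ _).trans htt) fun a ha hmem => by
    linarith [h1 a ha, hmem.2]).1

theorem exists_trajectory_on_curve (h : IsGuidance B D Φ Hd kN kT)
    (π : G → EuclideanSpace ℝ (Fin m)) (τ : ℝ) {g : G} (hg : g ∈ range Hd) : ∃ (A : Set ℝ) (H : ℝ → G), H 0 = g ∧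
      B.IsPolicyTrajectory (B.Psi D Hd kN kT) (range Hd) (B.P D Hd) π τ A H := by
  obtain ⟨K, hK0, hK⟩ := h.exists_solution_on_curve hg
  refine ⟨∅, K, hK0, ⟨?_, by simp, by simp, by simp, by simp, fun t _ _ =>
    ⟨h.notMem_P_of_mem_range (hK t).1, (hK t).2.hasDerivWithinAt⟩⟩⟩
  exact continuousOn_of_hasDerivWithinAt fun t _ => (hK t).2.hasDerivWithinAt

/-- Induction on the number of decreases by `δ` that the distance still permits: flow up to the
closure of the singular set, perform one manoeuvre, and continue from its end. -/
theorem exists_trajectory_of_lt (h : IsGuidance B D Φ Hd kN kT) (hτ : 0 < τ) {c δ : ℝ} (hδ : 0 < δ)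
    (hdec : ∀ g, g ∉ range Hd → curveDist D Hd g ≤ c → B.expS (τ • π g) * g ∈ range Hd ∨
        curveDist D Hd (B.expS (τ • π g) * g) ≤ curveDist D Hd g - δ) (k : ℕ) :
    ∀ g, curveDist D Hd g ≤ c → curveDist D Hd g < k * δ → ∃ (A : Set ℝ) (H : ℝ → G), H 0 = g ∧
      B.IsPolicyTrajectory (B.Psi D Hd kN kT) (range Hd) (B.P D Hd) π τ A H := by
  induction k with
  | zero =>
    intro g _ hlt
    have := h.curveDist_nonneg g
    simp at hlt
    linarith
  | succ k ih =>
    have hman : ∀ g, g ∈ closure (B.P D Hd) → curveDist D Hd g ≤ c →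
        curveDist D Hd g < (k + 1 : ℕ) * δ → ∃ (A : Set ℝ) (H : ℝ → G), H 0 = g ∧
          B.IsPolicyTrajectory (B.Psi D Hd kN kT) (range Hd) (B.P D Hd) π τ A H := by
      intro g hgP hgc hgk
      by_cases hgC : g ∈ range Hd
      · exact h.exists_trajectory_on_curve π τ hgC
      have hnext : ∃ (A : Set ℝ) (H : ℝ → G), H 0 = B.expS (τ • π g) * g ∧
          B.IsPolicyTrajectory (B.Psi D Hd kN kT) (range Hd) (B.P D Hd) π τ A H := by
        rcases hdec g hgC hgc with hC | hC
        · exact h.exists_trajectory_on_curve π τ hC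
        · refine ih _ (by linarith) ?_
          push_cast at hgk
          linarith
      obtain ⟨A, H, hH0, hH⟩ := hnext
      have hK0 : B.expS ((0 : ℝ) • π g) * g = g := by simp
      have hcont : Continuous fun t : ℝ => B.expS (t • π g) * g :=
        (B.continuous_expS.comp (by fun_prop)).mul continuous_const
      refine ⟨_, _, ?_, hH.concat (K := fun t => B.expS (t • π g) * g) (A₀ := {0}) (T := τ) hτ hτ.le
        hcont.continuousOn hH0.symm ?_ ?_ ?_ ?_ ?_⟩
      · simp [hτ.le]
      · rintro _ rfl
        exact ⟨le_rfl, by linarith⟩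
      · rintro _ rfl _ rfl h0
        exact absurd h0 (lt_irrefl _)
      · rintro _ rfl
        simpa only [hK0] using ⟨hgP, hgC⟩
      · rintro _ rfl t _
        simp only [hK0, sub_zero]
      · intro t ht hno
        exact absurd ⟨ht.1, by simpa using ht.2⟩ (hno 0 rfl)
    intro g hgc hgk
    by_cases hgP : g ∈ closure (B.P D Hd)
    · exact hman g hgP hgc hgk
    obtain ⟨K, rfl, hc, hd⟩ := h.exists_flow g (curveDist D Hd g + 1)
    -- The second set is the cut-off of the field. At the first bad time it is excluded, because the
    -- distance has not increased until then.
    set bad : Set ℝ := Ici 0 ∩ K ⁻¹' (closure (B.P D Hd) ∪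
      {g | curveDist D Hd (K 0) + 1 ≤ curveDist D Hd g}) with hbad
    have hclosed : IsClosed bad := hc.preimage_isClosed_of_isClosed isClosed_Ici
      (isClosed_closure.union (isClosed_le continuous_const h.continuous_curveDist))
    have hfol : ∀ t, 0 ≤ t → t ∉ bad → B.FollowsAt (B.Psi D Hd kN kT) (B.P D Hd) K t := by
      intro t ht htb
      have h1 : K t ∉ closure (B.P D Hd) := fun h1 => htb ⟨ht, Or.inl h1⟩
      have h2 : curveDist D Hd (K t) < curveDist D Hd (K 0) + 1 := by
        by_contra! h2
        exact htb ⟨ht, Or.inr h2⟩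
      exact ⟨fun h3 => h1 (subset_closure h3), (hd t ht h1 h2).mono fun s hs => ht.trans hs⟩
    rcases bad.eq_empty_or_nonempty with he | hne
    · exact ⟨∅, K, rfl, ⟨hc, by simp, by simp, by simp, by simp, fun t ht _ =>
        hfol t ht (by simp [he])⟩⟩
    have hbdd : BddBelow bad := ⟨0, fun t ht => ht.1⟩
    have hTmem : sInf bad ∈ bad := hclosed.csInf_mem hne hbdd
    set T := sInf bad
    have hT0 : 0 ≤ T := hTmem.1
    have hfolT : ∀ t ∈ Ico 0 T, B.FollowsAt (B.Psi D Hd kN kT) (B.P D Hd) K t := fun t ht =>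
      hfol t ht.1 fun htb => (csInf_le hbdd htb).not_gt ht.2
    have hcT : ContinuousOn K (Icc 0 T) := hc.mono fun t ht => ht.1
    have hle := h.curveDist_le_of_follows hT0 hcT hfolT
    have hTP : K T ∈ closure (B.P D Hd) := by
      rcases hTmem.2 with h1 | h1
      · exact h1
      · have : curveDist D Hd (K 0) + 1 ≤ curveDist D Hd (K T) := h1
        linarith
    obtain ⟨A, H, hH0, hH⟩ := hman (K T) hTP (hle.trans hgc) (hle.trans_lt hgk)
    exact ⟨_, _, by simp [hT0], hH.concat (K := K) (A₀ := ∅) hτ hT0 hcT hH0.symm (by simp) (by simp)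
      (by simp) (by simp) fun t ht _ => hfolT t ht⟩

/-- The policy is fixed once; only the guaranteed decrease `δ` depends on the initial distance. -/
theorem escapable (h : IsGuidance B D Φ Hd kN kT) {ε : ℝ} (hε : 0 < ε) (hτ : 0 < τ) :
    ∃ π : G → EuclideanSpace ℝ (Fin m), (∀ H, ‖π H‖ ≤ ε) ∧
      (∀ H₀ : G, ∃ (A : Set ℝ) (H : ℝ → G), H 0 = H₀ ∧
        B.IsPolicyTrajectory (B.Psi D Hd kN kT) (range Hd) (B.P D Hd) π τ A H) ∧
      (∀ (A : Set ℝ) (H : ℝ → G),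
        B.IsPolicyTrajectory (B.Psi D Hd kN kT) (range Hd) (B.P D Hd) π τ A H →
        ∃ t' : ℝ, 0 ≤ t' ∧ (∀ a ∈ A, a + τ ≤ t') ∧ ∀ t, t' ≤ t → H t ∉ B.P D Hd) := by
  obtain ⟨π, hπ, hdec⟩ := h.exists_policy hε hτ
  refine ⟨π, hπ, fun g => ?_, fun A H ht => ?_⟩
  · obtain ⟨δ, hδ, hdec'⟩ := hdec (curveDist D Hd g)
    obtain ⟨k, hk⟩ := exists_nat_gt (curveDist D Hd g / δ)
    exact h.exists_trajectory_of_lt hτ hδ hdec' k g le_rfl ((div_lt_iff₀ hδ).1 hk)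
  · obtain ⟨δ, hδ, hdec'⟩ := hdec (curveDist D Hd (H 0))
    exact h.exists_end_of_manoeuvres hτ ht hδ hdec'

end IsGuidance

end GuidanceField

end

theorem theorem1 {n m : ℕ} (G : Subgroup (GL (Fin n) ℝ))
    (hGclosed : IsClosed (G : Set (GL (Fin n) ℝ)))
    (hGconn : IsPathConnected (G : Set (GL (Fin n) ℝ)))
    (B : GuidanceField.LieBasis G m)
    (D : G → G → ℝ) (hD : GuidanceField.IsEEDistance B D)
    (hleft : GuidanceField.IsLeftInvariant D)
    (Φ : ℝ → G → G → G) (hchain : GuidanceField.IsChainable Φ D)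
    (hlin : GuidanceField.IsLocallyLinear Φ D)
    (Hd : ℝ → G) (hHd : GuidanceField.IsProperClosedCurve B Hd)
    (kN kT : G → ℝ) (hgain : GuidanceField.IsGainPair Hd kN kT) :
    -- (i) convergence to the curve (as time tends to infinity) or to the singular set
    (∀ (T : EReal) (H : ℝ → G),
      B.IsMaximalSolution (B.Psi D Hd kN kT) (B.P D Hd) T H →
      (T = ⊤ ∧ GuidanceField.ConvergesTo T H (Set.range Hd)) ∨
        GuidanceField.ConvergesTo T H (B.P D Hd)) ∧
    -- (ii) escape from the singular set by arbitrarily small perturbation twists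
    (∀ ε : ℝ, 0 < ε → ∀ τ : ℝ, 0 < τ →
      ∃ π : G → EuclideanSpace ℝ (Fin m), (∀ H, ‖π H‖ ≤ ε) ∧
        (∀ H₀ : G, ∃ (A : Set ℝ) (H : ℝ → G), H 0 = H₀ ∧
          B.IsPolicyTrajectory (B.Psi D Hd kN kT) (Set.range Hd) (B.P D Hd) π τ A H) ∧
        (∀ (A : Set ℝ) (H : ℝ → G),
          B.IsPolicyTrajectory (B.Psi D Hd kN kT) (Set.range Hd) (B.P D Hd) π τ A H →
          ∃ t' : ℝ, 0 ≤ t' ∧ (∀ a ∈ A, a + τ ≤ t') ∧ ∀ t, t' ≤ t → H t ∉ B.P D Hd)) ∧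
    -- (iii) traversal of the curve
    (∀ (T : EReal) (H : ℝ → G),
      B.IsMaximalSolution (B.Psi D Hd kN kT) (B.P D Hd) T H →
      (GuidanceField.ConvergesTo T H (Set.range Hd) →
        ∃ c : ℝ, 0 < c ∧ ∀ t ∈ GuidanceField.timeDom T, c ≤ ‖kT (H t) • B.xiT D Hd (H t)‖) ∧
      (∀ t₀ ∈ GuidanceField.timeDom T, H t₀ ∈ Set.range Hd →
        T = ⊤ ∧ ∀ t : ℝ, t₀ ≤ t → H t ∈ Set.range Hd ∧
          B.Psi D Hd kN kT (H t) = kT (H t) • B.xiT D Hd (H t) ∧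
          B.Psi D Hd kN kT (H t) ≠ 0)) := by
  have h : GuidanceField.IsGuidance B D Φ Hd kN kT :=
    ⟨hGclosed, hD, hleft, hchain, hlin, hHd, hgain⟩
  exact ⟨fun _ _ hmax => h.convergence hmax, fun _ hε _ hτ => h.escapable hε hτ,
    fun _ _ hmax => ⟨fun _ => h.exists_tangent_bound hmax.1,
      fun _ ht₀ hC => h.traversal hmax ht₀ hC⟩⟩
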